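/- Let $1\le p<\infty$ and $\alpha>-1$. Let $m_\infty$ be the normalised Haar measure of the infinite polytorus $\mathbb{T}^\infty$ and let $\mu_\alpha$ be the probability measure on $(0,\infty)$ with density $h_\alpha(u)=\frac{2^{\alpha+1}}{\Gamma(\alpha+1)}u^\alpha e^{-2u}$. For a Dirichlet polynomial $P(s)=\sum_n a_n n^{-s}$ let $\mathcal{B}P(z)=\sum_n a_n\prod_j z_j^{\alpha_j(n)}$, where $n=\prod_j p_j^{\alpha_j(n)}$ is the prime factorisation of $n$, be its Bohr lift, let $\|P\|_{\mathcal{H}^p}=\|\mathcal{B}P\|_{L^p(\mathbb{T}^\infty,m_\infty)}$, let $P_u(s)=P(u+s)$, and let $$\|P\|_{\mathcal{A}^p_\alpha}=\Big(\int_0^\infty\|P_u\|_{\mathcal{H}^p}^p\,d\mu_\alpha(u)\Big)^{1/p}.$$ Let $\mathcal{A}^p_\alpha$ be the completion of the Dirichlet polynomials in this norm, realised as the closure in $L^p(\mu_\alpha\otimes m_\infty)$ of the functions $(u,z)\mapsto\mathcal{B}(P_u)(z)$. Every $f\in\mathcal{A}^p_\alpha$ is identified with the Dirichlet series $\sum_n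 a_n(f)n^{-s}$, where $a_n(f)$ is the continuous extension of the $n$-th coefficient functional. Let $\mathcal{A}^p_{\alpha,\infty}=\{f\in\mathcal{A}^p_\alpha : a_1(f)=0\}$. For every $s$ with $\sigma=\Re s>1/2$ and every $f\in\mathcal{A}^p_\alpha$ the series $f(s)=\sum_n a_n(f)n^{-s}$ converges absolutely, and $\delta_s(f)=f(s)$ defines a bounded linear functional on $\mathcal{A}^p_\alpha$ and on its subspace $\mathcal{A}^p_{\alpha,\infty}$. Writing $X\approx Y$ if $cY\le X\le CY$ with constants $c,C>0$, we have: 1. for every $a>1/2$, $$\|\delta_s\|_{(\mathcal{A}^p_{\alpha,\infty})^*}\approx\frac{1}{(\sigma-1/2)^{(\alpha+2)/p}}\qquad\text{for all } s \text{ with } \sigma\in(1/2,a);$$ 2. $$\|\delta_s\|_{(\mathcal{A}^p_{\alpha})^*}\approx\Big(\frac{\sigma}{\sigma-1/2}\Big)^{(\alpha+2)/p}\qquad\text{for all } s \text{ with } \sigma>1/2;$$ 3. in particular, $$\|\delta_s\|_{(\mathcal{A}^p_{\alpha,\infty})^*}\approx\|\delta_s\|_{(\mathcal{A}^p_{\alpha})^*}\approx\frac{1}{(\sigma-1/2)^{(\alpha+2)/p}}\qquad\text{as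 }\sigma\to\tfrac12^+,$$ that is, for all $s$ with $1/2<\sigma<b$, for some $b>1/2$. The constants depend only on $p$ and $\alpha$ (and, in 1, on $a$), as does $b$ in 3. -/

import Mathlib

open MeasureTheory Set
open scoped ENNReal

namespace DirichletBergman

noncomputable section

/-! ### The infinite polytorus and Dirichlet polynomials -/

/-- The infinite polytorus, with one circle `ℝ/ℤ` for every prime number. -/
abbrev Polytorus : Type := Nat.Primes → UnitAddCircle

/-- The normalised Haar measure of the infinite polytorus: the product of the normalised
Lebesgue (Haar) measures of the circles. -/
def polytorusMeasure : Measure Polytorus :=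
  Measure.infinitePi fun _ : Nat.Primes => (AddCircle.haarAddCircle : Measure UnitAddCircle)

instance : IsProbabilityMeasure polytorusMeasure := by
  unfold polytorusMeasure; infer_instance

/-- The monomial `z ^ α = ∏ z_p ^ α_p` attached to `n = ∏ p ^ α_p`, where
`z_p = exp (2 π i x_p)` and the prime factors of `n` are taken with multiplicity. In other words,
the value at `n` of the completely multiplicative unimodular character given by the point `x`. -/
def character (n : ℕ+) (x : Polytorus) : ℂ :=
  (Multiset.map (fun p : Nat.Primes => (AddCircle.toCircle (x p) : ℂ)) n.factorMultiset).prod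

/-- A Dirichlet polynomial `∑ aₙ n⁻ˢ`, given by its finitely supported coefficients. -/
abbrev DirichletPolynomial : Type := ℕ+ →₀ ℂ

/-- The Bohr lift of a Dirichlet polynomial. -/
def bohrLift (P : DirichletPolynomial) (x : Polytorus) : ℂ :=
  P.sum fun n a => a * character n x

/-- The horizontal translate `P_σ(s) = P(σ + s)`, with coefficients `aₙ n^(-σ)`. -/
def translate (σ : ℝ) (P : DirichletPolynomial) : DirichletPolynomial :=
  Finsupp.onFinset P.support (fun n => P n * ((n : ℂ) ^ (-(σ : ℂ)))) fun n hn => by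
    rw [Finsupp.mem_support_iff]
    exact left_ne_zero_of_mul hn

/-- The Hardy norm of a Dirichlet polynomial: the `L^p` norm of its Bohr lift. -/
def hardyENorm (p : ℝ≥0∞) (P : DirichletPolynomial) : ℝ≥0∞ :=
  eLpNorm (bohrLift P) p polytorusMeasure

/-! ### The measures `μ_α` -/

/-- The measure on `(0, ∞)` with density `2^(α+1) / Γ(α+1) * σ^α * exp (-2σ)`. -/
def bergmanMeasure (α : ℝ) : Measure ℝ :=
  (volume.restrict (Ioi 0)).withDensity fun σ =>
    ENNReal.ofReal (2 ^ (α + 1) / Real.Gamma (α + 1) * σ ^ α * Real.exp (-(2 * σ)))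

instance (α : ℝ) [hα : Fact (-1 < α)] : IsProbabilityMeasure (bergmanMeasure α) := by
  have h : bergmanMeasure α = ProbabilityTheory.gammaMeasure (α + 1) 2 := by
    rw [bergmanMeasure, ← restrict_withDensity measurableSet_Ioi, ProbabilityTheory.gammaMeasure,
      restrict_withDensity measurableSet_Ioi, ← withDensity_indicator measurableSet_Ioi]
    refine withDensity_congr_ae ?_
    have h0 : ∀ᵐ x : ℝ, x ≠ 0 := by simp [ae_iff]
    filter_upwards [h0] with x hx
    rcases lt_or_gt_of_ne hx with h | h
    · rw [ProbabilityTheory.gammaPDF_of_neg h, indicator_of_notMem (by simpa using h.le)]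
    · rw [ProbabilityTheory.gammaPDF_of_nonneg h.le, indicator_of_mem (by simpa using h),
        add_sub_cancel_right]
  rw [h]
  exact ProbabilityTheory.isProbabilityMeasure_gammaMeasure (by linarith [hα.out]) two_pos

/-- The measure `μ_α ⊗ m_∞` on `ℝ × 𝕋^∞`. -/
abbrev bergmanProd (α : ℝ) : Measure (ℝ × Polytorus) := (bergmanMeasure α).prod polytorusMeasure

/-! ### The Bergman spaces -/

/-- The function `(σ, x) ↦ (Bohr lift of P_σ)(x)`. -/
def bergmanLift (P : DirichletPolynomial) (z : ℝ × Polytorus) : ℂ :=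
  bohrLift (translate z.1 P) z.2

theorem ae_bergmanMeasure (α : ℝ) : ∀ᵐ σ ∂(bergmanMeasure α), 0 < σ :=
  (withDensity_absolutelyContinuous (volume.restrict (Ioi (0 : ℝ))) fun σ =>
    ENNReal.ofReal (2 ^ (α + 1) / Real.Gamma (α + 1) * σ ^ α * Real.exp (-(2 * σ)))).ae_le
    (ae_restrict_mem measurableSet_Ioi)

theorem continuous_character (n : ℕ+) : Continuous (character n) := by
  unfold character
  refine continuous_multiset_prod _ fun p _ => ?_
  have : Continuous fun x : Polytorus => AddCircle.toCircle (x p) :=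
    AddCircle.continuous_toCircle.comp (continuous_apply p)
  exact continuous_subtype_val.comp this

theorem norm_character (n : ℕ+) (x : Polytorus) : ‖character n x‖ = 1 := by
  unfold character
  refine Multiset.induction_on (p := fun s : Multiset Nat.Primes =>
    ‖(Multiset.map (fun p : Nat.Primes => (AddCircle.toCircle (x p) : ℂ)) s).prod‖ = 1) _ ?_ ?_
  · simp
  · intro p s hs
    rw [Multiset.map_cons, Multiset.prod_cons, norm_mul, hs, Circle.norm_coe, one_mul]

theorem bergmanLift_eq (P : DirichletPolynomial) (z : ℝ × Polytorus) :
    bergmanLift P z = P.sum fun n a => a * ((n : ℂ) ^ (-(z.1 : ℂ))) * character n z.2 := by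
  unfold bergmanLift bohrLift translate
  rw [Finsupp.onFinset_sum _ (by simp)]
  rfl

theorem continuous_bergmanLift (P : DirichletPolynomial) : Continuous (bergmanLift P) := by
  have h : bergmanLift P = fun z : ℝ × Polytorus =>
      P.sum fun n a => a * ((n : ℂ) ^ (-(z.1 : ℂ))) * character n z.2 :=
    funext (bergmanLift_eq P)
  rw [h]
  refine continuous_finsetSum _ fun n _ => ?_
  refine Continuous.mul (continuous_const.mul ?_) ((continuous_character n).comp continuous_snd)
  refine Continuous.const_cpow (by fun_prop) (Or.inl ?_)
  exact_mod_cast n.ne_zero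

theorem memLp_bergmanLift (p : ℝ≥0∞) (α : ℝ) [Fact (-1 < α)] (P : DirichletPolynomial) :
    MemLp (bergmanLift P) p (bergmanProd α) := by
  refine MemLp.of_bound (continuous_bergmanLift P).aestronglyMeasurable
    (P.sum fun _ a => ‖a‖) ?_
  have h2 : ∀ᵐ z ∂(bergmanProd α), 0 < z.1 :=
    (Measure.quasiMeasurePreserving_fst (μ := bergmanMeasure α) (ν := polytorusMeasure)).ae
      (ae_bergmanMeasure α)
  filter_upwards [h2] with z hz
  rw [bergmanLift_eq]
  refine (norm_sum_le _ _).trans (Finset.sum_le_sum fun n _ => ?_)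
  rw [norm_mul, norm_mul, norm_character, mul_one]
  refine mul_le_of_le_one_right (norm_nonneg _) ?_
  have hn : (1 : ℝ) ≤ (n : ℕ) := by exact_mod_cast n.pos
  rw [Complex.norm_natCast_cpow_of_pos n.pos]
  exact Real.rpow_le_one_of_one_le_of_nonpos hn (by simpa using hz.le)

/-- A Dirichlet polynomial as an element of `L^p(μ_α ⊗ m_∞)`, through `bergmanLift`. The induced
norm is the Bergman norm of the polynomial, see `enorm_ofPolynomial_rpow`. -/
def ofPolynomial (p : ℝ≥0∞) (α : ℝ) [Fact (-1 < α)] :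
    DirichletPolynomial →ₗ[ℂ] Lp ℂ p (bergmanProd α) where
  toFun P := (memLp_bergmanLift p α P).toLp (bergmanLift P)
  map_add' P Q := by
    rw [← MemLp.toLp_add]
    congr 1
    funext z
    simp only [Pi.add_apply, bergmanLift_eq]
    exact Finsupp.sum_add_index' (by simp) (by intros; ring)
  map_smul' c P := by
    rw [RingHom.id_apply, ← MemLp.toLp_const_smul]
    congr 1
    funext z
    simp only [Pi.smul_apply, bergmanLift_eq, smul_eq_mul]
    rw [Finsupp.sum_smul_index' (by simp), Finsupp.mul_sum]
    simp only [smul_eq_mul, mul_assoc]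

/-- The norm of a Dirichlet polynomial is `(∫ ‖P_σ‖_{H^p}^p dμ_α(σ))^{1/p}`. -/
theorem enorm_ofPolynomial_rpow (p : ℝ≥0∞) [hp1 : Fact (1 ≤ p)] (hp : p ≠ ∞)
    (α : ℝ) [Fact (-1 < α)] (P : DirichletPolynomial) :
    ‖ofPolynomial p α P‖ₑ ^ p.toReal =
      ∫⁻ σ, hardyENorm p (translate σ P) ^ p.toReal ∂(bergmanMeasure α) := by
  have hp0 : p ≠ 0 := (zero_lt_one.trans_le hp1.out).ne'
  have hpr : p.toReal ≠ 0 := (ENNReal.toReal_pos hp0 hp).ne'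
  have key : ∀ {Ω : Type} [MeasurableSpace Ω] (ν : Measure Ω) (f : Ω → ℂ),
      eLpNorm f p ν ^ p.toReal = ∫⁻ x, ‖f x‖ₑ ^ p.toReal ∂ν := by
    intro Ω _ ν f
    rw [eLpNorm_eq_lintegral_rpow_enorm_toReal hp0 hp, ← ENNReal.rpow_mul,
      one_div_mul_cancel hpr, ENNReal.rpow_one]
  change ‖(memLp_bergmanLift p α P).toLp (bergmanLift P)‖ₑ ^ p.toReal = _
  rw [Lp.enorm_toLp, key, lintegral_prod]
  · refine lintegral_congr fun σ => ?_
    rw [hardyENorm, key]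
    rfl
  · exact ((continuous_bergmanLift P).measurable.enorm.pow_const _).aemeasurable

/-- The Bergman space of Dirichlet series: the closure of the Dirichlet polynomials. Its elements
are identified with Dirichlet series through `dirichletCoeff`. -/
def bergmanSpace (p : ℝ≥0∞) [Fact (1 ≤ p)] (α : ℝ) [Fact (-1 < α)] :
    Submodule ℂ (Lp ℂ p (bergmanProd α)) :=
  (LinearMap.range (ofPolynomial p α)).topologicalClosure

theorem integrable_mul_conj_character (p : ℝ≥0∞) [hp : Fact (1 ≤ p)] (α : ℝ) [Fact (-1 < α)]
    (n : ℕ+) (f : Lp ℂ p (bergmanProd α)) :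
    Integrable (fun z : ℝ × Polytorus => f z * (starRingEnd ℂ) (character n z.2))
      (bergmanProd α) := by
  have h1 : Integrable f (bergmanProd α) := (Lp.memLp f).integrable hp.out
  refine h1.mul_bdd (c := 1) ?_ (ae_of_all _ fun z => ?_)
  · exact (Complex.continuous_conj.comp
      ((continuous_character n).comp continuous_snd)).aestronglyMeasurable
  · rw [RCLike.norm_conj, norm_character]

/-- The `n`-th Dirichlet coefficient: the `n`-th Fourier coefficient of `f(σ, ·)`, which is
`aₙ n^(-σ)`, averaged over `σ` and divided by the average of `n^(-σ)`. -/
def dirichletCoeff (p : ℝ≥0∞) [Fact (1 ≤ p)] (α : ℝ) [Fact (-1 < α)] (n : ℕ+) :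
    Lp ℂ p (bergmanProd α) →ₗ[ℂ] ℂ where
  toFun f := (∫ σ : ℝ, ((n : ℂ) ^ (-(σ : ℂ))) ∂(bergmanMeasure α))⁻¹ *
    ∫ z, f z * (starRingEnd ℂ) (character n z.2) ∂(bergmanProd α)
  map_add' f g := by
    rw [← mul_add, ← integral_add (integrable_mul_conj_character p α n f)
      (integrable_mul_conj_character p α n g)]
    congr 1
    refine integral_congr_ae ?_
    filter_upwards [Lp.coeFn_add f g] with z hz
    rw [hz, Pi.add_apply, add_mul]
  map_smul' c f := by
    rw [RingHom.id_apply, smul_eq_mul, mul_left_comm]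
    congr 1
    refine Eq.trans (integral_congr_ae ?_) (integral_const_mul c _)
    filter_upwards [Lp.coeFn_smul c f] with z hz
    rw [hz, Pi.smul_apply, smul_eq_mul, mul_assoc]

theorem character_add (n : ℕ+) (x t : Polytorus) :
    character n (x + t) = character n x * character n t := by
  simp only [character, Pi.add_apply, AddCircle.toCircle_add, Circle.coe_mul]
  exact Multiset.prod_map_mul

theorem exists_character_ne {n m : ℕ+} (h : n ≠ m) : ∃ t, character n t ≠ character m t := by
  classical
  by_contra! hc
  apply h
  apply PNat.factorMultisetEquiv.injective
  change n.factorMultiset = m.factorMultiset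
  obtain ⟨r, hr⟩ := exists_irrational_btwn (zero_lt_one (α := ℝ))
  have hfin : ¬ IsOfFinAddOrder ((r : ℝ) : UnitAddCircle) := by
    rw [AddCircle.not_isOfFinAddOrder_iff_forall_rat_ne_div]
    intro q hq
    exact hr.1 ⟨q, by simpa using hq⟩
  have hch : ∀ (k : ℕ+) (q : Nat.Primes), character k (Pi.single q (r : UnitAddCircle)) =
      (AddCircle.toCircle ((Multiset.count q (k.factorMultiset : Multiset Nat.Primes)) •
        (r : UnitAddCircle)) : ℂ) := by
    intro k q
    unfold character
    generalize (k.factorMultiset : Multiset Nat.Primes) = s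
    induction s using Multiset.induction_on with
    | empty => simp
    | cons a s ih =>
      rw [Multiset.map_cons, Multiset.prod_cons, ih]
      by_cases hqa : a = q
      · subst hqa
        simp [add_smul, AddCircle.toCircle_add, mul_comm]
      · simp [hqa, Ne.symm hqa]
  refine (Multiset.ext (s := n.factorMultiset) (t := m.factorMultiset)).2 fun q => ?_
  have h1 := hc (Pi.single q (r : UnitAddCircle))
  rw [hch, hch] at h1
  have h2 := AddCircle.injective_toCircle one_ne_zero (Circle.coe_injective h1)
  exact injective_nsmul_iff_not_isOfFinAddOrder.2 hfin h2

/-- The characters are orthonormal. -/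
theorem integral_character_mul_conj (n m : ℕ+) :
    ∫ x, character n x * (starRingEnd ℂ) (character m x) ∂polytorusMeasure =
      if n = m then 1 else 0 := by
  split_ifs with h
  · subst h
    simp [Complex.mul_conj, Complex.normSq_eq_norm_sq, norm_character]
  · obtain ⟨t, ht⟩ := exists_character_ne h
    have hmap : polytorusMeasure.map (fun x => x + t) = polytorusMeasure := by
      unfold polytorusMeasure
      have := Measure.infinitePi_map_pi
        (fun _ : Nat.Primes => (AddCircle.haarAddCircle : Measure UnitAddCircle))
        (f := fun i y => y + t i) (fun i => measurable_add_const (t i))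
      simp only [map_add_right_eq_self] at this
      exact this
    set F : Polytorus → ℂ := fun x => character n x * (starRingEnd ℂ) (character m x) with hF
    have hc : Continuous F :=
      (continuous_character n).mul (Complex.continuous_conj.comp (continuous_character m))
    have h1 : ∫ x, F x ∂polytorusMeasure = (∫ x, F x ∂polytorusMeasure) * F t := by
      conv_lhs => rw [← hmap, integral_map (measurable_add_const t).aemeasurable
        hc.aestronglyMeasurable]
      rw [← integral_mul_const]
      refine integral_congr_ae (ae_of_all _ fun x => ?_)
      simp only [hF, character_add, map_mul]
      ring
    have h2 : F t ≠ 1 := by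
      intro h3
      apply ht
      have h4 : (starRingEnd ℂ) (character m t) * character m t = 1 := by
        rw [mul_comm, Complex.mul_conj, Complex.normSq_eq_norm_sq, norm_character]
        simp
      calc character n t = F t * character m t := by simp only [hF]; rw [mul_assoc, h4, mul_one]
        _ = character m t := by rw [h3, one_mul]
    by_contra h5
    exact h2 (mul_left_cancel₀ h5 (by rw [← h1, mul_one]))

theorem integrable_cpow (α : ℝ) [Fact (-1 < α)] (n : ℕ+) :
    Integrable (fun σ : ℝ => ((n : ℂ) ^ (-(σ : ℂ)))) (bergmanMeasure α) := by
  refine Integrable.of_bound (C := 1) ?_ ?_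
  · exact (Continuous.const_cpow (by fun_prop)
      (Or.inl (by exact_mod_cast n.ne_zero))).aestronglyMeasurable
  · filter_upwards [ae_bergmanMeasure α] with σ hσ
    have hn : (1 : ℝ) ≤ (n : ℕ) := by exact_mod_cast n.pos
    rw [Complex.norm_natCast_cpow_of_pos n.pos]
    exact Real.rpow_le_one_of_one_le_of_nonpos hn (by simpa using hσ.le)

theorem integral_cpow_ne_zero (α : ℝ) [Fact (-1 < α)] (n : ℕ+) :
    ∫ σ : ℝ, ((n : ℂ) ^ (-(σ : ℂ))) ∂(bergmanMeasure α) ≠ 0 := by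
  have hn : (0 : ℝ) < (n : ℕ) := by exact_mod_cast n.pos
  have h : ∀ σ : ℝ, ((n : ℂ) ^ (-(σ : ℂ))) = (((n : ℕ) : ℝ) ^ (-σ) : ℝ) := fun σ => by
    rw [Complex.ofReal_cpow hn.le]; simp
  have hi := (integrable_cpow α n).norm
  simp only [h, integral_complex_ofReal]
  simp only [h, Complex.norm_real, Real.norm_eq_abs, abs_of_pos (Real.rpow_pos_of_pos hn _)] at hi
  rw [Complex.ofReal_ne_zero]
  refine ((integral_pos_iff_support_of_nonneg (fun σ => (Real.rpow_pos_of_pos hn _).le) hi).2 ?_).ne'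
  have : (Function.support fun σ : ℝ => ((n : ℕ) : ℝ) ^ (-σ)) = univ :=
    eq_univ_of_forall fun σ => (Real.rpow_pos_of_pos hn _).ne'
  rw [this, measure_univ]
  exact one_pos

/-- On Dirichlet polynomials, `dirichletCoeff` returns the coefficients. -/
theorem dirichletCoeff_ofPolynomial (p : ℝ≥0∞) [Fact (1 ≤ p)] (α : ℝ) [Fact (-1 < α)]
    (n : ℕ+) (P : DirichletPolynomial) :
    dirichletCoeff p α n (ofPolynomial p α P) = P n := by
  induction P using Finsupp.induction_linear with
  | zero => simp
  | add P Q hP hQ => rw [map_add, map_add, hP, hQ, Finsupp.add_apply]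
  | single m a =>
    change (∫ σ : ℝ, ((n : ℂ) ^ (-(σ : ℂ))) ∂(bergmanMeasure α))⁻¹ *
      ∫ z, ((memLp_bergmanLift p α (Finsupp.single m a)).toLp _ : _ → ℂ) z *
        (starRingEnd ℂ) (character n z.2) ∂(bergmanProd α) = _
    have h : ∫ z, ((memLp_bergmanLift p α (Finsupp.single m a)).toLp _ : _ → ℂ) z *
        (starRingEnd ℂ) (character n z.2) ∂(bergmanProd α) =
        ∫ z : ℝ × Polytorus, (a * ((m : ℂ) ^ (-(z.1 : ℂ)))) *
          (character m z.2 * (starRingEnd ℂ) (character n z.2)) ∂(bergmanProd α) := by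
      refine integral_congr_ae ?_
      filter_upwards [(memLp_bergmanLift p α (Finsupp.single m a)).coeFn_toLp] with z hz
      rw [hz, bergmanLift_eq, Finsupp.sum_single_index (by simp), mul_assoc]
    rw [h, integral_prod_mul (fun σ : ℝ => a * ((m : ℂ) ^ (-(σ : ℂ))))
      (fun x => character m x * (starRingEnd ℂ) (character n x)), integral_character_mul_conj,
      integral_const_mul]
    by_cases hmn : m = n
    · subst hmn
      rw [if_pos rfl, Finsupp.single_eq_same]
      field_simp [integral_cpow_ne_zero α m]
    · rw [if_neg hmn, mul_zero, mul_zero, Finsupp.single_eq_of_ne (Ne.symm hmn)]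

/-- The subspace of the Dirichlet series whose first coefficient is zero. -/
def bergmanSpaceInfty (p : ℝ≥0∞) [Fact (1 ≤ p)] (α : ℝ) [Fact (-1 < α)] :
    Submodule ℂ (Lp ℂ p (bergmanProd α)) :=
  bergmanSpace p α ⊓ LinearMap.ker (dirichletCoeff p α 1)

/-- The bounded functional `δ` on `X` is evaluation at `s`: for every `f` in `X` the Dirichlet
series of `f` converges (absolutely) at `s` and `δ f` is its sum. -/
def IsPointEvaluation {p : ℝ≥0∞} [Fact (1 ≤ p)] {α : ℝ} [Fact (-1 < α)]
    (X : Submodule ℂ (Lp ℂ p (bergmanProd α))) (s : ℂ) (δ : X →L[ℂ] ℂ) : Prop :=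
  ∀ f : X, HasSum (fun n : ℕ+ => dirichletCoeff p α n (f : Lp ℂ p (bergmanProd α)) *
    ((n : ℂ) ^ (-s))) (δ f)

end

end DirichletBergman

namespace DirichletBergman

noncomputable section

/-! ### Analytic trigonometric polynomials on the circle -/

/-! Write `d = Re s - 1/2`. The upper bound comes from Hardy spaces. On one circle, evaluation at
`w` is integration against a kernel `K` with `|K| = (1 - |w|²)^(-1/p) W^(1 - 1/p)`, where `W` is the
Poisson kernel (`exists_evaluation_kernel`). Taking the product over primes with `w_q = q^(-s)` and
applying Hölder gives `|P(s)|^p ≤ ζ(2 Re s) ‖P‖^p` in `H^p`. This is applied to `P_u` at `s - u` for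
`0 < u ≤ t`, with `t` comparable to `d` near the critical line. There the zeta factor is at most
`1/t`, while `μ_α((0, t])` is at least a multiple of `t^(α+1)`, so averaging gives the exponent `α +
2` (`exists_norm_polyEval_le`).

Absolute convergence needs separate control of the coefficients. Dilation by `r` with `r² ≤ 1/5` is
a contraction from `H^1` to `H^2` of the disc. Minkowski's inequality tensorises this over the
primes; only finitely many `q` have `q^(-2ε) > 1/5`, and these cost a finite constant. So
translation by any `ε > 0` maps `H^1` into `H^2` (`exists_sum_sq_coeff_le`), and Cauchy–Schwarz
finishes.

For the lower bound the test functions are finite versions of `ζ(w + conj s)^(2/p) (-ζ'/ζ (w + conj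
s))^k` with `k ≥ 1`, whose first coefficient vanishes because `Λ(1) = 0`. The factor `ζ` is replaced
by the exponential of a finite prime sum, and `-ζ'/ζ` by a finite sum with weights `Λ(n)`; no bound
on the norm depends on the truncation. The `p`-th power of the modulus is `|ζ|² |ζ'/ζ|^(kp)`. Its
mean over the torus is controlled by the `H^2` norms of `ζ` and `ζ (ζ'/ζ)^m`, whose coefficients are
dominated by `1` and `(log n)^m` times the twist. This gives at most a multiple of `(1 + 1/(d +
u))^(kp + 1)`, and integration against `μ_α` gives `d^(α - kp)` once `kp > α`
(`exists_lintegral_test_le`). At `s` the argument `s + conj s = 2 Re s` is real, and the `p`-th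
power of the value is at least a multiple of `d^(-2 - kp)`. The quotient is `d^(-(α + 2))`
(`exists_le_norm_pointEvaluation_near`). Away from the critical line, `2^(-s)` and the constant `1`
suffice as test functions. -/

theorem continuous_coe_toCircle :
    Continuous fun t : UnitAddCircle => (AddCircle.toCircle t : ℂ) :=
  continuous_subtype_val.comp AddCircle.continuous_toCircle

theorem integral_toCircle_pow_mul_conj_pow (j k : ℕ) :
    ∫ t : UnitAddCircle, (AddCircle.toCircle t : ℂ) ^ j *
      (starRingEnd ℂ) ((AddCircle.toCircle t : ℂ) ^ k) ∂AddCircle.haarAddCircle =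
      if j = k then 1 else 0 := by
  have h : ∀ t : UnitAddCircle, (AddCircle.toCircle t : ℂ) ^ j *
      (starRingEnd ℂ) ((AddCircle.toCircle t : ℂ) ^ k) = fourier ((j : ℤ) - k) t := by
    intro t
    rw [sub_eq_add_neg, fourier_add, fourier_neg, fourier_apply, fourier_apply, natCast_zsmul,
      natCast_zsmul, AddCircle.toCircle_nsmul, AddCircle.toCircle_nsmul]
    simp
  simp only [h]
  split_ifs with hjk
  · simp [hjk]
  · have hn : (j : ℤ) - k ≠ 0 := by omega
    exact integral_eq_zero_of_add_right_eq_neg (μ := AddCircle.haarAddCircle)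
      (fourier_add_half_inv_index hn one_pos)

theorem integrable_of_continuous_circle {E : Type*} [NormedAddCommGroup E]
    {f : UnitAddCircle → E} (hf : Continuous f) :
    Integrable f AddCircle.haarAddCircle :=
  hf.integrable_of_hasCompactSupport (HasCompactSupport.of_compactSpace f)

theorem integral_sum_mul_conj_pow (N : ℕ) (a : ℕ → ℂ) (k : ℕ) :
    ∫ t : UnitAddCircle, (∑ j ∈ Finset.range N, a j * (AddCircle.toCircle t : ℂ) ^ j) *
      (starRingEnd ℂ) ((AddCircle.toCircle t : ℂ) ^ k) ∂AddCircle.haarAddCircle =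
      if k < N then a k else 0 := by
  have hc := continuous_coe_toCircle
  simp_rw [Finset.sum_mul, mul_assoc]
  rw [integral_finsetSum]
  · simp_rw [integral_const_mul, integral_toCircle_pow_mul_conj_pow]
    simp
  · intro j _
    exact integrable_of_continuous_circle (by fun_prop)

theorem integral_conj_sum_mul_conj_pow (N : ℕ) (a : ℕ → ℂ) {k : ℕ} (hk : k ≠ 0) :
    ∫ t : UnitAddCircle,
      (starRingEnd ℂ) (∑ j ∈ Finset.range N, a j * (AddCircle.toCircle t : ℂ) ^ j) *
      (starRingEnd ℂ) ((AddCircle.toCircle t : ℂ) ^ k) ∂AddCircle.haarAddCircle = 0 := by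
  have hc := continuous_coe_toCircle
  have h : ∀ t : UnitAddCircle,
      (starRingEnd ℂ) (∑ j ∈ Finset.range N, a j * (AddCircle.toCircle t : ℂ) ^ j) *
      (starRingEnd ℂ) ((AddCircle.toCircle t : ℂ) ^ k) =
      ∑ j ∈ Finset.range N, (starRingEnd ℂ) (a j) * ((AddCircle.toCircle t : ℂ) ^ 0 *
        (starRingEnd ℂ) ((AddCircle.toCircle t : ℂ) ^ (j + k))) := by
    intro t
    rw [map_sum, Finset.sum_mul]
    refine Finset.sum_congr rfl fun j _ => ?_
    rw [pow_add]
    simp only [map_mul, pow_zero, one_mul]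
    ring
  simp only [h]
  rw [integral_finsetSum]
  · refine Finset.sum_eq_zero fun j _ => ?_
    rw [integral_const_mul, integral_toCircle_pow_mul_conj_pow, if_neg (by omega), mul_zero]
  · intro j _
    exact integrable_of_continuous_circle (by fun_prop)

/-- For an analytic trigonometric polynomial, the higher coefficients are controlled by the
difference between the `L¹` norm and the mean. -/
theorem norm_sq_coeff_le_of_nonneg (N : ℕ) (a : ℕ → ℂ) (m : ℝ) (ha : a 0 = m) (hN : 0 < N)
    {k : ℕ} (hk : k ≠ 0) (hkN : k < N) :
    ‖a k‖ ^ 2 ≤ 4 * ((∫ t : UnitAddCircle,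
      ‖∑ j ∈ Finset.range N, a j * (AddCircle.toCircle t : ℂ) ^ j‖ ∂AddCircle.haarAddCircle) ^ 2
        - m ^ 2) := by
  have hc := continuous_coe_toCircle
  set f : UnitAddCircle → ℂ := fun t =>
    ∑ j ∈ Finset.range N, a j * (AddCircle.toCircle t : ℂ) ^ j with hf
  have hfc : Continuous f := by fun_prop
  set M := ∫ t, ‖f t‖ ∂(AddCircle.haarAddCircle : Measure UnitAddCircle)
  set I := ∫ t, |(f t).im| ∂(AddCircle.haarAddCircle : Measure UnitAddCircle)
  have hre : ∫ t, (f t).re ∂(AddCircle.haarAddCircle : Measure UnitAddCircle) = m := by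
    have h0 := integral_sum_mul_conj_pow N a 0
    simp only [pow_zero, map_one, mul_one, if_pos hN] at h0
    have h1 := integral_re (𝕜 := ℂ) (integrable_of_continuous_circle hfc)
    have h2 : ∫ t, f t ∂(AddCircle.haarAddCircle : Measure UnitAddCircle) = m := by
      rw [← ha, ← h0]
    rw [h2] at h1
    simpa using h1
  -- Subtracting the conjugate of `f` does not change the `k`-th coefficient for `k ≠ 0`, since the
  -- conjugate has no positive frequencies; only the imaginary part of `f` remains.
  have him : ‖a k‖ ≤ 2 * I := by
    have h1 := integral_sum_mul_conj_pow N a k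
    have h2 := integral_conj_sum_mul_conj_pow N a hk
    rw [if_pos hkN] at h1
    rw [← sub_zero (a k), ← h1, ← h2, ← integral_sub
      (integrable_of_continuous_circle (by fun_prop))
      (integrable_of_continuous_circle (by fun_prop)), ← integral_const_mul]
    refine norm_integral_le_of_norm_le (integrable_of_continuous_circle (by fun_prop))
      (ae_of_all _ fun t => ?_)
    change ‖f t * _ - (starRingEnd ℂ) (f t) * _‖ ≤ _
    rw [← sub_mul, norm_mul, RCLike.norm_conj, norm_pow, Circle.norm_coe, one_pow, mul_one,
      Complex.sub_conj]
    simp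
  -- Cauchy–Schwarz for `|Im f| = √(|f| - Re f) √(|f| + Re f)`, in discriminant form: the quadratic
  -- is the integral of a square, so `I² ≤ (M - m)(M + m)`.
  have hquad : ∀ x : ℝ, 0 ≤ (M - m) * (x * x) + (-2 * I) * x + (M + m) := by
    intro x
    have h1 : (M - m) * (x * x) + (-2 * I) * x + (M + m) =
        ∫ t, ((x * x) * (‖f t‖ - (f t).re) - (2 * x) * |(f t).im| + (‖f t‖ + (f t).re))
          ∂(AddCircle.haarAddCircle : Measure UnitAddCircle) := by
      rw [integral_add, integral_sub, integral_const_mul, integral_const_mul, integral_sub,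
        integral_add, hre]
      · ring
      all_goals exact integrable_of_continuous_circle (by fun_prop)
    rw [h1]
    refine integral_nonneg fun t => ?_
    have hn : ‖f t‖ ^ 2 = (f t).re ^ 2 + |(f t).im| ^ 2 := by
      rw [Complex.sq_norm, Complex.normSq_apply, sq_abs]; ring
    have hA : 0 ≤ ‖f t‖ - (f t).re := sub_nonneg.2 (Complex.re_le_norm _)
    have hB : 0 ≤ ‖f t‖ + (f t).re := by
      linarith [neg_le_of_abs_le (Complex.abs_re_le_norm (f t))]
    have hs : |(f t).im| = √(‖f t‖ - (f t).re) * √(‖f t‖ + (f t).re) := by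
      rw [← Real.sqrt_mul hA, eq_comm, Real.sqrt_eq_iff_mul_self_eq (by nlinarith) (abs_nonneg _)]
      linarith
    have := sq_nonneg (x * √(‖f t‖ - (f t).re) - √(‖f t‖ + (f t).re))
    change 0 ≤ _
    rw [hs]
    nlinarith [Real.sq_sqrt hA, Real.sq_sqrt hB]
  have hd := discrim_le_zero hquad
  rw [discrim] at hd
  have hI : 0 ≤ I := integral_nonneg fun t => abs_nonneg _
  nlinarith [norm_nonneg (a k)]

/-- A unimodular factor makes the mean nonnegative without changing any modulus. -/
theorem norm_sq_coeff_le (N : ℕ) (a : ℕ → ℂ) (hN : 0 < N) {k : ℕ} (hk : k ≠ 0) (hkN : k < N) :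
    ‖a k‖ ^ 2 ≤ 4 * ((∫ t : UnitAddCircle,
      ‖∑ j ∈ Finset.range N, a j * (AddCircle.toCircle t : ℂ) ^ j‖ ∂AddCircle.haarAddCircle) ^ 2
        - ‖a 0‖ ^ 2) := by
  obtain ⟨c, hc, hca⟩ : ∃ c : ℂ, ‖c‖ = 1 ∧ c * a 0 = ‖a 0‖ := by
    by_cases h0 : a 0 = 0
    · exact ⟨1, by simp, by simp [h0]⟩
    · have hn : (‖a 0‖ : ℂ) ≠ 0 := by simpa using h0
      refine ⟨‖a 0‖ / a 0, by simp [h0], by field_simp⟩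
  have h := norm_sq_coeff_le_of_nonneg N (fun j => c * a j) ‖a 0‖ hca hN hk hkN
  simpa only [mul_assoc, ← Finset.mul_sum, norm_mul, hc, one_mul] using h

theorem norm_coeff_le (N : ℕ) (a : ℕ → ℂ) {k : ℕ} (hkN : k < N) :
    ‖a k‖ ≤ ∫ t : UnitAddCircle,
      ‖∑ j ∈ Finset.range N, a j * (AddCircle.toCircle t : ℂ) ^ j‖ ∂AddCircle.haarAddCircle := by
  have hc := continuous_coe_toCircle
  have h1 := integral_sum_mul_conj_pow N a k
  rw [if_pos hkN] at h1
  rw [← h1]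
  refine norm_integral_le_of_norm_le (integrable_of_continuous_circle (by fun_prop))
      (ae_of_all _ fun t => ?_)
  rw [norm_mul, RCLike.norm_conj, norm_pow, Circle.norm_coe, one_pow, mul_one]

/-- The constant of the `H¹ → H²` bound for dilation by `r`. -/
def dilationConst (r : ℝ) : ℝ := if r ^ 2 ≤ 1 / 5 then 1 else (1 - r ^ 2)⁻¹

theorem dilationConst_pos {r : ℝ} (h0 : 0 ≤ r) (hr : r < 1) : 0 < dilationConst r := by
  unfold dilationConst
  split_ifs
  · exact one_pos
  · exact inv_pos.2 (by nlinarith)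

/-- For small `r` the terms with `k ≥ 1` are absorbed by the gap `M² - |a 0|²`, which leaves
constant exactly `1`; this is what survives an infinite product over primes. For the other `r` the
trivial bound `|a k| ≤ M` and a geometric series are enough. -/
theorem sum_sq_pow_mul_le (r : ℝ) (h0 : 0 ≤ r) (hr : r < 1) (N : ℕ) (a : ℕ → ℂ) :
    ∑ k ∈ Finset.range N, (r ^ k * ‖a k‖) ^ 2 ≤ dilationConst r * (∫ t : UnitAddCircle,
      ‖∑ j ∈ Finset.range N, a j * (AddCircle.toCircle t : ℂ) ^ j‖
        ∂AddCircle.haarAddCircle) ^ 2 := by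
  rcases Nat.eq_zero_or_pos N with rfl | hN
  · simp
  obtain ⟨N, rfl⟩ := Nat.exists_eq_add_of_lt hN
  simp only [zero_add] at *
  set M := ∫ t : UnitAddCircle,
      ‖∑ j ∈ Finset.range (N + 1), a j * (AddCircle.toCircle t : ℂ) ^ j‖ ∂AddCircle.haarAddCircle
    with hM
  have hM0 : 0 ≤ M := integral_nonneg fun t => norm_nonneg _
  have hr2 : r ^ 2 < 1 := by nlinarith
  have hgeom : ∀ n, ∑ k ∈ Finset.range n, (r ^ 2) ^ k ≤ (1 - r ^ 2)⁻¹ := by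
    intro n
    rw [← tsum_geometric_of_lt_one (sq_nonneg r) hr2]
    exact (summable_geometric_of_lt_one (sq_nonneg r) hr2).sum_le_tsum _
      fun _ _ => by positivity
  unfold dilationConst
  split_ifs with h
  · rw [Finset.sum_range_succ']
    have ha0 : ‖a 0‖ ≤ M := norm_coeff_le (N + 1) a (by omega)
    have hD : 0 ≤ M ^ 2 - ‖a 0‖ ^ 2 := by nlinarith [norm_nonneg (a 0)]
    have h1 : ∀ k ∈ Finset.range N, (r ^ (k + 1) * ‖a (k + 1)‖) ^ 2 ≤
        (r ^ 2) ^ k * (r ^ 2 * (4 * (M ^ 2 - ‖a 0‖ ^ 2))) := by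
      intro k hk
      rw [Finset.mem_range] at hk
      have := norm_sq_coeff_le (N + 1) a (by omega) (Nat.succ_ne_zero k) (by omega)
      calc (r ^ (k + 1) * ‖a (k + 1)‖) ^ 2 = (r ^ 2) ^ k * (r ^ 2 * ‖a (k + 1)‖ ^ 2) := by ring
        _ ≤ _ := by gcongr
    have h2 := Finset.sum_le_sum h1
    rw [← Finset.sum_mul] at h2
    have h3 : (∑ k ∈ Finset.range N, (r ^ 2) ^ k) * (r ^ 2 * (4 * (M ^ 2 - ‖a 0‖ ^ 2))) ≤
        (1 - r ^ 2)⁻¹ * (r ^ 2 * (4 * (M ^ 2 - ‖a 0‖ ^ 2))) := by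
      gcongr
      exact hgeom N
    -- Here `4 r² ≤ 1 - r²` is the origin of the threshold `1/5`.
    have h4 : (1 - r ^ 2)⁻¹ * (r ^ 2 * (4 * (M ^ 2 - ‖a 0‖ ^ 2))) ≤ M ^ 2 - ‖a 0‖ ^ 2 := by
      rw [inv_mul_le_iff₀ (by linarith)]
      nlinarith
    simp only [pow_zero, one_mul]
    linarith
  · calc ∑ k ∈ Finset.range (N + 1), (r ^ k * ‖a k‖) ^ 2
        ≤ ∑ k ∈ Finset.range (N + 1), (r ^ 2) ^ k * M ^ 2 := by
          refine Finset.sum_le_sum fun k hk => ?_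
          have := norm_coeff_le (N + 1) a (Finset.mem_range.1 hk)
          calc (r ^ k * ‖a k‖) ^ 2 = (r ^ 2) ^ k * ‖a k‖ ^ 2 := by ring
            _ ≤ _ := by gcongr
      _ ≤ _ := by
          rw [← Finset.sum_mul]
          gcongr
          exact hgeom _

/-! ### Point evaluations on the circle -/

theorem integral_circle_eq_circleAverage (f : ℂ → ℂ) :
    ∫ t : UnitAddCircle, f (AddCircle.toCircle t) ∂AddCircle.haarAddCircle =
      Real.circleAverage f 0 1 := by
  rw [AddCircle.integral_haarAddCircle, inv_one, one_smul,
    ← UnitAddCircle.intervalIntegral_preimage 0, Real.circleAverage_def]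
  have h : ∀ x : ℝ, f (AddCircle.toCircle (x : UnitAddCircle)) =
      (fun θ => f (circleMap 0 1 θ)) (x * (2 * Real.pi)) := by
    intro x
    rw [AddCircle.toCircle_apply_mk, Circle.coe_exp]
    simp only [circleMap, div_one, zero_add, Complex.ofReal_one, one_mul]
    congr 3
    push_cast
    ring
  simp only [h, zero_add]
  rw [intervalIntegral.integral_comp_mul_right (fun θ => f (circleMap 0 1 θ)) (by positivity)]
  simp

/-- The kernel is `K = W H^(2r)` with `W` the Poisson kernel at `w` and `H(z) = (1 - conj w z)/(1 -
|w|²)`. Since `z^k H^(2r)` is holomorphic and `H(w) = 1`, the Poisson formula reproduces `w^k`. On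
the circle `|1 - conj w z| = |z - w|`, so `|H|² = 1/((1 - |w|²) W)`. With `r = 1/p` this is the form
needed for Hölder. -/
theorem exists_evaluation_kernel {w : ℂ} (hw : ‖w‖ < 1) (r : ℝ) :
    ∃ (K : UnitAddCircle → ℂ) (W : UnitAddCircle → ℝ), Continuous K ∧ Continuous W ∧
      (∀ t, 0 < W t) ∧ (∫ t, W t ∂AddCircle.haarAddCircle = 1) ∧
      (∀ k : ℕ, ∫ t, (AddCircle.toCircle t : ℂ) ^ k * K t ∂AddCircle.haarAddCircle = w ^ k) ∧
      ∀ t, ‖K t‖ = ((1 - ‖w‖ ^ 2)⁻¹) ^ r * W t ^ (1 - r) := by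
  have hc := continuous_coe_toCircle
  set D : ℝ := 1 - ‖w‖ ^ 2 with hD
  have hDpos : 0 < D := by nlinarith [norm_nonneg w]
  have hDc : (D : ℂ) ≠ 0 := by exact_mod_cast hDpos.ne'
  set H : ℂ → ℂ := fun z => (1 - (starRingEnd ℂ) w * z) / D with hH
  -- Positivity on the closed disc keeps `H` in the slit plane, so the principal power is
  -- holomorphic there.
  have hHre : ∀ z : ℂ, ‖z‖ ≤ 1 → 0 < (H z).re := by
    intro z hz
    rw [hH]
    simp only [Complex.div_ofReal_re]
    refine div_pos ?_ hDpos
    have h1 : ((starRingEnd ℂ) w * z).re ≤ ‖(starRingEnd ℂ) w * z‖ := Complex.re_le_norm _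
    rw [norm_mul, RCLike.norm_conj] at h1
    simp only [Complex.sub_re, Complex.one_re]
    nlinarith [norm_nonneg w, norm_nonneg z]
  have hHw : H w = 1 := by
    rw [hH]
    simp only
    rw [div_eq_one_iff_eq hDc, mul_comm, Complex.mul_conj, Complex.normSq_eq_norm_sq, hD]
    push_cast
    ring
  have hwmem : w ∈ Metric.ball (0 : ℂ) 1 := by simpa using hw
  set P : ℂ → ℝ := fun z => (‖z - 0‖ ^ 2 - ‖w - 0‖ ^ 2) / ‖(z - 0) - (w - 0)‖ ^ 2 with hP
  have hPc : ∀ t : UnitAddCircle, P (AddCircle.toCircle t) =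
      D / ‖(AddCircle.toCircle t : ℂ) - w‖ ^ 2 := by
    intro t
    simp only [hP, hD, sub_zero, Circle.norm_coe, one_pow]
  have hne : ∀ t : UnitAddCircle, 0 < ‖(AddCircle.toCircle t : ℂ) - w‖ := by
    intro t
    rw [norm_pos_iff, sub_ne_zero]
    intro h
    rw [← h, Circle.norm_coe] at hw
    exact lt_irrefl _ hw
  have hWcont : Continuous fun t : UnitAddCircle => P (AddCircle.toCircle t) := by
    simp only [hPc]
    exact continuous_const.div (by fun_prop) fun t => by have := hne t; positivity
  have hHcont : Continuous fun t : UnitAddCircle => H (AddCircle.toCircle t) ^ ((2 * r : ℝ) : ℂ) := by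
    exact Continuous.cpow (by fun_prop) continuous_const fun t =>
      Or.inl (hHre _ (Circle.norm_coe _).le)
  have hpoisson : ∀ k : ℕ, ∫ t : UnitAddCircle, P (AddCircle.toCircle t) •
      ((AddCircle.toCircle t : ℂ) ^ k * H (AddCircle.toCircle t) ^ ((2 * r : ℝ) : ℂ))
        ∂AddCircle.haarAddCircle = w ^ k := by
    intro k
    rw [integral_circle_eq_circleAverage fun z => P z • (z ^ k * H z ^ ((2 * r : ℝ) : ℂ))]
    have hdiff : DiffContOnCl ℂ (fun z => z ^ k * H z ^ ((2 * r : ℝ) : ℂ))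
        (Metric.ball (0 : ℂ) 1) := by
      refine DifferentiableOn.diffContOnCl fun z hz => ?_
      rw [closure_ball _ one_ne_zero, mem_closedBall_zero_iff] at hz
      refine DifferentiableAt.differentiableWithinAt ?_
      refine (differentiableAt_id.pow k).mul ?_
      exact DifferentiableAt.cpow_const (by simp only [hH]; fun_prop) (Or.inl (hHre z hz))
    have := hdiff.circleAverage_poissonKernel_smul' hwmem
    rw [hHw, Complex.one_cpow, mul_one] at this
    exact this
  refine ⟨fun t => P (AddCircle.toCircle t) • H (AddCircle.toCircle t) ^ ((2 * r : ℝ) : ℂ),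
    fun t => P (AddCircle.toCircle t), hWcont.smul hHcont, hWcont, fun t => ?_, ?_, fun k => ?_,
    fun t => ?_⟩
  · simp only [hPc]
    have := hne t
    positivity
  · have h1 := integral_circle_eq_circleAverage fun z => P z • (1 : ℂ)
    have h2 := (diffContOnCl_const (c := (1 : ℂ)) (s := Metric.ball (0 : ℂ) 1) (𝕜 := ℂ)
      ).circleAverage_poissonKernel_smul' hwmem
    rw [h2] at h1
    simp only [Complex.real_smul, mul_one] at h1
    rw [integral_complex_ofReal] at h1
    exact_mod_cast h1
  · rw [← hpoisson k]
    refine integral_congr_ae (ae_of_all _ fun t => ?_)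
    simp only [Complex.real_smul]
    ring
  · have hz := hne t
    have hn : ‖1 - (starRingEnd ℂ) w * (AddCircle.toCircle t : ℂ)‖ =
        ‖(AddCircle.toCircle t : ℂ) - w‖ := by
      have h1 : (AddCircle.toCircle t : ℂ) * (starRingEnd ℂ) (AddCircle.toCircle t : ℂ) = 1 := by
        rw [Complex.mul_conj, Complex.normSq_eq_norm_sq, Circle.norm_coe]; simp
      have h2 : 1 - (starRingEnd ℂ) w * (AddCircle.toCircle t : ℂ) =
          (AddCircle.toCircle t : ℂ) * (starRingEnd ℂ) ((AddCircle.toCircle t : ℂ) - w) := by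
        rw [map_sub, mul_sub, h1]; ring
      rw [h2, norm_mul, RCLike.norm_conj, Circle.norm_coe, one_mul]
    simp only [norm_smul, Complex.norm_cpow_real, hPc]
    have hHn : ‖H (AddCircle.toCircle t : ℂ)‖ = ‖(AddCircle.toCircle t : ℂ) - w‖ / D := by
      rw [hH]
      simp only [norm_div, hn, Complex.norm_real, Real.norm_eq_abs, abs_of_pos hDpos]
    set y := ‖(AddCircle.toCircle t : ℂ) - w‖
    have hDy : 0 < D / y ^ 2 := by positivity
    rw [hHn, Real.rpow_sub hDy, Real.rpow_one, Real.norm_eq_abs, abs_of_pos hDy,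
      Real.rpow_mul (by positivity), mul_div_left_comm,
      ← Real.div_rpow (by positivity) (by positivity), Real.rpow_two]
    congr 2
    field_simp

/-! ### Completely multiplicative functions -/

/-- The exponent of the prime `q` in `n`. -/
def primeExponent (q : Nat.Primes) (n : ℕ+) : ℕ :=
  Multiset.count q (n.factorMultiset : Multiset Nat.Primes)

/-- Characters of the polytorus as monoid homomorphisms in `n`. -/
def characterHom (x : Polytorus) : ℕ+ →* ℂ where
  toFun n := character n x
  map_one' := by simp only [character, PNat.factorMultiset_one]; rfl
  map_mul' m n := by
    simp only [character, PNat.factorMultiset_mul]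
    exact (congrArg Multiset.prod (Multiset.map_add _ _ _)).trans (Multiset.prod_add _ _)

@[simp]
theorem characterHom_apply (x : Polytorus) (n : ℕ+) : characterHom x n = character n x := rfl

/-- The function `n ↦ n^(-s)` as a monoid homomorphism. -/
def dirichletHom (s : ℂ) : ℕ+ →* ℂ where
  toFun n := (n : ℂ) ^ (-s)
  map_one' := by simp
  map_mul' m n := by
    have := Complex.mul_cpow_ofReal_nonneg (a := (m : ℕ)) (b := (n : ℕ)) (by positivity)
      (by positivity) (-s)
    push_cast at this ⊢
    exact this

@[simp]
theorem dirichletHom_apply (s : ℂ) (n : ℕ+) : dirichletHom s n = (n : ℂ) ^ (-s) := rfl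

theorem norm_dirichletHom (s : ℂ) (n : ℕ+) :
    ‖dirichletHom s n‖ = ((n : ℕ) : ℝ) ^ (-s.re) := by
  rw [dirichletHom_apply, Complex.norm_natCast_cpow_of_pos n.pos, Complex.neg_re]

theorem character_prime (q : Nat.Primes) (x : Polytorus) :
    character (q : ℕ+) x = AddCircle.toCircle (x q) := by
  simp only [character, PNat.factorMultiset_ofPrime]
  exact (congrArg Multiset.prod (Multiset.map_singleton _ _)).trans (Multiset.prod_singleton _)

theorem prod_coe_factorMultiset (n : ℕ+) :
    (Multiset.map (fun q : Nat.Primes => (q : ℕ+)) n.factorMultiset).prod = n :=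
  n.prod_factorMultiset

/-- Allowing any `S` that contains the prime factors lets one finite set of primes serve every term
of a polynomial. -/
theorem map_eq_prod_primeExponent (χ : ℕ+ →* ℂ) {n : ℕ+} {S : Finset Nat.Primes}
    (hS : ∀ q : Nat.Primes, primeExponent q n ≠ 0 → q ∈ S) :
    χ n = ∏ q ∈ S, χ (q : ℕ+) ^ primeExponent q n := by
  classical
  have h : ∀ s : Multiset Nat.Primes, χ (s.map fun q : Nat.Primes => (q : ℕ+)).prod =
      ∏ q ∈ s.toFinset, χ (q : ℕ+) ^ s.count q := fun s => by
    rw [map_multiset_prod, Multiset.map_map, Finset.prod_multiset_map_count]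
    rfl
  refine (congrArg χ (prod_coe_factorMultiset n).symm).trans ((h _).trans ?_)
  refine Finset.prod_subset (fun q hq => hS q ?_) fun q _ hq => ?_
  · exact Multiset.count_ne_zero.2 (Multiset.mem_toFinset.1 hq)
  · have h0 : primeExponent q n = 0 :=
      Multiset.count_eq_zero.2 fun h1 => hq (Multiset.mem_toFinset.2 h1)
    exact (congrArg (χ (q : ℕ+) ^ ·) h0).trans (pow_zero _)

/-- The primes which divide some index in the support of a Dirichlet polynomial. -/
theorem exists_finset_primes (T : Finset ℕ+) :
    ∃ S : Finset Nat.Primes, ∀ n ∈ T, ∀ q : Nat.Primes, primeExponent q n ≠ 0 → q ∈ S := by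
  classical
  refine ⟨T.biUnion fun n => Multiset.toFinset (n.factorMultiset : Multiset Nat.Primes),
    fun n hn q hq => ?_⟩
  rw [Finset.mem_biUnion]
  exact ⟨n, hn, Multiset.mem_toFinset.2 (Multiset.count_ne_zero.1 hq)⟩

/-! ### Integrals of products over the polytorus -/

/-- The coordinates are independent under the product measure. -/
theorem integral_prod_polytorus {𝕜 : Type*} [RCLike 𝕜] (S : Finset Nat.Primes)
    (f : Nat.Primes → UnitAddCircle → 𝕜) (hf : ∀ q, Continuous (f q)) :
    ∫ x, ∏ q ∈ S, f q (x q) ∂polytorusMeasure =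
      ∏ q ∈ S, ∫ t, f q t ∂AddCircle.haarAddCircle := by
  have h1 : ProbabilityTheory.iIndepFun (fun (q : Nat.Primes) (x : Polytorus) => f q (x q))
      polytorusMeasure :=
    ProbabilityTheory.iIndepFun_infinitePi fun q => (hf q).measurable
  have h2 := (h1.precomp (g := fun q : S => (q : Nat.Primes))
    Subtype.val_injective).integral_fun_prod_eq_prod_integral
    fun q => ((hf q).measurable.comp (measurable_pi_apply (q : Nat.Primes))).aestronglyMeasurable
  have h3 : ∀ x : Polytorus, ∏ q ∈ S, f q (x q) = ∏ q : S, f q (x q) := fun x =>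
    (Finset.prod_coe_sort S fun q => f q (x q)).symm
  simp only [h3]
  rw [h2, ← Finset.prod_coe_sort S]
  refine Finset.prod_congr rfl fun q _ => ?_
  have h4 := measurePreserving_eval_infinitePi
    (fun _ : Nat.Primes => (AddCircle.haarAddCircle : Measure UnitAddCircle)) (q : Nat.Primes)
  conv_rhs => rw [← h4.map_eq]
  rw [integral_map h4.measurable.aemeasurable (hf q).aestronglyMeasurable]
  rfl

theorem integrable_of_continuous_polytorus {E : Type*} [NormedAddCommGroup E]
    {f : Polytorus → E} (hf : Continuous f) : Integrable f polytorusMeasure :=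
  hf.integrable_of_hasCompactSupport (HasCompactSupport.of_compactSpace f)

theorem continuous_bohrLift (P : DirichletPolynomial) : Continuous (bohrLift P) :=
  continuous_finsetSum _ fun n _ => continuous_const.mul (continuous_character n)

/-! ### Point evaluations on Hardy spaces -/

/-- The value at `s` of a Dirichlet polynomial. -/
def polyEval (s : ℂ) (P : DirichletPolynomial) : ℂ := P.sum fun n a => a * (n : ℂ) ^ (-s)

/-- Evaluation at `s` is integration of the Bohr lift against the product of the circle kernels at
`q^(-s)`; multiplicativity in `n` makes the product kernel reproduce each `n^(-s)`. -/
theorem enorm_polyEval_rpow_le {p : ℝ} (hp : 1 ≤ p) {s : ℂ} (hs : 0 < s.re)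
    (P : DirichletPolynomial) {S : Finset Nat.Primes}
    (hS : ∀ n ∈ P.support, ∀ q : Nat.Primes, primeExponent q n ≠ 0 → q ∈ S) :
    ‖polyEval s P‖ₑ ^ p ≤
      ENNReal.ofReal (∏ q ∈ S, (1 - ((q : ℕ) : ℝ) ^ (-(2 * s.re)))⁻¹) *
        ∫⁻ x, ‖bohrLift P x‖ₑ ^ p ∂polytorusMeasure := by
  have hp0 : 0 < p := by linarith
  set w : Nat.Primes → ℂ := fun q => dirichletHom s (q : ℕ+) with hw
  have hwn : ∀ q, ‖w q‖ < 1 := fun q => by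
    rw [hw]
    simp only
    rw [norm_dirichletHom]
    exact Real.rpow_lt_one_of_one_lt_of_neg (by exact_mod_cast q.2.one_lt) (by linarith)
  have hwsq : ∀ q : Nat.Primes, ‖w q‖ ^ 2 = ((q : ℕ) : ℝ) ^ (-(2 * s.re)) := fun q => by
    rw [hw]
    simp only
    rw [norm_dirichletHom, ← Real.rpow_natCast, ← Real.rpow_mul (by positivity)]
    congr 1
    push_cast
    ring
  choose K W hKc hWc hWpos hWint hK hKn using
    fun q : Nat.Primes => exists_evaluation_kernel (hwn q) (1 / p)
  set Kt : Polytorus → ℂ := fun x => ∏ q ∈ S, K q (x q) with hKt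
  set Wt : Polytorus → ℝ := fun x => ∏ q ∈ S, W q (x q) with hWt
  have hKtc : Continuous Kt := continuous_finsetProd _ fun q _ => (hKc q).comp (continuous_apply q)
  have hWtc : Continuous Wt := continuous_finsetProd _ fun q _ => (hWc q).comp (continuous_apply q)
  have hWtpos : ∀ x, 0 < Wt x := fun x => Finset.prod_pos fun q _ => hWpos q _
  have hWtint : ∫⁻ x, ENNReal.ofReal (Wt x) ∂polytorusMeasure = 1 := by
    rw [← ofReal_integral_eq_lintegral_ofReal (integrable_of_continuous_polytorus hWtc)
      (ae_of_all _ fun x => (hWtpos x).le), hWt, integral_prod_polytorus S W hWc]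
    simp [hWint]
  set D : ℝ := ∏ q ∈ S, (1 - ‖w q‖ ^ 2)⁻¹ with hD
  have hDpos : 0 < D := Finset.prod_pos fun q _ =>
    inv_pos.2 (by nlinarith [hwn q, norm_nonneg (w q)])
  have hKtn : ∀ x, ‖Kt x‖ = D ^ (1 / p) * Wt x ^ (1 - 1 / p) := by
    intro x
    rw [hKt, hWt, hD]
    simp only
    rw [norm_prod, ← Real.finsetProd_rpow _ _ fun q _ =>
      (inv_nonneg.2 (by nlinarith [hwn q, norm_nonneg (w q)])),
      ← Real.finsetProd_rpow _ _ fun q _ => (hWpos q _).le, ← Finset.prod_mul_distrib]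
    exact Finset.prod_congr rfl fun q _ => hKn q _
  have heval : polyEval s P = ∫ x, bohrLift P x * Kt x ∂polytorusMeasure := by
    have h1 : ∀ x, bohrLift P x * Kt x = ∑ n ∈ P.support, P n * (character n x * Kt x) := by
      intro x
      simp only [bohrLift, Finsupp.sum, Finset.sum_mul, mul_assoc]
    simp only [h1]
    rw [integral_finsetSum]
    · refine Finset.sum_congr rfl fun n hn => ?_
      rw [integral_const_mul]
      have h2 : ∀ x, character n x * Kt x =
          ∏ q ∈ S, ((AddCircle.toCircle (x q) : ℂ) ^ primeExponent q n * K q (x q)) := by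
        intro x
        rw [Finset.prod_mul_distrib, ← characterHom_apply,
          map_eq_prod_primeExponent (characterHom x) (hS n hn)]
        simp only [characterHom_apply, character_prime, hKt]
      simp only [h2]
      rw [integral_prod_polytorus S
        (fun q t => (AddCircle.toCircle t : ℂ) ^ primeExponent q n * K q t)
        fun q => (continuous_coe_toCircle.pow _).mul (hKc q)]
      simp only [hK]
      rw [← dirichletHom_apply, map_eq_prod_primeExponent (dirichletHom s) (hS n hn)]
    · intro n _
      exact integrable_of_continuous_polytorus
        (continuous_const.mul ((continuous_character n).mul hKtc))
  have hbound : ‖polyEval s P‖ₑ ≤ ENNReal.ofReal (D ^ (1 / p)) *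
      (∫⁻ x, ‖bohrLift P x‖ₑ ^ p ∂polytorusMeasure) ^ (1 / p) := by
    rw [heval]
    refine (enorm_integral_le_lintegral_enorm _).trans ?_
    have h1 : ∀ x, ‖bohrLift P x * Kt x‖ₑ = ENNReal.ofReal (D ^ (1 / p)) *
        ((‖bohrLift P x‖ₑ ^ p) ^ (1 / p) * ENNReal.ofReal (Wt x) ^ (1 - 1 / p)) := by
      intro x
      rw [enorm_mul, ← ENNReal.rpow_mul, mul_one_div_cancel hp0.ne', ENNReal.rpow_one,
        ← ofReal_norm (Kt x), hKtn, ENNReal.ofReal_mul (by positivity),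
        ENNReal.ofReal_rpow_of_pos (hWtpos x)]
      ring
    simp only [h1]
    rw [lintegral_const_mul' _ _ ENNReal.ofReal_ne_top]
    gcongr
    -- Hölder with weights `1/p` and `1 - 1/p`. The second factor integrates to `1` because the
    -- product of Poisson kernels is a probability density; `p = 1` needs no separate case.
    have h2 := ENNReal.lintegral_mul_norm_pow_le (μ := polytorusMeasure)
      (f := fun x => ‖bohrLift P x‖ₑ ^ p) (g := fun x => ENNReal.ofReal (Wt x))
      (((continuous_bohrLift P).measurable.enorm.pow_const _).aemeasurable)
      hWtc.measurable.ennreal_ofReal.aemeasurable (p := 1 / p) (q := 1 - 1 / p)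
      (by positivity) (by rw [sub_nonneg, div_le_one hp0]; exact hp) (by ring)
    simpa [hWtint] using h2
  have hDeq : (∏ q ∈ S, (1 - ((q : ℕ) : ℝ) ^ (-(2 * s.re)))⁻¹) = D := by
    simp only [hD, hwsq]
  rw [hDeq]
  refine (ENNReal.rpow_le_rpow hbound hp0.le).trans_eq ?_
  rw [ENNReal.mul_rpow_of_nonneg _ _ hp0.le, ← ENNReal.rpow_mul, one_div_mul_cancel hp0.ne',
    ENNReal.rpow_one, ENNReal.ofReal_rpow_of_pos (by positivity), ← Real.rpow_mul hDpos.le,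
    one_div_mul_cancel hp0.ne', Real.rpow_one]

/-! ### The zeta function on the real axis -/

theorem summable_pnat_rpow {x : ℝ} (hx : 1 < x) :
    Summable fun n : ℕ+ => ((n : ℕ) : ℝ) ^ (-x) := by
  have := (Real.summable_nat_rpow (p := -x)).2 (by linarith)
  exact this.comp_injective PNat.coe_injective

theorem tsum_pnat_rpow_le {x : ℝ} (hx : 1 < x) :
    ∑' n : ℕ+, ((n : ℕ) : ℝ) ^ (-x) ≤ 1 + 1 / (x - 1) := by
  have h := ZetaAsymptotics.zeta_limit_aux1 hx
  have h1 : 0 ≤ ZetaAsymptotics.termTSum x := tsum_nonneg fun n =>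
    ZetaAsymptotics.term_nonneg _ _
  have h2 : ∑' n : ℕ+, ((n : ℕ) : ℝ) ^ (-x) = ∑' n : ℕ, 1 / (n + 1 : ℝ) ^ x := by
    rw [tsum_pnat_eq_tsum_succ (f := fun n : ℕ => (n : ℝ) ^ (-x))]
    refine tsum_congr fun n => ?_
    rw [Real.rpow_neg (by positivity), one_div]
    push_cast
    rfl
  rw [h2]
  nlinarith

/-- The finite Euler product is the sum of `n^(-x)` over the integers with all prime factors in `S`.
-/
theorem prod_primes_le {x : ℝ} (hx : 1 < x) (S : Finset Nat.Primes) :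
    ∏ q ∈ S, (1 - ((q : ℕ) : ℝ) ^ (-x))⁻¹ ≤ ∑' n : ℕ+, ((n : ℕ) : ℝ) ^ (-x) := by
  let f : ℕ →* ℝ :=
    { toFun := fun n => (n : ℝ) ^ (-x)
      map_one' := by simp
      map_mul' := fun m n => by
        push_cast
        exact Real.mul_rpow (by positivity) (by positivity) }
  have hsum : Summable fun n => f n := (Real.summable_nat_rpow (p := -x)).2 (by linarith)
  have h := EulerProduct.prod_filter_prime_geometric_eq_tsum_factoredNumbers hsum
    (S.map ⟨fun q : Nat.Primes => (q : ℕ), Subtype.val_injective⟩)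
  have hfil : (S.map ⟨fun q : Nat.Primes => (q : ℕ), Subtype.val_injective⟩).filter Nat.Prime =
      S.map ⟨fun q : Nat.Primes => (q : ℕ), Subtype.val_injective⟩ := by
    rw [Finset.filter_eq_self]
    intro n hn
    obtain ⟨q, _, rfl⟩ := Finset.mem_map.1 hn
    exact q.2
  rw [hfil, Finset.prod_map] at h
  have h0 : f 0 = 0 := by
    change ((0 : ℕ) : ℝ) ^ (-x) = 0
    rw [Nat.cast_zero, Real.zero_rpow (by linarith)]
  have h1 : ∑' n : ℕ+, ((n : ℕ) : ℝ) ^ (-x) = ∑' n : ℕ, f n :=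
    (tsum_pnat_eq_tsum_succ (f := fun n : ℕ => (n : ℝ) ^ (-x))).trans <| by
      rw [hsum.tsum_eq_zero_add, h0, zero_add]
      rfl
  rw [h1]
  refine le_trans (le_of_eq h) ?_
  exact hsum.tsum_subtype_le _ _ (fun n => Real.rpow_nonneg (by positivity) _)

/-- The point evaluations on the Hardy space `H^p` are bounded on `Re s > 1/2`. -/
theorem enorm_polyEval_rpow_le_hardy {p : ℝ} (hp : 1 ≤ p) {s : ℂ} (hs : 1 / 2 < s.re)
    (P : DirichletPolynomial) :
    ‖polyEval s P‖ₑ ^ p ≤ ENNReal.ofReal (1 + 1 / (2 * s.re - 1)) *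
        ∫⁻ x, ‖bohrLift P x‖ₑ ^ p ∂polytorusMeasure := by
  obtain ⟨S, hS⟩ := exists_finset_primes P.support
  refine (enorm_polyEval_rpow_le hp (by linarith) P hS).trans ?_
  gcongr
  exact (prod_primes_le (by linarith) S).trans (tsum_pnat_rpow_le (by linarith))

/-! ### Bounds for the coefficients by the Hardy norm with exponent one -/

theorem map_add_right_polytorusMeasure (t : Polytorus) :
    polytorusMeasure.map (fun x => x + t) = polytorusMeasure := by
  unfold polytorusMeasure
  have := Measure.infinitePi_map_pi
    (fun _ : Nat.Primes => (AddCircle.haarAddCircle : Measure UnitAddCircle))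
    (f := fun i y => y + t i) (fun i => measurable_add_const (t i))
  simp only [map_add_right_eq_self] at this
  exact this

theorem integral_add_right_polytorus {f : Polytorus → ℝ} (hf : Continuous f) (t : Polytorus) :
    ∫ x, f (x + t) ∂polytorusMeasure = ∫ x, f x ∂polytorusMeasure := by
  conv_rhs => rw [← map_add_right_polytorusMeasure t]
  rw [integral_map (measurable_add_const t).aemeasurable hf.aestronglyMeasurable]

theorem continuous_single_polytorus (q : Nat.Primes) :
    Continuous fun t : UnitAddCircle => (Pi.single q t : Polytorus) := by
  refine continuous_pi fun q' => ?_
  by_cases h : q' = q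
  · subst h
    simp only [Pi.single_eq_same]
    exact continuous_id
  · simpa only [Pi.single_eq_of_ne h] using continuous_const

/-- Averaging first over the coordinate `q`. -/
theorem integral_eq_integral_coordinate {f : Polytorus → ℝ} (hf : Continuous f)
    (q : Nat.Primes) :
    ∫ x, f x ∂polytorusMeasure = ∫ x, (∫ t : UnitAddCircle, f (x + Pi.single q t)
      ∂AddCircle.haarAddCircle) ∂polytorusMeasure := by
  have hsingle := continuous_single_polytorus q
  have hc : Continuous (Function.uncurry fun (x : Polytorus) (t : UnitAddCircle) =>
      f (x + Pi.single q t)) :=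
    hf.comp (continuous_fst.add (hsingle.comp continuous_snd))
  rw [integral_integral_swap
    (hc.integrable_of_hasCompactSupport (HasCompactSupport.of_compactSpace _))]
  simp [integral_add_right_polytorus hf]

-- Translating along one coordinate turns a Bohr lift into a one-variable trigonometric polynomial,
-- so the circle estimates apply slice by slice.
theorem character_single (n : ℕ+) (q : Nat.Primes) (t : UnitAddCircle) :
    character n (Pi.single q t) = (AddCircle.toCircle t : ℂ) ^ primeExponent q n := by
  classical
  obtain ⟨S, hS⟩ := exists_finset_primes {n}
  have h := map_eq_prod_primeExponent (characterHom (Pi.single q t)) (n := n) (S := insert q S)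
    fun q' hq' => Finset.mem_insert_of_mem (hS n (Finset.mem_singleton_self n) q' hq')
  rw [characterHom_apply] at h
  rw [h, Finset.prod_eq_single q]
  · rw [characterHom_apply, character_prime, Pi.single_eq_same]
  · intro q' _ hne
    rw [characterHom_apply, character_prime, Pi.single_eq_of_ne hne, AddCircle.toCircle_zero,
      Circle.coe_one, one_pow]
  · simp

/-- The part of a Dirichlet polynomial where the exponent of `q` is equal to `k`. -/
def exponentPart (q : Nat.Primes) (k : ℕ) (P : DirichletPolynomial) : DirichletPolynomial :=
  P.filter fun n => primeExponent q n = k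

theorem support_exponentPart (q : Nat.Primes) (k : ℕ) (P : DirichletPolynomial) :
    (exponentPart q k P).support = P.support.filter fun n => primeExponent q n = k :=
  Finsupp.support_filter _ _

theorem exponentPart_apply {q : Nat.Primes} {k : ℕ} {P : DirichletPolynomial} {n : ℕ+}
    (h : primeExponent q n = k) : exponentPart q k P n = P n :=
  Finsupp.filter_apply_pos _ _ h

theorem bohrLift_add_single (P : DirichletPolynomial) (q : Nat.Primes) {N : ℕ}
    (hN : ∀ n ∈ P.support, primeExponent q n < N) (x : Polytorus) (t : UnitAddCircle) :
    bohrLift P (x + Pi.single q t) = ∑ k ∈ Finset.range N,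
      bohrLift (exponentPart q k P) x * (AddCircle.toCircle t : ℂ) ^ k := by
  unfold bohrLift Finsupp.sum
  rw [← Finset.sum_fiberwise_of_maps_to (g := primeExponent q)
    fun n hn => Finset.mem_range.2 (hN n hn)]
  refine Finset.sum_congr rfl fun k _ => ?_
  rw [support_exponentPart, Finset.sum_mul]
  refine Finset.sum_congr rfl fun n hn => ?_
  have hk := (Finset.mem_filter.1 hn).2
  simp only [exponentPart_apply hk, character_add, character_single, hk, mul_assoc]

/-- Minkowski's inequality for finitely many functions. -/
theorem sum_sq_integral_le {Ω : Type*} [MeasurableSpace Ω] {ν : Measure Ω} (s : Finset ℕ)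
    (g : ℕ → Ω → ℝ) (hg : ∀ k, Integrable (g k) ν)
    (hi : Integrable (fun x => √(∑ k ∈ s, g k x ^ 2)) ν) :
    ∑ k ∈ s, (∫ x, g k x ∂ν) ^ 2 ≤ (∫ x, √(∑ k ∈ s, g k x ^ 2) ∂ν) ^ 2 := by
  set c : ℕ → ℝ := fun k => ∫ x, g k x ∂ν with hc
  set A := ∑ k ∈ s, c k ^ 2 with hA
  set I := ∫ x, √(∑ k ∈ s, g k x ^ 2) ∂ν with hI
  have hA0 : 0 ≤ A := Finset.sum_nonneg fun k _ => sq_nonneg _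
  have hI0 : 0 ≤ I := integral_nonneg fun x => Real.sqrt_nonneg _
  have h1 : A ≤ √A * I := by
    calc A = ∫ x, ∑ k ∈ s, c k * g k x ∂ν := by
          rw [integral_finsetSum _ fun k _ => (hg k).const_mul (c k)]
          simp only [integral_const_mul, hA, sq, hc]
      _ ≤ ∫ x, √A * √(∑ k ∈ s, g k x ^ 2) ∂ν := by
          refine integral_mono (integrable_finsetSum _ fun k _ => (hg k).const_mul (c k))
            (hi.const_mul _) fun x => ?_
          exact Real.sum_mul_le_sqrt_mul_sqrt s c fun k => g k x
      _ = √A * I := by rw [integral_const_mul]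
  have h2 : √A ≤ I := by
    rcases hA0.eq_or_lt with h0 | h0
    · rw [← h0, Real.sqrt_zero]; exact hI0
    · have := Real.sqrt_pos.2 h0
      have h3 : √A * √A ≤ √A * I := by rwa [Real.mul_self_sqrt hA0]
      exact le_of_mul_le_mul_left h3 this
  calc A = √A ^ 2 := (Real.sq_sqrt hA0).symm
    _ ≤ I ^ 2 := by gcongr

/-- The dilation bound is applied in the variable `q` for each fixed `x`, and Minkowski moves the
square sum outside the integral over `x`. The left side again has `L¹` norms, which allows iteration
over the primes. -/
theorem sum_sq_exponentPart_le {r : ℝ} (h0 : 0 ≤ r) (hr : r < 1) (P : DirichletPolynomial)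
    (q : Nat.Primes) {N : ℕ} (hN : ∀ n ∈ P.support, primeExponent q n < N) :
    ∑ k ∈ Finset.range N, (r ^ k * ∫ x, ‖bohrLift (exponentPart q k P) x‖ ∂polytorusMeasure) ^ 2 ≤
      dilationConst r * (∫ x, ‖bohrLift P x‖ ∂polytorusMeasure) ^ 2 := by
  have hC := (dilationConst_pos h0 hr).le
  have hcont : ∀ k, Continuous fun x => r ^ k * ‖bohrLift (exponentPart q k P) x‖ := fun k =>
    continuous_const.mul (continuous_bohrLift _).norm
  have hsq : Continuous fun x => √(∑ k ∈ Finset.range N,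
      (r ^ k * ‖bohrLift (exponentPart q k P) x‖) ^ 2) :=
    (continuous_finsetSum _ fun k _ => (hcont k).pow 2).sqrt
  have h1 := sum_sq_integral_le (Finset.range N)
    (fun k x => r ^ k * ‖bohrLift (exponentPart q k P) x‖)
    (fun k => integrable_of_continuous_polytorus (hcont k))
    (integrable_of_continuous_polytorus hsq)
  simp only [integral_const_mul] at h1
  refine h1.trans ?_
  have hPn := (continuous_bohrLift P).norm
  have hsingle := continuous_single_polytorus q
  have h2 : ∫ x, √(∑ k ∈ Finset.range N,
      (r ^ k * ‖bohrLift (exponentPart q k P) x‖) ^ 2) ∂polytorusMeasure ≤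
      √(dilationConst r) * ∫ x, ‖bohrLift P x‖ ∂polytorusMeasure := by
    rw [integral_eq_integral_coordinate hPn q, ← integral_const_mul]
    refine integral_mono (integrable_of_continuous_polytorus hsq) ?_ fun x => ?_
    · have hc : Continuous (Function.uncurry fun (x : Polytorus) (t : UnitAddCircle) =>
          ‖bohrLift P (x + Pi.single q t)‖) :=
        hPn.comp (continuous_fst.add (hsingle.comp continuous_snd))
      exact (hc.integrable_of_hasCompactSupport (μ := polytorusMeasure.prod
        AddCircle.haarAddCircle) (HasCompactSupport.of_compactSpace _)).integral_prod_left.const_mul _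
    · have h3 := sum_sq_pow_mul_le r h0 hr N fun k => bohrLift (exponentPart q k P) x
      simp only [← bohrLift_add_single P q hN x] at h3
      have hnn : 0 ≤ ∫ t : UnitAddCircle, ‖bohrLift P (x + Pi.single q t)‖
        ∂AddCircle.haarAddCircle := integral_nonneg fun t => norm_nonneg _
      refine (Real.sqrt_le_sqrt h3).trans_eq ?_
      rw [Real.sqrt_mul hC, Real.sqrt_sq hnn]
  have h4 : 0 ≤ ∫ x, √(∑ k ∈ Finset.range N,
      (r ^ k * ‖bohrLift (exponentPart q k P) x‖) ^ 2) ∂polytorusMeasure :=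
    integral_nonneg fun x => Real.sqrt_nonneg _
  calc _ ≤ (√(dilationConst r) * ∫ x, ‖bohrLift P x‖ ∂polytorusMeasure) ^ 2 := by gcongr
    _ = _ := by rw [mul_pow, Real.sq_sqrt hC]

theorem eq_of_primeExponent_eq {n m : ℕ+} (h : ∀ q, primeExponent q n = primeExponent q m) :
    n = m :=
  PNat.factorMultisetEquiv.injective
    ((Multiset.ext (s := n.factorMultiset) (t := m.factorMultiset)).2 h)

/-- Induction on the set of primes that may vary. With none left the support has at most one index;
a new prime is treated by splitting the polynomial according to its exponent, and each part is
homogeneous in that prime. -/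
theorem sum_sq_coeff_le_of_homogeneous (r : Nat.Primes → ℝ) (h0 : ∀ q, 0 ≤ r q)
    (hr : ∀ q, r q < 1) (S : Finset Nat.Primes) (P : DirichletPolynomial)
    (hP : ∀ n ∈ P.support, ∀ m ∈ P.support, ∀ q ∉ S, primeExponent q n = primeExponent q m) :
    ∑ n ∈ P.support, ((∏ q ∈ S, r q ^ primeExponent q n) * ‖P n‖) ^ 2 ≤
      (∏ q ∈ S, dilationConst (r q)) * (∫ x, ‖bohrLift P x‖ ∂polytorusMeasure) ^ 2 := by
  classical
  induction S using Finset.induction_on generalizing P with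
  | empty =>
    rcases P.support.eq_empty_or_nonempty with h | ⟨n, hn⟩
    · rw [h, Finset.sum_empty, Finset.prod_empty]; positivity
    · have hs : P.support = {n} := by
        refine Finset.eq_singleton_iff_unique_mem.2 ⟨hn, fun m hm => ?_⟩
        exact eq_of_primeExponent_eq fun q => hP m hm n hn q (by simp)
      have hb : ∀ x, ‖bohrLift P x‖ = ‖P n‖ := fun x => by
        rw [bohrLift, Finsupp.sum, hs, Finset.sum_singleton, norm_mul, norm_character, mul_one]
      simp [hs, hb]
  | insert q S hq ih =>
    obtain ⟨N, hN⟩ : ∃ N, ∀ n ∈ P.support, primeExponent q n < N :=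
      ⟨P.support.sup (primeExponent q) + 1, fun n hn => Nat.lt_succ_of_le (Finset.le_sup hn)⟩
    have hpos : ∀ q, 0 < dilationConst (r q) := fun q => dilationConst_pos (h0 q) (hr q)
    have hih : ∀ k, ∑ n ∈ P.support.filter (fun n => primeExponent q n = k),
        ((∏ q' ∈ S, r q' ^ primeExponent q' n) * ‖P n‖) ^ 2 ≤ (∏ q' ∈ S, dilationConst (r q')) *
          (∫ x, ‖bohrLift (exponentPart q k P) x‖ ∂polytorusMeasure) ^ 2 := by
      intro k
      have h := ih (exponentPart q k P) ?_
      · rw [support_exponentPart] at h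
        refine (Finset.sum_congr rfl fun n hn => ?_).trans_le h
        rw [exponentPart_apply (Finset.mem_filter.1 hn).2]
      · intro n hn m hm q' hq'
        rw [support_exponentPart, Finset.mem_filter] at hn hm
        by_cases hqq : q' = q
        · rw [hqq, hn.2, hm.2]
        · exact hP n hn.1 m hm.1 q' (by simp [hqq, hq'])
    rw [← Finset.sum_fiberwise_of_maps_to (g := primeExponent q) (t := Finset.range N)
      fun n hn => Finset.mem_range.2 (hN n hn)]
    calc _ = ∑ k ∈ Finset.range N, (r q ^ k) ^ 2 *
          ∑ n ∈ P.support.filter (fun n => primeExponent q n = k),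
            ((∏ q' ∈ S, r q' ^ primeExponent q' n) * ‖P n‖) ^ 2 := by
          refine Finset.sum_congr rfl fun k _ => ?_
          rw [Finset.mul_sum]
          refine Finset.sum_congr rfl fun n hn => ?_
          rw [Finset.prod_insert hq, (Finset.mem_filter.1 hn).2]
          ring
      _ ≤ ∑ k ∈ Finset.range N, (r q ^ k) ^ 2 * ((∏ q' ∈ S, dilationConst (r q')) *
          (∫ x, ‖bohrLift (exponentPart q k P) x‖ ∂polytorusMeasure) ^ 2) := by
          gcongr with k _
          exact hih k
      _ = (∏ q' ∈ S, dilationConst (r q')) * ∑ k ∈ Finset.range N,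
          (r q ^ k * ∫ x, ‖bohrLift (exponentPart q k P) x‖ ∂polytorusMeasure) ^ 2 := by
          rw [Finset.mul_sum]
          exact Finset.sum_congr rfl fun k _ => by ring
      _ ≤ (∏ q' ∈ S, dilationConst (r q')) * (dilationConst (r q) *
          (∫ x, ‖bohrLift P x‖ ∂polytorusMeasure) ^ 2) := by
          have := Finset.prod_nonneg fun q' (_ : q' ∈ S) => (hpos q').le
          gcongr
          exact sum_sq_exponentPart_le (h0 q) (hr q) P q hN
      _ = _ := by rw [Finset.prod_insert hq]; ring

/-- Horizontal translations map `H^1` boundedly into `H^2`. -/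
theorem exists_sum_sq_coeff_le {ε : ℝ} (hε : 0 < ε) :
    ∃ C : ℝ, 0 < C ∧ ∀ P : DirichletPolynomial,
      ∑ n ∈ P.support, (((n : ℕ) : ℝ) ^ (-ε) * ‖P n‖) ^ 2 ≤
        C * (∫ x, ‖bohrLift P x‖ ∂polytorusMeasure) ^ 2 := by
  classical
  set r : Nat.Primes → ℝ := fun q => ((q : ℕ) : ℝ) ^ (-ε) with hrdef
  have h0 : ∀ q, 0 ≤ r q := fun q => Real.rpow_nonneg (by positivity) _
  have hr : ∀ q, r q < 1 := fun q =>
    Real.rpow_lt_one_of_one_lt_of_neg (by exact_mod_cast q.2.one_lt) (by linarith)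
  -- Since `q^(-ε) → 0`, only finitely many primes contribute a constant different from `1`. This
  -- makes the final constant independent of `P`.
  obtain ⟨B, hB⟩ : ∃ B : Finset Nat.Primes, ∀ q ∉ B, r q ^ 2 ≤ 1 / 5 := by
    have ht := ((tendsto_rpow_neg_atTop hε).comp tendsto_natCast_atTop_atTop).pow 2
    simp only [ne_eq, OfNat.ofNat_ne_zero, not_false_eq_true, zero_pow] at ht
    obtain ⟨N, hN⟩ := Filter.eventually_atTop.1
      (ht.eventually_le_const (show (0 : ℝ) < 1 / 5 by norm_num))
    have hfin : {q : Nat.Primes | (q : ℕ) < N}.Finite :=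
      (Set.finite_lt_nat N).preimage (Subtype.val_injective.injOn)
    refine ⟨hfin.toFinset, fun q hq => hN q ?_⟩
    simpa using hq
  refine ⟨∏ q ∈ B, dilationConst (r q),
    Finset.prod_pos fun q _ => dilationConst_pos (h0 q) (hr q), fun P => ?_⟩
  obtain ⟨S, hS⟩ := exists_finset_primes P.support
  have h := sum_sq_coeff_le_of_homogeneous r h0 hr (S ∪ B) P fun n hn m hm q hq => by
    rw [Finset.notMem_union] at hq
    rw [not_not.1 (mt (hS n hn q) hq.1), not_not.1 (mt (hS m hm q) hq.1)]
  have hprod : ∏ q ∈ S ∪ B, dilationConst (r q) = ∏ q ∈ B, dilationConst (r q) := by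
    refine (Finset.prod_subset Finset.subset_union_right fun q _ hq => ?_).symm
    rw [dilationConst, if_pos (hB q hq)]
  rw [hprod] at h
  refine (Finset.sum_congr rfl fun n hn => ?_).trans_le h
  congr 2
  have h1 := congrArg norm (map_eq_prod_primeExponent (dirichletHom (ε : ℂ)) (n := n) (S := S ∪ B)
    fun q hq => Finset.mem_union_left _ (hS n hn q hq))
  rw [norm_dirichletHom, norm_prod, Complex.ofReal_re] at h1
  rw [h1]
  refine Finset.prod_congr rfl fun q _ => ?_
  rw [norm_pow, norm_dirichletHom, Complex.ofReal_re]
  rfl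

/-! ### Averaging over translates -/

/-- On `(0, 1]` the exponential factor is at least `exp (-2)`, so the density dominates a multiple
of `u^α`. -/
theorem exists_le_bergmanMeasure_Ioc (α : ℝ) [hα : Fact (-1 < α)] :
    ∃ c : ℝ, 0 < c ∧ ∀ t : ℝ, 0 < t → t ≤ 1 →
      ENNReal.ofReal (c * t ^ (α + 1)) ≤ bergmanMeasure α (Ioc 0 t) := by
  have hα' := hα.out
  have hΓ : 0 < Real.Gamma (α + 1) := Real.Gamma_pos_of_pos (by linarith)
  set c0 : ℝ := 2 ^ (α + 1) / Real.Gamma (α + 1) * Real.exp (-2) with hc0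
  have hc0pos : 0 < c0 := by positivity
  refine ⟨c0 / (α + 1), div_pos hc0pos (by linarith), fun t ht ht1 => ?_⟩
  rw [bergmanMeasure, ← restrict_withDensity measurableSet_Ioi,
    Measure.restrict_apply measurableSet_Ioc,
    inter_eq_self_of_subset_left (fun x hx => hx.1), withDensity_apply _ measurableSet_Ioc]
  have hint : IntegrableOn (fun u : ℝ => c0 * u ^ α) (Ioc 0 t) :=
    ((intervalIntegrable_iff_integrableOn_Ioc_of_le ht.le).1
      (intervalIntegral.intervalIntegrable_rpow' hα')).const_mul c0
  have hval : ∫ u in Ioc 0 t, c0 * u ^ α = c0 / (α + 1) * t ^ (α + 1) := by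
    rw [integral_const_mul, ← intervalIntegral.integral_of_le ht.le, integral_rpow (Or.inl hα'),
      Real.zero_rpow (by linarith)]
    ring
  rw [← hval, ofReal_integral_eq_lintegral_ofReal hint]
  · refine setLIntegral_mono' measurableSet_Ioc fun u hu => ENNReal.ofReal_le_ofReal ?_
    have h1 : Real.exp (-2) ≤ Real.exp (-(2 * u)) := Real.exp_le_exp.2 (by linarith [hu.2])
    have h2 : 0 ≤ u ^ α := Real.rpow_nonneg hu.1.le _
    calc c0 * u ^ α = 2 ^ (α + 1) / Real.Gamma (α + 1) * u ^ α * Real.exp (-2) := by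
          rw [hc0]; ring
      _ ≤ _ := by gcongr
  · exact (ae_restrict_mem measurableSet_Ioc).mono fun u hu =>
      mul_nonneg hc0pos.le (Real.rpow_nonneg hu.1.le _)

theorem hardyENorm_rpow {p : ℝ≥0∞} [hp1 : Fact (1 ≤ p)] (hp : p ≠ ∞) (P : DirichletPolynomial) :
    hardyENorm p P ^ p.toReal = ∫⁻ x, ‖bohrLift P x‖ₑ ^ p.toReal ∂polytorusMeasure := by
  have hp0 : p ≠ 0 := (zero_lt_one.trans_le hp1.out).ne'
  have hpr : p.toReal ≠ 0 := (ENNReal.toReal_pos hp0 hp).ne'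
  rw [hardyENorm, eLpNorm_eq_lintegral_rpow_enorm_toReal hp0 hp, ← ENNReal.rpow_mul,
    one_div_mul_cancel hpr, ENNReal.rpow_one]

theorem one_le_toReal {p : ℝ≥0∞} [hp1 : Fact (1 ≤ p)] (hp : p ≠ ∞) : 1 ≤ p.toReal := by
  simpa using ENNReal.toReal_mono hp hp1.out

/-- A bound for all translates by `u ≤ t` in the Hardy norm gives a bound in the Bergman norm. -/
theorem exists_average_bound (p : ℝ≥0∞) [hp1 : Fact (1 ≤ p)] (hp : p ≠ ∞) (α : ℝ)
    [Fact (-1 < α)] : ∃ c : ℝ, 0 < c ∧ ∀ (t a K : ℝ) (P : DirichletPolynomial), 0 < t → t ≤ 1 →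
      0 ≤ a → 0 ≤ K → (∀ u ∈ Ioc 0 t, ENNReal.ofReal a ^ p.toReal ≤
        ENNReal.ofReal K * hardyENorm p (translate u P) ^ p.toReal) →
      c * t ^ (α + 1) * a ^ p.toReal ≤ K * ‖ofPolynomial p α P‖ ^ p.toReal := by
  obtain ⟨c, hc, hct⟩ := exists_le_bergmanMeasure_Ioc α
  have hpr : 0 < p.toReal := by linarith [one_le_toReal hp]
  refine ⟨c, hc, fun t a K P ht ht1 ha hK h => ?_⟩
  have h1 : bergmanMeasure α (Ioc 0 t) * ENNReal.ofReal a ^ p.toReal ≤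
      ENNReal.ofReal K * ‖ofPolynomial p α P‖ₑ ^ p.toReal := by
    rw [enorm_ofPolynomial_rpow p hp α P, mul_comm, ← setLIntegral_const,
      ← lintegral_const_mul' _ _ ENNReal.ofReal_ne_top]
    exact (setLIntegral_mono' measurableSet_Ioc h).trans (setLIntegral_le_lintegral _ _)
  have h2 := (mul_le_mul_left (hct t ht ht1) (ENNReal.ofReal a ^ p.toReal)).trans h1
  rw [← ofReal_norm, ENNReal.ofReal_rpow_of_nonneg ha hpr.le,
    ENNReal.ofReal_rpow_of_nonneg (norm_nonneg _) hpr.le, ← ENNReal.ofReal_mul (by positivity),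
    ← ENNReal.ofReal_mul hK] at h2
  exact (ENNReal.ofReal_le_ofReal_iff (by positivity)).1 h2

theorem translate_apply (u : ℝ) (P : DirichletPolynomial) (n : ℕ+) :
    translate u P n = P n * (n : ℂ) ^ (-(u : ℂ)) := rfl

theorem polyEval_translate (s : ℂ) (u : ℝ) (P : DirichletPolynomial) :
    polyEval (s - u) (translate u P) = polyEval s P := by
  unfold polyEval translate
  rw [Finsupp.onFinset_sum _ (by simp)]
  refine Finset.sum_congr rfl fun n _ => ?_
  rw [mul_assoc, ← Complex.cpow_add _ _ (by exact_mod_cast n.ne_zero)]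
  congr 2
  ring

/-- The sharp bound of the point evaluations on Dirichlet polynomials. -/
theorem exists_norm_polyEval_le (p : ℝ≥0∞) [hp1 : Fact (1 ≤ p)] (hp : p ≠ ∞) (α : ℝ)
    [Fact (-1 < α)] : ∃ C : ℝ, 0 < C ∧ ∀ (s : ℂ) (t : ℝ) (P : DirichletPolynomial), 0 < t →
      t ≤ 1 / 4 → t ≤ (s.re - 1 / 2) / 2 →
      ‖polyEval s P‖ ≤ C * (1 / t) ^ ((α + 2) / p.toReal) * ‖ofPolynomial p α P‖ := by
  obtain ⟨c, hc, h⟩ := exists_average_bound p hp α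
  have hp1' := one_le_toReal hp
  have hpr : 0 < p.toReal := by linarith
  refine ⟨(1 / c) ^ (1 / p.toReal), by positivity, fun s t P ht ht4 hts => ?_⟩
  have h1 := h t ‖polyEval s P‖ (1 / t) P ht (by linarith) (norm_nonneg _) (by positivity)
    fun u hu => by
      rw [hardyENorm_rpow hp, ofReal_norm, ← polyEval_translate s u P]
      have hre : (s - u).re = s.re - u := by simp
      refine (enorm_polyEval_rpow_le_hardy hp1' (by rw [hre]; linarith [hu.2]) _).trans ?_
      gcongr
      rw [hre]
      -- Half the distance to the critical line remains after the shift. The additive `1` in the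
      -- zeta bound is absorbed because `t ≤ 1/4`.
      have h3 : 1 / (2 * (s.re - u) - 1) ≤ 1 / (2 * t) :=
        one_div_le_one_div_of_le (by linarith) (by linarith [hu.2])
      have h4 : 1 / (2 * t) = 1 / t / 2 := by field_simp
      have h5 : 4 ≤ 1 / t := by rw [le_div_iff₀ ht]; linarith
      linarith
  have h2 : ‖polyEval s P‖ ^ p.toReal ≤
      1 / c * (1 / t) ^ (α + 2) * ‖ofPolynomial p α P‖ ^ p.toReal := by
    have h3 : 0 < t ^ (α + 1) := Real.rpow_pos_of_pos ht _
    have h4 : (1 / t) ^ (α + 2) = 1 / t * (1 / t ^ (α + 1)) := by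
      rw [Real.div_rpow zero_le_one ht.le, Real.one_rpow, show α + 2 = 1 + (α + 1) by ring,
        Real.rpow_add ht, Real.rpow_one]
      field_simp
    rw [h4]
    calc ‖polyEval s P‖ ^ p.toReal =
        (1 / c * (1 / t ^ (α + 1))) * (c * t ^ (α + 1) * ‖polyEval s P‖ ^ p.toReal) := by
          field_simp
      _ ≤ (1 / c * (1 / t ^ (α + 1))) * (1 / t * ‖ofPolynomial p α P‖ ^ p.toReal) := by gcongr
      _ = _ := by ring
  have h3 := Real.rpow_le_rpow (by positivity) h2 (show 0 ≤ 1 / p.toReal by positivity)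
  rw [← Real.rpow_mul (norm_nonneg _), mul_one_div_cancel hpr.ne', Real.rpow_one,
    Real.mul_rpow (by positivity) (by positivity), Real.mul_rpow (by positivity) (by positivity),
    ← Real.rpow_mul (norm_nonneg _), mul_one_div_cancel hpr.ne', Real.rpow_one,
    ← Real.rpow_mul (by positivity), mul_one_div] at h3
  exact h3

theorem sum_mul_rpow_le (T : Finset ℕ+) (a : ℕ+ → ℝ) {η : ℝ} (hη : 0 < η) :
    ∑ n ∈ T, a n * ((n : ℕ) : ℝ) ^ (-(1 / 2 + η)) ≤
      √(∑ n ∈ T, a n ^ 2) * √(∑' n : ℕ+, ((n : ℕ) : ℝ) ^ (-(1 + 2 * η))) := by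
  refine (Real.sum_mul_le_sqrt_mul_sqrt T a _).trans ?_
  gcongr
  refine (Finset.sum_congr rfl fun n _ => ?_).trans_le
    ((summable_pnat_rpow (x := 1 + 2 * η) (by linarith)).sum_le_tsum T
      fun n _ => Real.rpow_nonneg (by positivity) _)
  rw [← Real.rpow_natCast, ← Real.rpow_mul (by positivity)]
  congr 1
  push_cast
  ring

/-- The Dirichlet series of a polynomial is absolutely convergent on `Re s > 1/2`, with a bound
in terms of the Bergman norm. -/
theorem exists_sum_norm_coeff_le (p : ℝ≥0∞) [hp1 : Fact (1 ≤ p)] (hp : p ≠ ∞) (α : ℝ)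
    [Fact (-1 < α)] {σ : ℝ} (hσ : 1 / 2 < σ) : ∃ C : ℝ, 0 < C ∧ ∀ P : DirichletPolynomial,
      ∑ n ∈ P.support, ‖P n‖ * ((n : ℕ) : ℝ) ^ (-σ) ≤ C * ‖ofPolynomial p α P‖ := by
  obtain ⟨c, hc, h⟩ := exists_average_bound p hp α
  have hp1' := one_le_toReal hp
  have hpr : 0 < p.toReal := by linarith
  -- The room above `1/2` is used three times: for the translation by `u ≤ η`, for the passage from
  -- `H^1` to `H^2`, and for the convergence of the series in Cauchy–Schwarz.
  obtain ⟨η, hη, hη1, hησ⟩ : ∃ η : ℝ, 0 < η ∧ η ≤ 1 ∧ η ≤ (σ - 1 / 2) / 3 :=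
    ⟨min 1 ((σ - 1 / 2) / 3), lt_min one_pos (by linarith), min_le_left _ _, min_le_right _ _⟩
  obtain ⟨D, hD, hDP⟩ := exists_sum_sq_coeff_le hη
  set Z := √(∑' n : ℕ+, ((n : ℕ) : ℝ) ^ (-(1 + 2 * η)))
  have hZ : 0 ≤ Z := Real.sqrt_nonneg _
  set K : ℝ := √D ^ p.toReal / (c * η ^ (α + 1)) with hK
  have hKpos : 0 < K := by positivity
  refine ⟨K ^ (1 / p.toReal) * (Z + 1), by positivity, fun P => ?_⟩
  set a : ℕ+ → ℝ := fun n => ‖P n‖ * ((n : ℕ) : ℝ) ^ (-(2 * η)) with ha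
  have ha0 : ∀ n, 0 ≤ a n := fun n => by positivity
  set A := √(∑ n ∈ P.support, a n ^ 2) with hA
  have hA0 : 0 ≤ A := Real.sqrt_nonneg _
  have hn1 : ∀ n : ℕ+, (1 : ℝ) ≤ (n : ℕ) := fun n => by exact_mod_cast n.pos
  have h1 : ∑ n ∈ P.support, ‖P n‖ * ((n : ℕ) : ℝ) ^ (-σ) ≤ A * Z := by
    refine le_trans (Finset.sum_le_sum fun n _ => ?_) (sum_mul_rpow_le P.support a hη)
    rw [ha]
    simp only
    rw [mul_assoc, ← Real.rpow_add (by linarith [hn1 n])]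
    gcongr
    · exact hn1 n
    · linarith
  have h2 : ∀ u ∈ Ioc 0 η, A ≤ √D * ∫ x, ‖bohrLift (translate u P) x‖ ∂polytorusMeasure := by
    intro u hu
    have h3 := hDP (translate u P)
    have hsub : (translate u P).support ⊆ P.support := Finsupp.support_onFinset_subset
    rw [Finset.sum_subset hsub fun n _ hn => by
      rw [Finsupp.notMem_support_iff.1 hn]; simp] at h3
    have h4 : ∑ n ∈ P.support, a n ^ 2 ≤
        ∑ n ∈ P.support, (((n : ℕ) : ℝ) ^ (-η) * ‖translate u P n‖) ^ 2 := by
      refine Finset.sum_le_sum fun n _ => ?_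
      have h5 : a n ≤ ((n : ℕ) : ℝ) ^ (-η) * ‖translate u P n‖ := by
        rw [translate_apply, norm_mul, Complex.norm_natCast_cpow_of_pos n.pos, Complex.neg_re,
          Complex.ofReal_re, mul_left_comm, ← Real.rpow_add (by linarith [hn1 n])]
        simp only [ha]
        gcongr
        · exact hn1 n
        · linarith [hu.2]
      have := ha0 n
      gcongr
    have hnn : 0 ≤ ∫ x, ‖bohrLift (translate u P) x‖ ∂polytorusMeasure :=
      integral_nonneg fun x => norm_nonneg _
    calc A ≤ √(D * (∫ x, ‖bohrLift (translate u P) x‖ ∂polytorusMeasure) ^ 2) :=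
          Real.sqrt_le_sqrt (h4.trans h3)
      _ = _ := by rw [Real.sqrt_mul hD.le, Real.sqrt_sq hnn]
  have h3 := h η A (√D ^ p.toReal) P hη hη1 hA0 (by positivity) fun u hu => by
    rw [← ENNReal.ofReal_rpow_of_nonneg (Real.sqrt_nonneg _) hpr.le,
      ← ENNReal.mul_rpow_of_nonneg _ _ hpr.le]
    gcongr
    refine (ENNReal.ofReal_le_ofReal (h2 u hu)).trans ?_
    rw [ENNReal.ofReal_mul (Real.sqrt_nonneg _)]
    gcongr
    rw [ofReal_integral_norm_eq_lintegral_enorm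
      (integrable_of_continuous_polytorus (continuous_bohrLift _)), ← eLpNorm_one_eq_lintegral_enorm,
      hardyENorm]
    exact eLpNorm_le_eLpNorm_of_exponent_le hp1.out (continuous_bohrLift _).aestronglyMeasurable
  have h4 : A ≤ K ^ (1 / p.toReal) * ‖ofPolynomial p α P‖ := by
    have h5 : A ^ p.toReal ≤ K * ‖ofPolynomial p α P‖ ^ p.toReal := by
      rw [hK, div_mul_eq_mul_div, le_div_iff₀ (by positivity)]
      linarith
    have h6 := Real.rpow_le_rpow (by positivity) h5 (show 0 ≤ 1 / p.toReal by positivity)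
    rwa [← Real.rpow_mul hA0, mul_one_div_cancel hpr.ne', Real.rpow_one,
      Real.mul_rpow hKpos.le (by positivity), ← Real.rpow_mul (norm_nonneg _),
      mul_one_div_cancel hpr.ne', Real.rpow_one] at h6
  calc _ ≤ A * Z := h1
    _ ≤ (K ^ (1 / p.toReal) * ‖ofPolynomial p α P‖) * (Z + 1) := by
      gcongr
      linarith
    _ = _ := by ring

/-! ### Point evaluations on the Bergman spaces -/

theorem continuous_dirichletCoeff (p : ℝ≥0∞) [hp1 : Fact (1 ≤ p)] (α : ℝ) [Fact (-1 < α)]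
    (n : ℕ+) : Continuous (dirichletCoeff p α n) := by
  refine AddMonoidHomClass.continuous_of_bound (dirichletCoeff p α n)
    ‖(∫ σ : ℝ, ((n : ℂ) ^ (-(σ : ℂ))) ∂(bergmanMeasure α))⁻¹‖ fun f => ?_
  rw [show dirichletCoeff p α n f = (∫ σ : ℝ, ((n : ℂ) ^ (-(σ : ℂ))) ∂(bergmanMeasure α))⁻¹ *
    ∫ z, f z * (starRingEnd ℂ) (character n z.2) ∂(bergmanProd α) from rfl, norm_mul]
  gcongr
  have hf : Integrable f (bergmanProd α) := (Lp.memLp f).integrable hp1.out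
  refine (norm_integral_le_integral_norm _).trans ?_
  simp only [norm_mul, RCLike.norm_conj, norm_character, mul_one]
  rw [Lp.norm_def, integral_norm_eq_lintegral_enorm hf.1, ← eLpNorm_one_eq_lintegral_enorm]
  exact ENNReal.toReal_mono (Lp.eLpNorm_ne_top f)
    (eLpNorm_le_eLpNorm_of_exponent_le hp1.out hf.1)

theorem exists_seq_of_mem_bergmanSpace {p : ℝ≥0∞} [Fact (1 ≤ p)] {α : ℝ} [Fact (-1 < α)]
    {f : Lp ℂ p (bergmanProd α)} (hf : f ∈ bergmanSpace p α) :
    ∃ P : ℕ → DirichletPolynomial,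
      Filter.Tendsto (fun k => ofPolynomial p α (P k)) Filter.atTop (nhds f) := by
  obtain ⟨x, hx, hxf⟩ := mem_closure_iff_seq_limit.1 hf
  choose P hP using hx
  exact ⟨P, by simpa only [hP] using hxf⟩

theorem exists_sum_norm_dirichletCoeff_le (p : ℝ≥0∞) [hp1 : Fact (1 ≤ p)] (hp : p ≠ ∞) (α : ℝ)
    [Fact (-1 < α)] {s : ℂ} (hs : 1 / 2 < s.re) : ∃ C : ℝ, 0 < C ∧
      ∀ f ∈ bergmanSpace p α, ∀ T : Finset ℕ+,
        ∑ n ∈ T, ‖dirichletCoeff p α n f * (n : ℂ) ^ (-s)‖ ≤ C * ‖f‖ := by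
  classical
  obtain ⟨C, hC, h⟩ := exists_sum_norm_coeff_le p hp α hs
  refine ⟨C, hC, fun f hf T => ?_⟩
  obtain ⟨P, hP⟩ := exists_seq_of_mem_bergmanSpace hf
  refine le_of_tendsto_of_tendsto (tendsto_finsetSum T fun n _ =>
    ((((continuous_dirichletCoeff p α n).tendsto f).comp hP).mul_const _).norm)
    (hP.norm.const_mul C) (Filter.Eventually.of_forall fun k => ?_)
  refine le_trans ?_ (h (P k))
  simp only [Function.comp_apply, dirichletCoeff_ofPolynomial]
  have h1 : ∀ n : ℕ+, ‖P k n * (n : ℂ) ^ (-s)‖ = ‖P k n‖ * ((n : ℕ) : ℝ) ^ (-s.re) := fun n => by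
    rw [norm_mul, Complex.norm_natCast_cpow_of_pos n.pos, Complex.neg_re]
  simp only [h1]
  calc _ ≤ ∑ n ∈ T ∪ (P k).support, ‖P k n‖ * ((n : ℕ) : ℝ) ^ (-s.re) :=
        Finset.sum_le_sum_of_subset_of_nonneg Finset.subset_union_left
          fun n _ _ => by positivity
    _ = _ := by
        refine (Finset.sum_subset Finset.subset_union_right fun n _ hn => ?_).symm
        rw [Finsupp.notMem_support_iff.1 hn, norm_zero, zero_mul]

/-- Only existence and boundedness matter here, since the constant depends badly on `s`. The sharp
norm bound is recovered afterwards on polynomials. -/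
theorem exists_isPointEvaluation (p : ℝ≥0∞) [hp1 : Fact (1 ≤ p)] (hp : p ≠ ∞) (α : ℝ)
    [Fact (-1 < α)] {X : Submodule ℂ (Lp ℂ p (bergmanProd α))} (hX : X ≤ bergmanSpace p α)
    {s : ℂ} (hs : 1 / 2 < s.re) : ∃ δ : X →L[ℂ] ℂ, IsPointEvaluation X s δ := by
  obtain ⟨C, hC, h⟩ := exists_sum_norm_dirichletCoeff_le p hp α hs
  have hsum : ∀ f : X, Summable fun n : ℕ+ =>
      ‖dirichletCoeff p α n (f : Lp ℂ p (bergmanProd α)) * (n : ℂ) ^ (-s)‖ := fun f =>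
    summable_of_sum_le (fun n => norm_nonneg _) (h f (hX f.2))
  let L : X →ₗ[ℂ] ℂ :=
    { toFun := fun f => ∑' n : ℕ+,
        dirichletCoeff p α n (f : Lp ℂ p (bergmanProd α)) * (n : ℂ) ^ (-s)
      map_add' := fun f g => by
        rw [← (hsum f).of_norm.tsum_add (hsum g).of_norm]
        refine tsum_congr fun n => ?_
        rw [Submodule.coe_add, map_add, add_mul]
      map_smul' := fun c f => by
        rw [RingHom.id_apply, smul_eq_mul, ← tsum_mul_left]
        refine tsum_congr fun n => ?_
        rw [Submodule.coe_smul, map_smul, smul_eq_mul, mul_assoc] }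
  refine ⟨L.mkContinuous C fun f => ?_, fun f => (hsum f).of_norm.hasSum⟩
  exact (norm_tsum_le_tsum_norm (hsum f)).trans
    ((hsum f).tsum_le_of_sum_le (h f (hX f.2)))

theorem ofPolynomial_mem_bergmanSpace (p : ℝ≥0∞) [Fact (1 ≤ p)] (α : ℝ) [Fact (-1 < α)]
    (P : DirichletPolynomial) : ofPolynomial p α P ∈ bergmanSpace p α :=
  Submodule.le_topologicalClosure _ (LinearMap.mem_range_self _ P)

theorem IsPointEvaluation.apply_ofPolynomial {p : ℝ≥0∞} [Fact (1 ≤ p)] {α : ℝ} [Fact (-1 < α)]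
    {X : Submodule ℂ (Lp ℂ p (bergmanProd α))} {s : ℂ} {δ : X →L[ℂ] ℂ}
    (h : IsPointEvaluation X s δ) {P : DirichletPolynomial} (hP : ofPolynomial p α P ∈ X) :
    δ ⟨ofPolynomial p α P, hP⟩ = polyEval s P := by
  refine (h ⟨ofPolynomial p α P, hP⟩).unique ?_
  simp only [dirichletCoeff_ofPolynomial]
  exact hasSum_sum_of_ne_finset_zero fun n hn => by
    rw [Finsupp.notMem_support_iff.1 hn, zero_mul]

/-- As `δ` is already continuous, the sharp bound on polynomials passes to their closure. -/
theorem exists_norm_pointEvaluation_le (p : ℝ≥0∞) [hp1 : Fact (1 ≤ p)] (hp : p ≠ ∞) (α : ℝ)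
    [Fact (-1 < α)] : ∃ C : ℝ, 0 < C ∧ ∀ (s : ℂ) (δ : bergmanSpace p α →L[ℂ] ℂ),
      1 / 2 < s.re → IsPointEvaluation (bergmanSpace p α) s δ →
      ‖δ‖ ≤ C * (s.re / (s.re - 1 / 2)) ^ ((α + 2) / p.toReal) := by
  have hα' : -1 < α := Fact.out
  obtain ⟨C, hC, h⟩ := exists_norm_polyEval_le p hp α
  have hpr : 0 < p.toReal := by linarith [one_le_toReal hp]
  have hexp : 0 < (α + 2) / p.toReal := div_pos (by linarith) hpr
  refine ⟨C * 4 ^ ((α + 2) / p.toReal), by positivity, fun s δ hs hδ => ?_⟩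
  have hd : 0 < s.re - 1 / 2 := by linarith
  -- The cap at `1/4` keeps the bound uniform for large `Re s`, where `Re s / (Re s - 1/2)` stays
  -- above `1`.
  set t := min (1 / 4) ((s.re - 1 / 2) / 2) with ht
  have htpos : 0 < t := lt_min (by norm_num) (by linarith)
  have ht1 : 1 / t ≤ 4 * (s.re / (s.re - 1 / 2)) := by
    rw [div_le_iff₀ htpos, ht, mul_min_of_nonneg _ _ (by positivity), le_min_iff]
    constructor
    · have : 1 ≤ s.re / (s.re - 1 / 2) := by rw [le_div_iff₀ hd]; linarith
      linarith
    · have : 4 * (s.re / (s.re - 1 / 2)) * ((s.re - 1 / 2) / 2) = 2 * s.re := by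
        rw [show 4 * (s.re / (s.re - 1 / 2)) * ((s.re - 1 / 2) / 2) =
          2 * (s.re / (s.re - 1 / 2) * (s.re - 1 / 2)) by ring, div_mul_cancel₀ _ hd.ne']
      linarith
  have hM : C * (1 / t) ^ ((α + 2) / p.toReal) ≤
      C * 4 ^ ((α + 2) / p.toReal) * (s.re / (s.re - 1 / 2)) ^ ((α + 2) / p.toReal) := by
    rw [mul_assoc, ← Real.mul_rpow (by norm_num) (by positivity)]
    gcongr
  refine ContinuousLinearMap.opNorm_le_bound _ (by positivity) fun f => ?_
  obtain ⟨P, hP⟩ := exists_seq_of_mem_bergmanSpace f.2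
  have hP' : Filter.Tendsto (fun k => (⟨ofPolynomial p α (P k),
      ofPolynomial_mem_bergmanSpace p α (P k)⟩ : bergmanSpace p α)) Filter.atTop (nhds f) :=
    tendsto_subtype_rng.2 hP
  refine le_of_tendsto_of_tendsto ((δ.continuous.tendsto f).comp hP').norm
    (hP'.norm.const_mul _) (Filter.Eventually.of_forall fun k => ?_)
  simp only [Function.comp_apply]
  rw [hδ.apply_ofPolynomial]
  refine (h s t (P k) htpos (min_le_left _ _) (min_le_right _ _)).trans ?_
  exact mul_le_mul_of_nonneg_right hM (norm_nonneg _)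

theorem norm_pointEvaluation_le_of_le {p : ℝ≥0∞} [Fact (1 ≤ p)] {α : ℝ} [Fact (-1 < α)]
    {X Y : Submodule ℂ (Lp ℂ p (bergmanProd α))} (hXY : X ≤ Y) {s : ℂ} {δ : X →L[ℂ] ℂ}
    {δ' : Y →L[ℂ] ℂ} (h : IsPointEvaluation X s δ) (h' : IsPointEvaluation Y s δ') :
    ‖δ‖ ≤ ‖δ'‖ := by
  refine ContinuousLinearMap.opNorm_le_bound _ δ'.opNorm_nonneg fun f => ?_
  rw [(h f).unique (h' ⟨f, hXY f.2⟩)]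
  exact δ'.le_opNorm ⟨f, hXY f.2⟩

/-! ### The algebra of Dirichlet polynomials -/

/-- The homomorphism whose extension to Dirichlet polynomials is `bergmanLift`. -/
def bergmanHom (z : ℝ × Polytorus) : ℕ+ →* ℂ := dirichletHom (z.1 : ℂ) * characterHom z.2

/-- Products of Dirichlet polynomials are products in the monoid algebra of `ℕ+`. Multiplicative
functions extend to algebra homomorphisms, so lifts and values of products and powers factor. -/
theorem bohrLift_coeff (Q : MonoidAlgebra ℂ ℕ+) (x : Polytorus) :
    bohrLift Q.coeff x = MonoidAlgebra.lift ℂ ℂ ℕ+ (characterHom x) Q :=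
  (MonoidAlgebra.lift_apply' (R := ℂ) (A := ℂ) (characterHom x) Q).symm

theorem polyEval_coeff (Q : MonoidAlgebra ℂ ℕ+) (s : ℂ) :
    polyEval s Q.coeff = MonoidAlgebra.lift ℂ ℂ ℕ+ (dirichletHom s) Q :=
  (MonoidAlgebra.lift_apply' (R := ℂ) (A := ℂ) (dirichletHom s) Q).symm

theorem bergmanLift_coeff (Q : MonoidAlgebra ℂ ℕ+) (z : ℝ × Polytorus) :
    bergmanLift Q.coeff z = MonoidAlgebra.lift ℂ ℂ ℕ+ (bergmanHom z) Q := by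
  rw [bergmanLift_eq, MonoidAlgebra.lift_apply']
  refine Finset.sum_congr rfl fun n _ => ?_
  simp only [bergmanHom, MonoidHom.mul_apply, dirichletHom_apply, characterHom_apply, mul_assoc]
  rfl

/-- The finite sum `∑ χ(q) q^(-s)` over primes `q ∈ S`. -/
def primeSum (χ : ℕ+ →* ℂ) (S : Finset Nat.Primes) : MonoidAlgebra ℂ ℕ+ :=
  ∑ q ∈ S, MonoidAlgebra.single (q : ℕ+) (χ q)

/-- The finite sum `∑ Λ(n) χ(n) n^(-s)` over `n ∈ T`. -/
def mangoldtSum (χ : ℕ+ →* ℂ) (T : Finset ℕ+) : MonoidAlgebra ℂ ℕ+ :=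
  ∑ n ∈ T, MonoidAlgebra.single n ((ArithmeticFunction.vonMangoldt (n : ℕ) : ℂ) * χ n)

/-- The truncated exponential series of `β * primeSum χ S`. -/
def expPrimeSum (β : ℂ) (J : ℕ) (χ : ℕ+ →* ℂ) (S : Finset Nat.Primes) : MonoidAlgebra ℂ ℕ+ :=
  ∑ j ∈ Finset.range J, (β ^ j / (j.factorial : ℂ)) • primeSum χ S ^ j

theorem lift_primeSum (ψ χ : ℕ+ →* ℂ) (S : Finset Nat.Primes) :
    MonoidAlgebra.lift ℂ ℂ ℕ+ ψ (primeSum χ S) = ∑ q ∈ S, (χ * ψ) (q : ℕ+) := by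
  simp [primeSum, MonoidAlgebra.lift_single]

theorem lift_mangoldtSum (ψ χ : ℕ+ →* ℂ) (T : Finset ℕ+) :
    MonoidAlgebra.lift ℂ ℂ ℕ+ ψ (mangoldtSum χ T) =
      ∑ n ∈ T, (ArithmeticFunction.vonMangoldt (n : ℕ) : ℂ) * (χ * ψ) n := by
  simp [mangoldtSum, MonoidAlgebra.lift_single, mul_assoc]

theorem lift_expPrimeSum (ψ : ℕ+ →* ℂ) (β : ℂ) (J : ℕ) (χ : ℕ+ →* ℂ) (S : Finset Nat.Primes) :
    MonoidAlgebra.lift ℂ ℂ ℕ+ ψ (expPrimeSum β J χ S) =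
      ∑ j ∈ Finset.range J, (β * ∑ q ∈ S, (χ * ψ) (q : ℕ+)) ^ j / (j.factorial : ℂ) := by
  rw [expPrimeSum, map_sum]
  refine Finset.sum_congr rfl fun j _ => ?_
  rw [map_smul, map_pow, lift_primeSum, smul_eq_mul, mul_pow]
  ring

/-! ### Coefficient bounds -/

open scoped Classical in
theorem norm_coeff_mul_single_le (χ : ℕ+ →* ℂ) (Q : MonoidAlgebra ℂ ℕ+) (d n : ℕ+) (r : ℂ)
    {A B : ℝ} (hA : 0 ≤ A) (hQ : ∀ e, e * d = n → ‖Q.coeff e‖ ≤ A * ‖χ e‖)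
    (hr : ‖r‖ ≤ B * ‖χ d‖) :
    ‖(Q * MonoidAlgebra.single d r).coeff n‖ ≤ if d ∣ n then A * B * ‖χ n‖ else 0 := by
  split_ifs with h
  · obtain ⟨e, rfl⟩ := h
    rw [mul_comm d e, MonoidAlgebra.coeff_mul_single_mul, norm_mul, map_mul, norm_mul]
    calc ‖Q.coeff e‖ * ‖r‖ ≤ (A * ‖χ e‖) * (B * ‖χ d‖) := by
          have := hQ e (mul_comm e d)
          gcongr
      _ = _ := by ring
  · rw [MonoidAlgebra.coeff_mul_single_of_forall_mul_ne, norm_zero]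
    intro e he
    exact h ⟨e, by rw [← he, mul_comm]⟩

/-- The number of prime factors of `n`, counted with multiplicity. -/
def numPrimeFactors (n : ℕ+) : ℕ := Multiset.card (n.factorMultiset : Multiset Nat.Primes)

theorem numPrimeFactors_mul_prime (n : ℕ+) (q : Nat.Primes) :
    numPrimeFactors (n * q) = numPrimeFactors n + 1 := by
  unfold numPrimeFactors
  rw [PNat.factorMultiset_mul, PNat.factorMultiset_ofPrime]
  exact (Multiset.card_add _ _).trans (congrArg _ (Multiset.card_singleton q))

open scoped Classical in
theorem card_filter_dvd_le (S : Finset Nat.Primes) (n : ℕ+) :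
    (S.filter fun q : Nat.Primes => (q : ℕ+) ∣ n).card ≤ numPrimeFactors n := by
  refine le_trans (Finset.card_le_card fun q hq => ?_)
    (Multiset.toFinset_card_le (n.factorMultiset : Multiset Nat.Primes))
  have h := (PNat.count_factorMultiset n q 1).1 (by simpa using (Finset.mem_filter.1 hq).2)
  exact Multiset.mem_toFinset.2 (Multiset.count_pos.1 h)

/-- An index with `j + 1` prime factors has at most `j + 1` distinct prime divisors, and each
contributes at most `j!`. -/
theorem norm_coeff_primeSum_pow_le (χ : ℕ+ →* ℂ) (S : Finset Nat.Primes) (j : ℕ) (n : ℕ+) :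
    ‖(primeSum χ S ^ j).coeff n‖ ≤
      if numPrimeFactors n = j then (j.factorial : ℝ) * ‖χ n‖ else 0 := by
  classical
  induction j generalizing n with
  | zero =>
    rw [pow_zero, MonoidAlgebra.one_def, MonoidAlgebra.coeff_single]
    by_cases h1 : n = 1
    · subst h1
      have h0 : numPrimeFactors 1 = 0 := by
        rw [numPrimeFactors, PNat.factorMultiset_one]
        exact Multiset.card_zero
      simp [h0]
    · rw [Finsupp.single_eq_of_ne h1, norm_zero]
      split_ifs <;> positivity
  | succ j ih =>
    have h1 : ‖(primeSum χ S ^ (j + 1)).coeff n‖ ≤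
        ∑ q ∈ S, ‖(primeSum χ S ^ j * MonoidAlgebra.single (q : ℕ+) (χ q)).coeff n‖ := by
      have h2 : primeSum χ S ^ (j + 1) =
          ∑ q ∈ S, primeSum χ S ^ j * MonoidAlgebra.single (q : ℕ+) (χ q) := by
        rw [← Finset.mul_sum, pow_succ]
        rfl
      rw [h2, MonoidAlgebra.coeff_sum, Finsupp.finsetSum_apply]
      exact norm_sum_le _ _
    have h2 : ∀ q ∈ S, ‖(primeSum χ S ^ j * MonoidAlgebra.single (q : ℕ+) (χ q)).coeff n‖ ≤
        if (q : ℕ+) ∣ n then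
          (if numPrimeFactors n = j + 1 then (j.factorial : ℝ) else 0) * 1 * ‖χ n‖ else 0 := by
      intro q _
      have hA : (0 : ℝ) ≤ if numPrimeFactors n = j + 1 then (j.factorial : ℝ) else 0 := by
        split_ifs <;> positivity
      refine norm_coeff_mul_single_le χ _ _ _ _ hA
        (fun e he => (ih e).trans_eq ?_) (by rw [one_mul])
      rw [← he, numPrimeFactors_mul_prime, ite_mul, zero_mul]
      simp only [Nat.add_right_cancel_iff]
    refine h1.trans ((Finset.sum_le_sum h2).trans ?_)
    rw [← Finset.sum_filter, Finset.sum_const, nsmul_eq_mul]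
    split_ifs with h
    · have h3 : ((S.filter fun q : Nat.Primes => (q : ℕ+) ∣ n).card : ℝ) ≤ (j + 1 : ℕ) := by
        exact_mod_cast (card_filter_dvd_le S n).trans_eq h
      calc _ ≤ ((j + 1 : ℕ) : ℝ) * ((j.factorial : ℝ) * 1 * ‖χ n‖) := by gcongr
        _ = _ := by rw [Nat.factorial_succ]; push_cast; ring
    · simp

/-- Only the term with `j` equal to the number of prime factors of `n` contributes, and its `1/j!`
cancels the `j!`. The exponential is thus dominated by the zeta series twisted by `χ`. -/
theorem norm_coeff_expPrimeSum_le (J : ℕ) (χ : ℕ+ →* ℂ) (S : Finset Nat.Primes) (n : ℕ+) :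
    ‖(expPrimeSum 1 J χ S).coeff n‖ ≤ ‖χ n‖ := by
  rw [expPrimeSum, MonoidAlgebra.coeff_sum, Finsupp.finsetSum_apply]
  refine (norm_sum_le _ _).trans ?_
  have h : ∀ j ∈ Finset.range J,
      ‖(((1 : ℂ) ^ j / (j.factorial : ℂ)) • primeSum χ S ^ j).coeff n‖ ≤
        if numPrimeFactors n = j then ‖χ n‖ else 0 := by
    intro j _
    have hj : (0 : ℝ) < j.factorial := by exact_mod_cast j.factorial_pos
    rw [MonoidAlgebra.coeff_smul_apply, norm_smul, one_pow, norm_div, norm_one,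
      Complex.norm_natCast]
    refine (mul_le_mul_of_nonneg_left (norm_coeff_primeSum_pow_le χ S j n) (by positivity)).trans ?_
    split_ifs
    · rw [← mul_assoc, one_div_mul_cancel hj.ne', one_mul]
    · simp
  refine (Finset.sum_le_sum h).trans ?_
  rw [Finset.sum_ite_eq]
  split_ifs
  · exact le_rfl
  · exact norm_nonneg _

open scoped Classical in
theorem sum_filter_vonMangoldt_le (T : Finset ℕ+) (n : ℕ+) :
    ∑ d ∈ T.filter (fun d => d ∣ n), ArithmeticFunction.vonMangoldt (d : ℕ) ≤
      Real.log (n : ℕ) := by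
  rw [← ArithmeticFunction.vonMangoldt_sum]
  refine (Finset.sum_map (T.filter fun d => d ∣ n) ⟨((↑) : ℕ+ → ℕ), PNat.coe_injective⟩
      fun d => ArithmeticFunction.vonMangoldt d).symm.trans_le ?_
  refine Finset.sum_le_sum_of_subset_of_nonneg (fun d hd => ?_)
    fun _ _ _ => ArithmeticFunction.vonMangoldt_nonneg
  obtain ⟨e, he, rfl⟩ := Finset.mem_map.1 hd
  exact Nat.mem_divisors.2 ⟨PNat.dvd_iff.1 (Finset.mem_filter.1 he).2, n.ne_zero⟩

/-- Divisors `e` of `n` satisfy `log e ≤ log n`, and the values of `Λ` over the divisors of `n` sum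
to `log n`; each factor costs one logarithm. -/
theorem norm_coeff_mul_mangoldtSum_le (χ : ℕ+ →* ℂ) (T : Finset ℕ+) (Q : MonoidAlgebra ℂ ℕ+)
    (m : ℕ) (hQ : ∀ n : ℕ+, ‖Q.coeff n‖ ≤ Real.log (n : ℕ) ^ m * ‖χ n‖) (n : ℕ+) :
    ‖(Q * mangoldtSum χ T).coeff n‖ ≤ Real.log (n : ℕ) ^ (m + 1) * ‖χ n‖ := by
  have hlog : 0 ≤ Real.log (n : ℕ) := Real.log_natCast_nonneg _
  rw [mangoldtSum, Finset.mul_sum, MonoidAlgebra.coeff_sum, Finsupp.finsetSum_apply]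
  refine (norm_sum_le _ _).trans ?_
  classical
  have h : ∀ d ∈ T, ‖(Q * MonoidAlgebra.single d
      ((ArithmeticFunction.vonMangoldt (d : ℕ) : ℂ) * χ d)).coeff n‖ ≤ if d ∣ n then
        Real.log (n : ℕ) ^ m * ArithmeticFunction.vonMangoldt (d : ℕ) * ‖χ n‖ else 0 := by
    intro d _
    refine norm_coeff_mul_single_le χ Q d n _ (by positivity)
      (fun e he => (hQ e).trans ?_) (le_of_eq ?_)
    · have he1 : (1 : ℝ) ≤ (e : ℕ) := by exact_mod_cast e.pos
      have hen : ((e : ℕ) : ℝ) ≤ (n : ℕ) := by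
        exact_mod_cast Nat.le_of_dvd n.pos (PNat.dvd_iff.1 ⟨d, he.symm⟩)
      have := Real.log_nonneg he1
      gcongr
    · rw [norm_mul, Complex.norm_real, Real.norm_of_nonneg ArithmeticFunction.vonMangoldt_nonneg]
  refine (Finset.sum_le_sum h).trans ?_
  rw [← Finset.sum_filter, ← Finset.sum_mul, ← Finset.mul_sum, pow_succ]
  gcongr
  exact sum_filter_vonMangoldt_le T n

theorem norm_coeff_expPrimeSum_mul_le (J : ℕ) (χ : ℕ+ →* ℂ) (S : Finset Nat.Primes)
    (T : Finset ℕ+) (m : ℕ) (n : ℕ+) :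
    ‖(expPrimeSum 1 J χ S * mangoldtSum χ T ^ m).coeff n‖ ≤ Real.log (n : ℕ) ^ m * ‖χ n‖ := by
  induction m generalizing n with
  | zero => simpa using norm_coeff_expPrimeSum_le J χ S n
  | succ m ih =>
    rw [pow_succ, ← mul_assoc]
    exact norm_coeff_mul_mangoldtSum_le χ T _ m ih n

/-- `Λ(1) = 0`, and no other `d` divides `1`. This puts the test functions in the subspace with
vanishing first coefficient. -/
theorem coeff_mul_mangoldtSum_one (χ : ℕ+ →* ℂ) (T : Finset ℕ+) (Q : MonoidAlgebra ℂ ℕ+) :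
    (Q * mangoldtSum χ T).coeff 1 = 0 := by
  rw [mangoldtSum, Finset.mul_sum, MonoidAlgebra.coeff_sum, Finsupp.finsetSum_apply]
  refine Finset.sum_eq_zero fun d _ => ?_
  by_cases hd : d = 1
  · subst hd
    simp
  · refine MonoidAlgebra.coeff_mul_single_of_forall_mul_ne _ _ fun e he => hd ?_
    rw [mul_comm] at he
    exact (PNat.dvd_one_iff d).1 ⟨e, he.symm⟩

/-! ### Mean squares -/

theorem integral_norm_sq_bohrLift (P : DirichletPolynomial) :
    ∫ x, ‖bohrLift P x‖ ^ 2 ∂polytorusMeasure = ∑ n ∈ P.support, ‖P n‖ ^ 2 := by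
  have h1 : ∀ x, ((‖bohrLift P x‖ ^ 2 : ℝ) : ℂ) = ∑ n ∈ P.support, ∑ m ∈ P.support,
      (P n * (starRingEnd ℂ) (P m)) * (character n x * (starRingEnd ℂ) (character m x)) := by
    intro x
    rw [← Complex.normSq_eq_norm_sq, ← Complex.mul_conj, bohrLift, Finsupp.sum, map_sum,
      Finset.sum_mul_sum]
    refine Finset.sum_congr rfl fun n _ => Finset.sum_congr rfl fun m _ => ?_
    rw [map_mul]
    ring
  have hi : ∀ n m : ℕ+, Integrable (fun x => (P n * (starRingEnd ℂ) (P m)) *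
      (character n x * (starRingEnd ℂ) (character m x))) polytorusMeasure := fun n m =>
    integrable_of_continuous_polytorus (continuous_const.mul ((continuous_character n).mul
      (Complex.continuous_conj.comp (continuous_character m))))
  have h2 : ((∫ x, ‖bohrLift P x‖ ^ 2 ∂polytorusMeasure : ℝ) : ℂ) =
      ((∑ n ∈ P.support, ‖P n‖ ^ 2 : ℝ) : ℂ) := by
    rw [← integral_complex_ofReal]
    simp only [h1]
    rw [integral_finsetSum _ fun n _ => integrable_finsetSum _ fun m _ => hi n m]
    push_cast
    refine Finset.sum_congr rfl fun n hn => ?_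
    rw [integral_finsetSum _ fun m _ => hi n m]
    simp only [integral_const_mul, integral_character_mul_conj]
    rw [Finset.sum_eq_single n]
    · rw [if_pos rfl, mul_one, Complex.mul_conj, Complex.normSq_eq_norm_sq]
      push_cast
      rfl
    · intro m _ hm
      rw [if_neg hm.symm, mul_zero]
    · exact fun h => absurd hn h
  exact_mod_cast h2

/-- Half of the excess `y` pays for the logarithms, through `v^m / m! ≤ exp v` at `v = (y/2) log n`.
-/
theorem rpow_log_pow_le {y : ℝ} (hy : 0 < y) (m : ℕ) (n : ℕ+) :
    Real.log (n : ℕ) ^ m * ((n : ℕ) : ℝ) ^ (-(1 + y)) ≤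
      (m.factorial * (2 / y) ^ m) * ((n : ℕ) : ℝ) ^ (-(1 + y / 2)) := by
  have hn : (0 : ℝ) < (n : ℕ) := by exact_mod_cast n.pos
  have hlog : 0 ≤ Real.log (n : ℕ) := Real.log_natCast_nonneg _
  have hm : (0 : ℝ) < m.factorial := by exact_mod_cast m.factorial_pos
  have h1 := Real.pow_div_factorial_le_exp (y / 2 * Real.log (n : ℕ)) (by positivity) m
  rw [div_le_iff₀ hm, mul_pow, mul_comm (y / 2) (Real.log _), ← Real.rpow_def_of_pos hn] at h1
  have h2 : Real.log (n : ℕ) ^ m ≤ (m.factorial * (2 / y) ^ m) * ((n : ℕ) : ℝ) ^ (y / 2) := by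
    have h3 : (2 / y) ^ m * (y / 2) ^ m = 1 := by
      rw [← mul_pow]
      field_simp
      exact one_pow m
    calc Real.log (n : ℕ) ^ m = (2 / y) ^ m * ((y / 2) ^ m * Real.log (n : ℕ) ^ m) := by
          rw [← mul_assoc, h3, one_mul]
      _ ≤ (2 / y) ^ m * (((n : ℕ) : ℝ) ^ (y / 2) * m.factorial) := by gcongr
      _ = _ := by ring
  calc _ ≤ (m.factorial * (2 / y) ^ m) * ((n : ℕ) : ℝ) ^ (y / 2) * ((n : ℕ) : ℝ) ^ (-(1 + y)) := by
        gcongr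
    _ = _ := by
        rw [mul_assoc, ← Real.rpow_add hn]
        congr 2
        ring

/-- The mean square of the truncated test functions. -/
theorem integral_norm_sq_expPrimeSum_mul_le (J : ℕ) (S : Finset Nat.Primes) (T : Finset ℕ+)
    (m : ℕ) {s : ℂ} (hs : 1 / 2 < s.re) :
    ∫ x, ‖bohrLift (expPrimeSum 1 J (dirichletHom s) S *
      mangoldtSum (dirichletHom s) T ^ m).coeff x‖ ^ 2 ∂polytorusMeasure ≤
      (2 * m).factorial * (1 + 1 / (s.re - 1 / 2)) ^ (2 * m + 1) := by
  rw [integral_norm_sq_bohrLift]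
  set y := 2 * s.re - 1 with hy
  have hypos : 0 < y := by linarith
  set B : ℝ := (2 * m).factorial * (2 / y) ^ (2 * m) with hB
  have hB0 : 0 ≤ B := by positivity
  set P := (expPrimeSum 1 J (dirichletHom s) S * mangoldtSum (dirichletHom s) T ^ m).coeff
  have h1 : ∀ n : ℕ+, ‖P n‖ ^ 2 ≤ B * ((n : ℕ) : ℝ) ^ (-(1 + y / 2)) := by
    intro n
    have hn : (0 : ℝ) < (n : ℕ) := by exact_mod_cast n.pos
    have h2 := norm_coeff_expPrimeSum_mul_le J (dirichletHom s) S T m n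
    rw [norm_dirichletHom] at h2
    calc ‖P n‖ ^ 2 ≤ (Real.log (n : ℕ) ^ m * ((n : ℕ) : ℝ) ^ (-s.re)) ^ 2 := by gcongr
      _ = Real.log (n : ℕ) ^ (2 * m) * ((n : ℕ) : ℝ) ^ (-(1 + y)) := by
          rw [mul_pow, ← pow_mul, mul_comm m 2, ← Real.rpow_natCast (((n : ℕ) : ℝ) ^ (-s.re)),
            ← Real.rpow_mul hn.le]
          congr 2
          rw [hy]
          push_cast
          ring
      _ ≤ _ := rpow_log_pow_le hypos (2 * m) n
  have h3 := summable_pnat_rpow (x := 1 + y / 2) (by linarith)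
  calc ∑ n ∈ P.support, ‖P n‖ ^ 2
      ≤ ∑ n ∈ P.support, B * ((n : ℕ) : ℝ) ^ (-(1 + y / 2)) := Finset.sum_le_sum fun n _ => h1 n
    _ ≤ B * ∑' n : ℕ+, ((n : ℕ) : ℝ) ^ (-(1 + y / 2)) := by
        rw [← Finset.mul_sum]
        gcongr
        exact h3.sum_le_tsum _ fun n _ => by positivity
    _ ≤ B * (1 + 1 / (1 + y / 2 - 1)) := by
        gcongr
        exact tsum_pnat_rpow_le (by linarith)
    _ = (2 * m).factorial * ((2 / y) ^ (2 * m) * (1 + 2 / y)) := by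
        rw [hB, show 1 / (1 + y / 2 - 1) = 2 / y by rw [add_sub_cancel_left]; field_simp]
        ring
    _ ≤ _ := by
        have h4 : 1 / (s.re - 1 / 2) = 2 / y := by
          rw [hy, show s.re - 1 / 2 = (2 * s.re - 1) / 2 by ring]
          field_simp
        rw [h4, pow_succ]
        gcongr
        linarith

/-! ### Limits of the test functions -/

theorem tendsto_sum_pow_div_factorial (w : ℂ) :
    Filter.Tendsto (fun J => ∑ j ∈ Finset.range J, w ^ j / (j.factorial : ℂ)) Filter.atTop
      (nhds (Complex.exp w)) := by
  rw [Complex.exp_eq_exp_ℂ]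
  exact (NormedSpace.expSeries_div_hasSum_exp w).tendsto_sum_nat

theorem norm_sum_pow_div_factorial_le (w : ℂ) (J : ℕ) :
    ‖∑ j ∈ Finset.range J, w ^ j / (j.factorial : ℂ)‖ ≤ Real.exp ‖w‖ := by
  refine (norm_sum_le _ _).trans (le_trans (le_of_eq ?_)
    (Real.sum_le_exp_of_nonneg (norm_nonneg w) J))
  exact Finset.sum_congr rfl fun j _ => by rw [norm_div, norm_pow, Complex.norm_natCast]

theorem lintegral_le_of_tendsto_of_forall_le {Ω : Type*} [MeasurableSpace Ω] {ν : Measure Ω}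
    {f : ℕ → Ω → ℝ≥0∞} {g : Ω → ℝ≥0∞} {C : ℝ≥0∞} (hf : ∀ n, Measurable (f n))
    (hlim : ∀ x, Filter.Tendsto (fun n => f n x) Filter.atTop (nhds (g x)))
    (hC : ∀ n, ∫⁻ x, f n x ∂ν ≤ C) : ∫⁻ x, g x ∂ν ≤ C := by
  have h : g = fun x => Filter.liminf (fun n => f n x) Filter.atTop :=
    funext fun x => (hlim x).liminf_eq.symm
  rw [h]
  refine (lintegral_liminf_le hf).trans ?_
  exact (Filter.liminf_le_liminf (Filter.Eventually.of_forall hC)).trans_eq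
    (Filter.liminf_const C)

theorem dirichletHom_add (s t : ℂ) : dirichletHom (s + t) = dirichletHom s * dirichletHom t := by
  ext n
  rw [MonoidHom.mul_apply, dirichletHom_apply, dirichletHom_apply, dirichletHom_apply, neg_add,
    Complex.cpow_add _ _ (by exact_mod_cast n.ne_zero)]

/-- The Bergman lift of `∑ q^(-s)` over `q ∈ S`, twisted by `q^(-s')`. -/
def primeLift (s : ℂ) (S : Finset Nat.Primes) (z : ℝ × Polytorus) : ℂ :=
  bergmanLift (primeSum (dirichletHom s) S).coeff z

/-- The Bergman lift of `∑ Λ(n) n^(-s)` over `n ∈ T`, twisted by `n^(-s')`. -/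
def mangoldtLift (s : ℂ) (T : Finset ℕ+) (z : ℝ × Polytorus) : ℂ :=
  bergmanLift (mangoldtSum (dirichletHom s) T).coeff z

theorem continuous_primeLift (s : ℂ) (S : Finset Nat.Primes) : Continuous (primeLift s S) :=
  continuous_bergmanLift _

theorem continuous_mangoldtLift (s : ℂ) (T : Finset ℕ+) : Continuous (mangoldtLift s T) :=
  continuous_bergmanLift _

theorem primeLift_eq (s : ℂ) (S : Finset Nat.Primes) (z : ℝ × Polytorus) :
    primeLift s S z =
      ∑ q ∈ S, (dirichletHom (s + z.1) * characterHom z.2 : ℕ+ →* ℂ) (q : ℕ+) := by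
  rw [primeLift, bergmanLift_coeff, lift_primeSum, bergmanHom, ← mul_assoc, ← dirichletHom_add]

theorem mangoldtLift_eq (s : ℂ) (T : Finset ℕ+) (z : ℝ × Polytorus) :
    mangoldtLift s T z = ∑ n ∈ T, (ArithmeticFunction.vonMangoldt (n : ℕ) : ℂ) *
      (dirichletHom (s + z.1) * characterHom z.2 : ℕ+ →* ℂ) n := by
  rw [mangoldtLift, bergmanLift_coeff, lift_mangoldtSum, bergmanHom, ← mul_assoc,
    ← dirichletHom_add]

theorem norm_dirichletHom_mul_characterHom_le_one {s : ℂ} (hs : 0 ≤ s.re) {z : ℝ × Polytorus}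
    (hz : 0 < z.1) (n : ℕ+) :
    ‖(dirichletHom (s + z.1) * characterHom z.2 : ℕ+ →* ℂ) n‖ ≤ 1 := by
  rw [MonoidHom.mul_apply, norm_mul, characterHom_apply, norm_character, mul_one,
    norm_dirichletHom]
  refine Real.rpow_le_one_of_one_le_of_nonpos (by exact_mod_cast n.pos) ?_
  simp only [Complex.add_re, Complex.ofReal_re]
  linarith

theorem norm_primeLift_le {s : ℂ} (hs : 0 ≤ s.re) (S : Finset Nat.Primes) {z : ℝ × Polytorus}
    (hz : 0 < z.1) : ‖primeLift s S z‖ ≤ S.card := by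
  rw [primeLift_eq]
  refine (norm_sum_le_of_le (n := fun _ => 1) _ fun q _ =>
    norm_dirichletHom_mul_characterHom_le_one hs hz _).trans_eq ?_
  simp

theorem norm_mangoldtLift_le {s : ℂ} (hs : 0 ≤ s.re) (T : Finset ℕ+) {z : ℝ × Polytorus}
    (hz : 0 < z.1) :
    ‖mangoldtLift s T z‖ ≤ ∑ n ∈ T, ArithmeticFunction.vonMangoldt (n : ℕ) := by
  rw [mangoldtLift_eq]
  refine norm_sum_le_of_le _ fun n _ => ?_
  rw [norm_mul, Complex.norm_real, Real.norm_of_nonneg ArithmeticFunction.vonMangoldt_nonneg]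
  exact mul_le_of_le_one_right ArithmeticFunction.vonMangoldt_nonneg
    (norm_dirichletHom_mul_characterHom_le_one hs hz _)

/-- The polynomials approximating `exp (β ∑ q^(-s)) (∑ Λ(n) n^(-s))^k`. -/
def testPolynomial (β s : ℂ) (S : Finset Nat.Primes) (T : Finset ℕ+) (k J : ℕ) :
    DirichletPolynomial :=
  (expPrimeSum β J (dirichletHom s) S * mangoldtSum (dirichletHom s) T ^ k).coeff

theorem bergmanLift_testPolynomial (β s : ℂ) (S : Finset Nat.Primes) (T : Finset ℕ+) (k J : ℕ)
    (z : ℝ × Polytorus) : bergmanLift (testPolynomial β s S T k J) z =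
      (∑ j ∈ Finset.range J, (β * primeLift s S z) ^ j / (j.factorial : ℂ)) *
        mangoldtLift s T z ^ k := by
  rw [testPolynomial, bergmanLift_coeff, map_mul, map_pow, ← bergmanLift_coeff (mangoldtSum _ _),
    lift_expPrimeSum, ← lift_primeSum, ← bergmanLift_coeff]
  rfl

theorem polyEval_testPolynomial (β s w : ℂ) (S : Finset Nat.Primes) (T : Finset ℕ+) (k J : ℕ) :
    polyEval w (testPolynomial β s S T k J) =
      (∑ j ∈ Finset.range J, (β * ∑ q ∈ S, dirichletHom (s + w) (q : ℕ+)) ^ j /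
        (j.factorial : ℂ)) *
      (∑ n ∈ T, (ArithmeticFunction.vonMangoldt (n : ℕ) : ℂ) * dirichletHom (s + w) n) ^ k := by
  rw [testPolynomial, polyEval_coeff, map_mul, map_pow, lift_expPrimeSum, lift_mangoldtSum,
    dirichletHom_add]

theorem testPolynomial_one (β s : ℂ) (S : Finset Nat.Primes) (T : Finset ℕ+) {k : ℕ} (hk : k ≠ 0)
    (J : ℕ) : testPolynomial β s S T k J 1 = 0 := by
  obtain ⟨k, rfl⟩ := Nat.exists_eq_succ_of_ne_zero hk
  rw [testPolynomial, Nat.succ_eq_add_one, pow_succ, ← mul_assoc]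
  exact coeff_mul_mangoldtSum_one _ _ _

theorem enorm_ofPolynomial_rpow_eq_lintegral {p : ℝ≥0∞} [hp1 : Fact (1 ≤ p)] (hp : p ≠ ∞)
    (α : ℝ) [Fact (-1 < α)] (P : DirichletPolynomial) :
    ‖ofPolynomial p α P‖ₑ ^ p.toReal =
      ∫⁻ z, ‖bergmanLift P z‖ₑ ^ p.toReal ∂(bergmanProd α) := by
  have hp0 : p ≠ 0 := (zero_lt_one.trans_le hp1.out).ne'
  have hpr : p.toReal ≠ 0 := (ENNReal.toReal_pos hp0 hp).ne'
  change ‖(memLp_bergmanLift p α P).toLp (bergmanLift P)‖ₑ ^ p.toReal = _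
  rw [Lp.enorm_toLp, eLpNorm_eq_lintegral_rpow_enorm_toReal hp0 hp, ← ENNReal.rpow_mul,
    one_div_mul_cancel hpr, ENNReal.rpow_one]

/-- For finite `S` and `T` the lifts are bounded where `u > 0`, uniformly in `J`, so dominated
convergence applies. The genuine exponential is needed because its modulus can be raised to real
powers exactly, unlike that of a truncation. -/
theorem tendsto_enorm_testPolynomial {p : ℝ≥0∞} [hp1 : Fact (1 ≤ p)] (hp : p ≠ ∞)
    (α : ℝ) [Fact (-1 < α)] (β : ℂ) {s : ℂ} (hs : 0 ≤ s.re) (S : Finset Nat.Primes)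
    (T : Finset ℕ+) (k : ℕ) :
    Filter.Tendsto (fun J => ‖ofPolynomial p α (testPolynomial β s S T k J)‖ₑ ^ p.toReal)
      Filter.atTop (nhds (∫⁻ z, ‖Complex.exp (β * primeLift s S z) *
        mangoldtLift s T z ^ k‖ₑ ^ p.toReal ∂(bergmanProd α))) := by
  have hpr : 0 < p.toReal := by linarith [one_le_toReal hp]
  simp only [enorm_ofPolynomial_rpow_eq_lintegral hp]
  set B : ℝ := Real.exp (‖β‖ * S.card) *
    (∑ n ∈ T, ArithmeticFunction.vonMangoldt (n : ℕ)) ^ k with hB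
  refine tendsto_lintegral_of_dominated_convergence (fun _ => ENNReal.ofReal B ^ p.toReal)
    (fun J => (continuous_bergmanLift _).measurable.enorm.pow_const _) (fun J => ?_) ?_ ?_
  · have h2 : ∀ᵐ z ∂(bergmanProd α), 0 < z.1 :=
      (Measure.quasiMeasurePreserving_fst (μ := bergmanMeasure α) (ν := polytorusMeasure)).ae
        (ae_bergmanMeasure α)
    filter_upwards [h2] with z hz
    rw [← ofReal_norm]
    refine ENNReal.rpow_le_rpow (ENNReal.ofReal_le_ofReal ?_) hpr.le
    rw [bergmanLift_testPolynomial, norm_mul, norm_pow]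
    have h3 := norm_primeLift_le hs S hz
    have h4 := norm_mangoldtLift_le hs T hz
    have h5 : ‖∑ j ∈ Finset.range J, (β * primeLift s S z) ^ j / (j.factorial : ℂ)‖ ≤
        Real.exp (‖β‖ * S.card) := by
      refine (norm_sum_pow_div_factorial_le _ _).trans (Real.exp_le_exp.2 ?_)
      rw [norm_mul]
      gcongr
    rw [hB]
    gcongr
  · rw [lintegral_const, measure_univ, mul_one]
    exact ENNReal.rpow_ne_top_of_nonneg hpr.le ENNReal.ofReal_ne_top
  · refine ae_of_all _ fun z => ?_
    simp only [bergmanLift_testPolynomial]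
    exact (((tendsto_sum_pow_div_factorial _).mul_const _).enorm).ennrpow_const _

/-! ### The norm of the test functions -/

theorem bohrLift_expPrimeSum_mul (s : ℂ) (S : Finset Nat.Primes) (T : Finset ℕ+) (m J : ℕ)
    (u : ℝ) (x : Polytorus) :
    bohrLift (expPrimeSum 1 J (dirichletHom (s + u)) S *
      mangoldtSum (dirichletHom (s + u)) T ^ m).coeff x =
      (∑ j ∈ Finset.range J, primeLift s S (u, x) ^ j / (j.factorial : ℂ)) *
        mangoldtLift s T (u, x) ^ m := by
  rw [bohrLift_coeff, map_mul, map_pow, lift_expPrimeSum, lift_mangoldtSum, primeLift_eq,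
    mangoldtLift_eq, one_mul]

/-- The mean-square bound does not depend on the truncation `J`, so Fatou carries it to the
exponential. -/
theorem lintegral_exp_primeLift_mul_le (s : ℂ) (S : Finset Nat.Primes) (T : Finset ℕ+) (m : ℕ)
    {u : ℝ} (hu : 1 / 2 < s.re + u) :
    ∫⁻ x, ENNReal.ofReal (‖Complex.exp (primeLift s S (u, x)) * mangoldtLift s T (u, x) ^ m‖ ^ 2)
      ∂polytorusMeasure ≤
      ENNReal.ofReal ((2 * m).factorial * (1 + 1 / (s.re - 1 / 2 + u)) ^ (2 * m + 1)) := by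
  have hre : (s + u).re = s.re + u := by simp
  set Q : ℕ → DirichletPolynomial := fun J => (expPrimeSum 1 J (dirichletHom (s + u)) S *
      mangoldtSum (dirichletHom (s + u)) T ^ m).coeff with hQ
  refine lintegral_le_of_tendsto_of_forall_le
    (f := fun J x => ENNReal.ofReal (‖bohrLift (Q J) x‖ ^ 2)) (fun J => ?_) (fun x => ?_)
    fun J => ?_
  · exact ((continuous_bohrLift _).norm.pow 2).measurable.ennreal_ofReal
  · simp only [hQ, bohrLift_expPrimeSum_mul]
    exact ENNReal.tendsto_ofReal
      (((tendsto_sum_pow_div_factorial _).mul_const _).norm.pow 2)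
  · rw [← ofReal_integral_eq_lintegral_ofReal (f := fun x => ‖bohrLift (Q J) x‖ ^ 2)
      (integrable_of_continuous_polytorus ((continuous_bohrLift _).norm.pow 2))
      (ae_of_all _ fun x => sq_nonneg _)]
    refine ENNReal.ofReal_le_ofReal ?_
    have h := integral_norm_sq_expPrimeSum_mul_le J S T m (s := s + u) (by rw [hre]; exact hu)
    rwa [hre, show s.re + u - 1 / 2 = s.re - 1 / 2 + u by ring] at h

/-- Below `τ` the first term dominates, above it the second. This replaces the real exponent `kp` by
the even integers `0` and `2m`, where coefficient estimates are available. -/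
theorem rpow_le_rpow_add_mul_pow {y τ a : ℝ} (hy : 0 ≤ y) (hτ : 0 < τ) {m : ℕ} (ha : 0 ≤ a)
    (ham : a ≤ (2 * m : ℕ)) : y ^ a ≤ τ ^ a + τ ^ (a - (2 * m : ℕ)) * (y ^ m) ^ 2 := by
  have h1 : 0 ≤ τ ^ (a - (2 * m : ℕ)) * (y ^ m) ^ 2 := by positivity
  rcases le_or_gt y τ with h | h
  · have := Real.rpow_le_rpow hy h ha
    linarith
  · have hy0 : 0 < y := hτ.trans h
    have h2 : y ^ a ≤ τ ^ (a - (2 * m : ℕ)) * (y ^ m) ^ 2 := by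
      rw [← pow_mul, mul_comm m 2, ← Real.rpow_natCast y]
      calc y ^ a = y ^ (a - (2 * m : ℕ)) * y ^ ((2 * m : ℕ) : ℝ) := by
            rw [← Real.rpow_add hy0, sub_add_cancel]
        _ ≤ _ := by
            gcongr ?_ * _
            exact Real.rpow_le_rpow_of_nonpos hτ h.le (by linarith)
    have h3 : 0 < τ ^ a := Real.rpow_pos_of_pos hτ _
    linarith

theorem norm_exp_mul_pow_rpow {p : ℝ} (hp : 0 < p) (L X : ℂ) (k : ℕ) :
    ‖Complex.exp (((2 / p : ℝ) : ℂ) * L) * X ^ k‖ ^ p = ‖Complex.exp L‖ ^ 2 * ‖X‖ ^ (k * p) := by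
  rw [norm_mul, Real.mul_rpow (norm_nonneg _) (norm_nonneg _), norm_pow,
    ← Real.rpow_natCast ‖X‖ k, ← Real.rpow_mul (norm_nonneg _), Complex.norm_exp,
    Complex.norm_exp, Complex.re_ofReal_mul, ← Real.exp_mul, ← Real.exp_nat_mul]
  congr 2
  push_cast
  field_simp

/-- The threshold `τ` is the expected size of `ζ'/ζ`, so both terms of the interpolation have the
same order `τ^(kp + 1)`. -/
theorem lintegral_test_le {p : ℝ} (hp : 0 < p) (s : ℂ) (S : Finset Nat.Primes)
    (T : Finset ℕ+) {k m : ℕ} (hkm : k * p ≤ (2 * m : ℕ)) {u : ℝ} (hu : 1 / 2 < s.re + u) :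
    ∫⁻ x, ‖Complex.exp (((2 / p : ℝ) : ℂ) * primeLift s S (u, x)) *
      mangoldtLift s T (u, x) ^ k‖ₑ ^ p ∂polytorusMeasure ≤
      ENNReal.ofReal ((1 + (2 * m).factorial) * (1 + 1 / (s.re - 1 / 2 + u)) ^ (k * p + 1)) := by
  set τ := 1 + 1 / (s.re - 1 / 2 + u) with hτ
  have hτ0 : 0 < τ := by
    have : 0 < s.re - 1 / 2 + u := by linarith
    positivity
  have hpt : ∀ x, ‖Complex.exp (((2 / p : ℝ) : ℂ) * primeLift s S (u, x)) *
      mangoldtLift s T (u, x) ^ k‖ₑ ^ p ≤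
      ENNReal.ofReal (τ ^ (k * p)) * ENNReal.ofReal (‖Complex.exp (primeLift s S (u, x)) *
        mangoldtLift s T (u, x) ^ 0‖ ^ 2) +
      ENNReal.ofReal (τ ^ (k * p - (2 * m : ℕ))) * ENNReal.ofReal
        (‖Complex.exp (primeLift s S (u, x)) * mangoldtLift s T (u, x) ^ m‖ ^ 2) := by
    intro x
    rw [← ofReal_norm, ENNReal.ofReal_rpow_of_nonneg (norm_nonneg _) hp.le,
      norm_exp_mul_pow_rpow hp, ← ENNReal.ofReal_mul (by positivity),
      ← ENNReal.ofReal_mul (by positivity), ← ENNReal.ofReal_add (by positivity) (by positivity)]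
    refine ENNReal.ofReal_le_ofReal ?_
    have h := rpow_le_rpow_add_mul_pow (norm_nonneg (mangoldtLift s T (u, x))) hτ0
      (by positivity) hkm
    calc _ ≤ ‖Complex.exp (primeLift s S (u, x))‖ ^ 2 * (τ ^ (k * p) +
          τ ^ (k * p - (2 * m : ℕ)) * (‖mangoldtLift s T (u, x)‖ ^ m) ^ 2) := by gcongr
      _ = _ := by
          rw [norm_mul, norm_mul, norm_pow, norm_pow]
          ring
  refine (lintegral_mono hpt).trans ?_
  have hmeas : Measurable fun x => ENNReal.ofReal (τ ^ (k * p)) *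
      ENNReal.ofReal (‖Complex.exp (primeLift s S (u, x)) * mangoldtLift s T (u, x) ^ 0‖ ^ 2) := by
    have h1 := (continuous_primeLift s S).comp (Continuous.prodMk_right u)
    have h2 := (continuous_mangoldtLift s T).comp (Continuous.prodMk_right u)
    exact (((Complex.continuous_exp.comp h1).mul (h2.pow 0)).norm.pow
      2).measurable.ennreal_ofReal.const_mul _
  rw [lintegral_add_left hmeas, lintegral_const_mul' _ _ ENNReal.ofReal_ne_top,
    lintegral_const_mul' _ _ ENNReal.ofReal_ne_top]
  refine (add_le_add (mul_le_mul_right (lintegral_exp_primeLift_mul_le s S T 0 hu) _)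
    (mul_le_mul_right (lintegral_exp_primeLift_mul_le s S T m hu) _)).trans ?_
  rw [← hτ, ← ENNReal.ofReal_mul (by positivity), ← ENNReal.ofReal_mul (by positivity),
    ← ENNReal.ofReal_add (by positivity) (by positivity)]
  refine ENNReal.ofReal_le_ofReal (le_of_eq ?_)
  have h1 : τ ^ (k * p + 1) = τ ^ (k * p) * τ := by rw [Real.rpow_add hτ0, Real.rpow_one]
  have h2 : τ ^ (k * p - (2 * m : ℕ)) * τ ^ (2 * m + 1) = τ ^ (k * p) * τ := by
    rw [pow_succ, ← Real.rpow_natCast τ (2 * m), ← mul_assoc, ← Real.rpow_add hτ0, sub_add_cancel]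
  calc _ = τ ^ (k * p) * τ + (2 * m).factorial *
        (τ ^ (k * p - (2 * m : ℕ)) * τ ^ (2 * m + 1)) := by
        simp only [mul_zero, Nat.factorial_zero, Nat.cast_one, zero_add, pow_one, one_mul]
        ring
    _ = _ := by rw [h1, h2]; ring

/-! ### Integration against the weight -/

/-- Split at `u = d`: bound `1/(d + u)` by `1/d` below and by `1/u` above. The tail converges
because `α - M < -1`. -/
theorem exists_lintegral_bergmanMeasure_le (α : ℝ) [hα : Fact (-1 < α)] {M : ℝ} (hM : α + 1 < M) :
    ∃ C : ℝ, 0 < C ∧ ∀ d : ℝ, 0 < d →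
      ∫⁻ u, ENNReal.ofReal ((1 / (d + u)) ^ M) ∂(bergmanMeasure α) ≤
        ENNReal.ofReal (C * d ^ (α + 1 - M)) := by
  have hα' := hα.out
  have hM0 : 0 < M := by linarith
  have hΓ : 0 < Real.Gamma (α + 1) := Real.Gamma_pos_of_pos (by linarith)
  set D : ℝ := 2 ^ (α + 1) / Real.Gamma (α + 1) with hD
  have hD0 : 0 < D := by positivity
  refine ⟨D / (α + 1) + D / (M - α - 1), add_pos (div_pos hD0 (by linarith))
    (div_pos hD0 (by linarith)), fun d hd => ?_⟩
  have hmeas : Measurable fun u : ℝ => ENNReal.ofReal ((1 / (d + u)) ^ M) := by fun_prop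
  rw [bergmanMeasure, lintegral_withDensity_eq_lintegral_mul _ (by fun_prop) hmeas]
  have hpt : ∀ u : ℝ, 0 < u → ENNReal.ofReal (D * u ^ α * Real.exp (-(2 * u))) *
      ENNReal.ofReal ((1 / (d + u)) ^ M) ≤ ENNReal.ofReal (D * u ^ α * (1 / (d + u)) ^ M) := by
    intro u hu
    rw [← ENNReal.ofReal_mul (by positivity)]
    refine ENNReal.ofReal_le_ofReal ?_
    have h1 : Real.exp (-(2 * u)) ≤ 1 := Real.exp_le_one_iff.2 (by linarith)
    gcongr ?_ * _
    exact mul_le_of_le_one_right (by positivity) h1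
  have hsplit : Ioi (0 : ℝ) = Ioc 0 d ∪ Ioi d := (Ioc_union_Ioi_eq_Ioi hd.le).symm
  have hnear : ∫⁻ u in Ioc 0 d, ENNReal.ofReal (D * u ^ α * (1 / (d + u)) ^ M) ≤
      ENNReal.ofReal (D / (α + 1) * d ^ (α + 1 - M)) := by
    have hint : IntegrableOn (fun u : ℝ => D * d ^ (-M) * u ^ α) (Ioc 0 d) :=
      ((intervalIntegrable_iff_integrableOn_Ioc_of_le hd.le).1
        (intervalIntegral.intervalIntegrable_rpow' hα')).const_mul _
    have hval : ∫ u in Ioc 0 d, D * d ^ (-M) * u ^ α = D / (α + 1) * d ^ (α + 1 - M) := by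
      rw [integral_const_mul, ← intervalIntegral.integral_of_le hd.le, integral_rpow (Or.inl hα'),
        Real.zero_rpow (by linarith), sub_eq_add_neg (α + 1) M, Real.rpow_add hd (α + 1)]
      ring
    rw [← hval, ofReal_integral_eq_lintegral_ofReal hint]
    · refine setLIntegral_mono' measurableSet_Ioc fun u hu => ENNReal.ofReal_le_ofReal ?_
      have hu0 := hu.1
      have h1 : (1 / (d + u)) ^ M ≤ d ^ (-M) := by
        rw [Real.rpow_neg hd.le, ← Real.inv_rpow hd.le, ← one_div]
        gcongr
        linarith
      calc D * u ^ α * (1 / (d + u)) ^ M ≤ D * u ^ α * d ^ (-M) := by gcongr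
        _ = _ := by ring
    · exact (ae_restrict_mem measurableSet_Ioc).mono fun u hu => by
        have hu0 := hu.1
        positivity
  have hfar : ∫⁻ u in Ioi d, ENNReal.ofReal (D * u ^ α * (1 / (d + u)) ^ M) ≤
      ENNReal.ofReal (D / (M - α - 1) * d ^ (α + 1 - M)) := by
    have hlt : α - M < -1 := by linarith
    have hint : IntegrableOn (fun u : ℝ => D * u ^ (α - M)) (Ioi d) :=
      (integrableOn_Ioi_rpow_of_lt hlt hd).const_mul _
    have hval : ∫ u in Ioi d, D * u ^ (α - M) = D / (M - α - 1) * d ^ (α + 1 - M) := by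
      rw [integral_const_mul, integral_Ioi_rpow_of_lt hlt hd,
        show α - M + 1 = -(M - α - 1) by ring, neg_div_neg_eq,
        show α + 1 - M = -(M - α - 1) by ring]
      ring
    rw [← hval, ofReal_integral_eq_lintegral_ofReal hint]
    · refine setLIntegral_mono' measurableSet_Ioi fun u hu => ENNReal.ofReal_le_ofReal ?_
      have hu0 : 0 < u := hd.trans hu
      have h1 : (1 / (d + u)) ^ M ≤ u ^ (-M) := by
        rw [Real.rpow_neg hu0.le, ← Real.inv_rpow hu0.le, ← one_div]
        gcongr
        linarith
      calc D * u ^ α * (1 / (d + u)) ^ M ≤ D * u ^ α * u ^ (-M) := by gcongr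
        _ = _ := by rw [mul_assoc, ← Real.rpow_add hu0, sub_eq_add_neg]
    · exact (ae_restrict_mem measurableSet_Ioi).mono fun u hu => by
        have hu0 : 0 < u := hd.trans hu
        positivity
  refine (setLIntegral_mono' measurableSet_Ioi hpt).trans ?_
  rw [hsplit]
  refine (lintegral_union_le _ _ _).trans ((add_le_add hnear hfar).trans_eq ?_)
  rw [← ENNReal.ofReal_add, ← add_mul]
  · exact mul_nonneg (div_nonneg hD0.le (by linarith)) (by positivity)
  · exact mul_nonneg (div_nonneg hD0.le (by linarith)) (by positivity)

theorem one_add_rpow_le {y M : ℝ} (hy : 0 ≤ y) (hM : 0 ≤ M) :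
    (1 + y) ^ M ≤ 2 ^ M * (1 + y ^ M) := by
  have h1 : (1 + y) ^ M ≤ (2 * max 1 y) ^ M := by
    gcongr
    linarith [le_max_left 1 y, le_max_right 1 y]
  refine h1.trans ?_
  rw [Real.mul_rpow (by norm_num) (by positivity)]
  gcongr
  have h2 : 0 ≤ y ^ M := by positivity
  rcases max_choice 1 y with h | h <;> rw [h]
  · rw [Real.one_rpow]; linarith
  · linarith

theorem exists_lintegral_test_le {p : ℝ} (hp : 0 < p) (α : ℝ) [hα : Fact (-1 < α)] {k : ℕ}
    (hk : α < k * p) : ∃ C : ℝ, 0 < C ∧ ∀ (s : ℂ) (S : Finset Nat.Primes) (T : Finset ℕ+),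
      1 / 2 < s.re → s.re ≤ 3 / 2 →
      ∫⁻ z, ‖Complex.exp (((2 / p : ℝ) : ℂ) * primeLift s S z) *
        mangoldtLift s T z ^ k‖ₑ ^ p ∂(bergmanProd α) ≤
        ENNReal.ofReal (C * (s.re - 1 / 2) ^ (α - k * p)) := by
  obtain ⟨m, hm⟩ := exists_nat_ge ((k : ℝ) * p)
  have hkm : (k : ℝ) * p ≤ (2 * m : ℕ) := by
    push_cast
    have : (0 : ℝ) ≤ m := by positivity
    linarith
  obtain ⟨C, hC, h⟩ := exists_lintegral_bergmanMeasure_le α (M := k * p + 1) (by linarith)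
  set M := (k : ℝ) * p + 1 with hM
  have hM0 : 0 ≤ M := by positivity
  set F : ℝ := (1 + (2 * m).factorial) * 2 ^ M with hF
  have hF0 : 0 < F := by positivity
  refine ⟨F * (1 + C), by positivity, fun s S T hs hs' => ?_⟩
  have hd : 0 < s.re - 1 / 2 := by linarith
  have hcont : Continuous fun z => Complex.exp (((2 / p : ℝ) : ℂ) * primeLift s S z) *
      mangoldtLift s T z ^ k :=
    (Complex.continuous_exp.comp (continuous_const.mul (continuous_primeLift s S))).mul
      ((continuous_mangoldtLift s T).pow k)
  rw [lintegral_prod _ (hcont.measurable.enorm.pow_const p).aemeasurable]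
  have hae : ∀ᵐ u ∂(bergmanMeasure α), ∫⁻ x, ‖Complex.exp (((2 / p : ℝ) : ℂ) *
      primeLift s S (u, x)) * mangoldtLift s T (u, x) ^ k‖ₑ ^ p ∂polytorusMeasure ≤
      ENNReal.ofReal F + ENNReal.ofReal F *
        ENNReal.ofReal ((1 / (s.re - 1 / 2 + u)) ^ M) := by
    filter_upwards [ae_bergmanMeasure α] with u hu
    refine (lintegral_test_le hp s S T hkm (by linarith)).trans ?_
    have hy : 0 ≤ 1 / (s.re - 1 / 2 + u) := by positivity
    rw [← ENNReal.ofReal_mul hF0.le, ← ENNReal.ofReal_add hF0.le (by positivity)]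
    refine ENNReal.ofReal_le_ofReal ?_
    calc _ ≤ (1 + (2 * m).factorial) * (2 ^ M * (1 + (1 / (s.re - 1 / 2 + u)) ^ M)) := by
          gcongr
          exact one_add_rpow_le hy hM0
      _ = _ := by rw [hF]; ring
  refine (lintegral_mono_ae hae).trans ?_
  rw [lintegral_add_left measurable_const, lintegral_const, measure_univ, mul_one,
    lintegral_const_mul' _ _ ENNReal.ofReal_ne_top]
  refine (add_le_add le_rfl (mul_le_mul_right (h _ hd) _)).trans ?_
  rw [← ENNReal.ofReal_mul hF0.le, ← ENNReal.ofReal_add hF0.le (by positivity)]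
  refine ENNReal.ofReal_le_ofReal ?_
  -- With `Re s ≤ 3/2` the base is at most `1` and the exponent is negative, so the constant term is
  -- absorbed.
  have h1 : 1 ≤ (s.re - 1 / 2) ^ (α - k * p) :=
    Real.one_le_rpow_of_pos_of_le_one_of_nonpos hd (by linarith) (by linarith)
  have h2 : α + 1 - M = α - k * p := by rw [hM]; ring
  rw [h2]
  calc F + F * (C * (s.re - 1 / 2) ^ (α - k * p))
      ≤ F * (s.re - 1 / 2) ^ (α - k * p) + F * (C * (s.re - 1 / 2) ^ (α - k * p)) := by
        gcongr
        exact le_mul_of_one_le_right hF0.le h1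
    _ = _ := by ring

/-! ### Lower bounds for sums over primes -/

theorem one_le_one_sub_mul_exp {y : ℝ} (hy : y ≤ 1 / 2) :
    1 ≤ (1 - y) * Real.exp (y + 2 * y ^ 2) := by
  have h1 := Real.add_one_le_exp (y + 2 * y ^ 2)
  have h2 : 1 ≤ (1 - y) * (y + 2 * y ^ 2 + 1) := by nlinarith [sq_nonneg y]
  exact h2.trans (mul_le_mul_of_nonneg_left h1 (by linarith))

/-- Comparing each Euler factor with `exp (q^(-x))` leaves the quadratic errors `2 q^(-2x)`, whose
sum is at most `2 ∑ n^(-2) ≤ 4`. -/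
theorem prod_primes_le_exp {x : ℝ} (hx : 1 < x) (S : Finset Nat.Primes) :
    ∏ q ∈ S, (1 - ((q : ℕ) : ℝ) ^ (-x))⁻¹ ≤
      Real.exp 4 * Real.exp (∑ q ∈ S, ((q : ℕ) : ℝ) ^ (-x)) := by
  have h2 : ∀ q : Nat.Primes, (2 : ℝ) ≤ (q : ℕ) := fun q => by exact_mod_cast q.2.two_le
  have hy0 : ∀ q : Nat.Primes, 0 ≤ ((q : ℕ) : ℝ) ^ (-x) := fun q => by positivity
  have hy1 : ∀ q : Nat.Primes, ((q : ℕ) : ℝ) ^ (-x) ≤ ((q : ℕ) : ℝ)⁻¹ := fun q => by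
    rw [← Real.rpow_neg_one]
    exact Real.rpow_le_rpow_of_exponent_le (by linarith [h2 q]) (by linarith)
  have hy : ∀ q : Nat.Primes, ((q : ℕ) : ℝ) ^ (-x) ≤ 1 / 2 := fun q =>
    (hy1 q).trans (by rw [← one_div]; exact one_div_le_one_div_of_le two_pos (h2 q))
  have hsq : ∑ q ∈ S, 2 * (((q : ℕ) : ℝ) ^ (-x)) ^ 2 ≤ 4 := by
    have hinj : Function.Injective fun q : Nat.Primes => (q : ℕ+) := fun a b hab => by
      apply Subtype.ext
      exact congrArg (fun n : ℕ+ => (n : ℕ)) hab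
    calc ∑ q ∈ S, 2 * (((q : ℕ) : ℝ) ^ (-x)) ^ 2
        ≤ ∑ q ∈ S, 2 * (((q : ℕ+) : ℕ) : ℝ) ^ (-2 : ℝ) := by
          refine Finset.sum_le_sum fun q _ => ?_
          have h3 : (((q : ℕ+) : ℕ) : ℝ) ^ (-2 : ℝ) = (((q : ℕ) : ℝ)⁻¹) ^ 2 := by
            rw [Real.rpow_neg (by positivity), Real.rpow_two, inv_pow]
            rfl
          rw [h3]
          have := hy0 q
          gcongr
          exact hy1 q
      _ = 2 * ∑ n ∈ S.map ⟨fun q : Nat.Primes => (q : ℕ+), hinj⟩, ((n : ℕ) : ℝ) ^ (-2 : ℝ) := by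
          rw [Finset.sum_map, Finset.mul_sum]
          rfl
      _ ≤ 2 * ∑' n : ℕ+, ((n : ℕ) : ℝ) ^ (-2 : ℝ) := by
          gcongr
          exact (summable_pnat_rpow one_lt_two).sum_le_tsum _ fun n _ => by positivity
      _ ≤ 2 * (1 + 1 / (2 - 1)) := by
          gcongr
          exact tsum_pnat_rpow_le one_lt_two
      _ = 4 := by norm_num
  calc ∏ q ∈ S, (1 - ((q : ℕ) : ℝ) ^ (-x))⁻¹
      ≤ ∏ q ∈ S, Real.exp (((q : ℕ) : ℝ) ^ (-x) + 2 * (((q : ℕ) : ℝ) ^ (-x)) ^ 2) := by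
        refine Finset.prod_le_prod (fun q _ => inv_nonneg.2 (by linarith [hy q])) fun q _ => ?_
        rw [inv_le_iff_one_le_mul₀ (by linarith [hy q]), mul_comm]
        exact one_le_one_sub_mul_exp (hy q)
    _ = Real.exp (∑ q ∈ S, 2 * (((q : ℕ) : ℝ) ^ (-x)) ^ 2) *
        Real.exp (∑ q ∈ S, ((q : ℕ) : ℝ) ^ (-x)) := by
        rw [← Real.exp_sum, Finset.sum_add_distrib, Real.exp_add, mul_comm]
    _ ≤ _ := by gcongr

theorem exists_prod_primes_ge {x : ℝ} (hx : 1 < x) :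
    ∃ S : Finset Nat.Primes, (∑' n : ℕ, 1 / (n : ℝ) ^ x) / 2 ≤
      ∏ q ∈ S, (1 - ((q : ℕ) : ℝ) ^ (-x))⁻¹ := by
  let f : ℕ →*₀ ℝ :=
    { toFun := fun n => (n : ℝ) ^ (-x)
      map_zero' := by simp only [Nat.cast_zero]; exact Real.zero_rpow (by linarith)
      map_one' := by simp
      map_mul' := fun m n => by
        push_cast
        exact Real.mul_rpow (by positivity) (by positivity) }
  have hsum : Summable fun n => f n := (Real.summable_nat_rpow (p := -x)).2 (by linarith)
  have hf : ∀ n : ℕ, f n = 1 / (n : ℝ) ^ x := fun n => by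
    change (n : ℝ) ^ (-x) = _
    rw [Real.rpow_neg (by positivity), one_div]
  have h := EulerProduct.eulerProduct_completely_multiplicative_hasProd hsum.norm
  have hpos : 0 < ∑' n, f n := by
    refine hsum.tsum_pos (fun n => ?_) 1 ?_
    · exact Real.rpow_nonneg (by positivity) _
    · rw [map_one]; exact one_pos
  have h2 := (h.eventually_const_le (half_lt_self hpos)).exists
  simp only [hf] at h2
  obtain ⟨S, hS⟩ := h2
  refine ⟨S, hS.trans_eq (Finset.prod_congr rfl fun q _ => ?_)⟩
  rw [Real.rpow_neg (by positivity), one_div]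

/-- A finite Euler product reaches half of `ζ(x)`, and `(x - 1) ζ(x) → 1` as `x → 1`. The set of
primes may depend on `x`, which is harmless as all upper bounds are uniform in it. -/
theorem exists_exp_sum_primes_ge : ∃ c b : ℝ, 0 < c ∧ 1 < b ∧ ∀ x : ℝ, 1 < x → x < b →
    ∃ S : Finset Nat.Primes, c / (x - 1) ≤ Real.exp (∑ q ∈ S, ((q : ℕ) : ℝ) ^ (-x)) := by
  have h := tendsto_sub_mul_tsum_nat_rpow.eventually_const_le (show (1 / 2 : ℝ) < 1 by norm_num)
  obtain ⟨b, hb, hbx⟩ := mem_nhdsGT_iff_exists_Ioo_subset.1 h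
  refine ⟨1 / (4 * Real.exp 4), b, by positivity, hb, fun x hx hxb => ?_⟩
  obtain ⟨S, hS⟩ := exists_prod_primes_ge hx
  have h1 : 1 / 2 ≤ (x - 1) * ∑' n : ℕ, 1 / (n : ℝ) ^ x := hbx ⟨hx, hxb⟩
  refine ⟨S, ?_⟩
  have h2 := hS.trans (prod_primes_le_exp hx S)
  have hx1 : 0 < x - 1 := by linarith
  rw [div_le_iff₀ hx1, div_le_iff₀ (by positivity)]
  nlinarith [mul_le_mul_of_nonneg_left h2 hx1.le]

theorem exists_sum_vonMangoldt_ge : ∃ b : ℝ, 1 < b ∧ ∀ x : ℝ, 1 < x → x < b →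
    ∃ T : Finset ℕ+, 1 / 4 / (x - 1) ≤
      ∑ n ∈ T, ArithmeticFunction.vonMangoldt (n : ℕ) * ((n : ℕ) : ℝ) ^ (-x) := by
  obtain ⟨C, hC⟩ := ArithmeticFunction.vonMangoldt.LSeries_residueClass_lower_bound
    (q := 1) (a := 1) isUnit_one
  refine ⟨1 + min 1 (1 / (2 * (|C| + 1))), by
    linarith [lt_min one_pos (show (0 : ℝ) < 1 / (2 * (|C| + 1)) by positivity)],
    fun x hx hxb => ?_⟩
  have hx1 : 0 < x - 1 := by linarith
  have hx2 : x - 1 ≤ 1 := by linarith [min_le_left 1 (1 / (2 * (|C| + 1)))]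
  have hx3 : |C| ≤ 1 / 2 / (x - 1) := by
    have h1 : x - 1 ≤ 1 / (2 * (|C| + 1)) := by linarith [min_le_right 1 (1 / (2 * (|C| + 1)))]
    rw [le_div_iff₀ (by positivity)] at h1
    rw [le_div_iff₀ hx1]
    linarith
  -- Modulo `1` there is a single residue class, so this is `∑ Λ(n) n^(-x) ≥ 1/(x - 1) - C`. Half of
  -- the main term absorbs `C`, and a further half is given up to make the sum finite.
  have h1 := hC (x := x) ⟨hx, by linarith⟩
  set F : ℕ → ℝ := fun n => ArithmeticFunction.vonMangoldt.residueClass (1 : ZMod 1) n /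
    (n : ℝ) ^ x with hF
  have hF0 : ∀ n, 0 ≤ F n := fun n =>
    div_nonneg (ArithmeticFunction.vonMangoldt.residueClass_nonneg _ n) (by positivity)
  have h2 : 1 / 2 / (x - 1) ≤ ∑' n, F n := by
    have h3 : ((Nat.totient 1 : ℕ) : ℝ)⁻¹ / (x - 1) = 1 / 2 / (x - 1) + 1 / 2 / (x - 1) := by
      rw [Nat.totient_one]
      ring
    rw [h3] at h1
    linarith [le_abs_self C]
  have hpos : 0 < 1 / 2 / (x - 1) := by positivity
  have hsum : Summable F := by
    by_contra h
    rw [tsum_eq_zero_of_not_summable h] at h2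
    linarith
  have h4 := (hsum.hasSum.eventually_const_le
    (show 1 / 4 / (x - 1) < ∑' n, F n by
      refine lt_of_lt_of_le ?_ h2
      gcongr
      norm_num)).exists
  obtain ⟨T, hT⟩ := h4
  classical
  refine ⟨(T.filter (0 < ·)).subtype (0 < ·), hT.trans ?_⟩
  have h5 : ∑ n ∈ T, F n ≤ ∑ n ∈ T.filter (0 < ·),
      ArithmeticFunction.vonMangoldt n * (n : ℝ) ^ (-x) := by
    rw [Finset.sum_filter]
    refine Finset.sum_le_sum fun n _ => ?_
    split_ifs with hn
    · rw [hF, Real.rpow_neg (by positivity), ← div_eq_mul_inv]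
      simp only
      gcongr
      exact ArithmeticFunction.vonMangoldt.residueClass_le _ n
    · rw [hF]
      simp [show n = 0 by omega]
  refine h5.trans (le_of_eq ?_)
  exact (Finset.sum_subtype_of_mem
    (fun n : ℕ => ArithmeticFunction.vonMangoldt n * (n : ℝ) ^ (-x))
    fun n hn => (Finset.mem_filter.1 hn).2).symm

/-! ### The lower bound for the point evaluations -/

theorem ofPolynomial_mem_bergmanSpaceInfty (p : ℝ≥0∞) [Fact (1 ≤ p)] (α : ℝ) [Fact (-1 < α)]
    {P : DirichletPolynomial} (hP : P 1 = 0) : ofPolynomial p α P ∈ bergmanSpaceInfty p α :=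
  ⟨ofPolynomial_mem_bergmanSpace p α P, by
    rw [SetLike.mem_coe, LinearMap.mem_ker, dirichletCoeff_ofPolynomial, hP]⟩

theorem dirichletHom_ofReal (x : ℝ) (n : ℕ+) :
    dirichletHom (x : ℂ) n = ((((n : ℕ) : ℝ) ^ (-x) : ℝ) : ℂ) := by
  rw [dirichletHom_apply, Complex.ofReal_cpow (by positivity)]
  push_cast
  rfl

theorem IsPointEvaluation.norm_polyEval_le {p : ℝ≥0∞} [Fact (1 ≤ p)] {α : ℝ} [Fact (-1 < α)]
    {X : Submodule ℂ (Lp ℂ p (bergmanProd α))} {s : ℂ} {δ : X →L[ℂ] ℂ}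
    (h : IsPointEvaluation X s δ) {P : DirichletPolynomial} (hP : ofPolynomial p α P ∈ X) :
    ‖polyEval s P‖ ≤ ‖δ‖ * ‖ofPolynomial p α P‖ := by
  rw [← h.apply_ofPolynomial hP]
  exact δ.le_opNorm ⟨ofPolynomial p α P, hP⟩

theorem tendsto_polyEval_testPolynomial (β s : ℂ) (S : Finset Nat.Primes) (T : Finset ℕ+)
    (k : ℕ) :
    Filter.Tendsto (fun J => polyEval s (testPolynomial β (starRingEnd ℂ s) S T k J)) Filter.atTop
      (nhds (Complex.exp (β * ((∑ q ∈ S, ((q : ℕ) : ℝ) ^ (-(2 * s.re)) : ℝ) : ℂ)) *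
        ((∑ n ∈ T, ArithmeticFunction.vonMangoldt (n : ℕ) * ((n : ℕ) : ℝ) ^ (-(2 * s.re)) : ℝ)
          : ℂ) ^ k)) := by
  -- The twist by `conj s` makes every term positive at `s`, whatever the imaginary part.
  have h : starRingEnd ℂ s + s = ((2 * s.re : ℝ) : ℂ) := by
    rw [add_comm, Complex.add_conj]
  simp only [polyEval_testPolynomial, h, dirichletHom_ofReal]
  push_cast
  exact (tendsto_sum_pow_div_factorial _).mul_const _

theorem IsPointEvaluation.test_le {p : ℝ≥0∞} [Fact (1 ≤ p)] (hp : p ≠ ∞) {α : ℝ}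
    [Fact (-1 < α)] {s : ℂ} (hs : 0 ≤ s.re) {δ : bergmanSpaceInfty p α →L[ℂ] ℂ}
    (h : IsPointEvaluation (bergmanSpaceInfty p α) s δ) (S : Finset Nat.Primes) (T : Finset ℕ+)
    {k : ℕ} (hk : k ≠ 0) {B : ℝ}
    (hB : ∫⁻ z, ‖Complex.exp (((2 / p.toReal : ℝ) : ℂ) * primeLift (starRingEnd ℂ s) S z) *
        mangoldtLift (starRingEnd ℂ s) T z ^ k‖ₑ ^ p.toReal ∂(bergmanProd α) ≤
        ENNReal.ofReal B) (hB0 : 0 ≤ B) :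
    Real.exp (∑ q ∈ S, ((q : ℕ) : ℝ) ^ (-(2 * s.re))) ^ 2 *
      (∑ n ∈ T, ArithmeticFunction.vonMangoldt (n : ℕ) * ((n : ℕ) : ℝ) ^ (-(2 * s.re))) ^
        (k * p.toReal) ≤ ‖δ‖ ^ p.toReal * B := by
  have hpr : 0 < p.toReal := by linarith [one_le_toReal hp]
  set β : ℂ := ((2 / p.toReal : ℝ) : ℂ)
  set L : ℝ := ∑ q ∈ S, ((q : ℕ) : ℝ) ^ (-(2 * s.re))
  set Y : ℝ := ∑ n ∈ T, ArithmeticFunction.vonMangoldt (n : ℕ) * ((n : ℕ) : ℝ) ^ (-(2 * s.re))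
  have hY : 0 ≤ Y := Finset.sum_nonneg fun n _ =>
    mul_nonneg ArithmeticFunction.vonMangoldt_nonneg (by positivity)
  have h1 : ∀ J, ‖polyEval s (testPolynomial β (starRingEnd ℂ s) S T k J)‖ₑ ^ p.toReal ≤
      ENNReal.ofReal (‖δ‖ ^ p.toReal) *
        ‖ofPolynomial p α (testPolynomial β (starRingEnd ℂ s) S T k J)‖ₑ ^ p.toReal := by
    intro J
    rw [← ENNReal.ofReal_rpow_of_nonneg δ.opNorm_nonneg hpr.le,
      ← ENNReal.mul_rpow_of_nonneg _ _ hpr.le]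
    refine ENNReal.rpow_le_rpow ?_ hpr.le
    rw [← ofReal_norm, ← ofReal_norm, ← ENNReal.ofReal_mul δ.opNorm_nonneg]
    exact ENNReal.ofReal_le_ofReal (h.norm_polyEval_le
      (ofPolynomial_mem_bergmanSpaceInfty p α (testPolynomial_one β _ S T hk J)))
  have h2 := le_of_tendsto_of_tendsto'
    ((tendsto_polyEval_testPolynomial β s S T k).enorm.ennrpow_const p.toReal)
    (ENNReal.Tendsto.const_mul (tendsto_enorm_testPolynomial hp α β
      (s := starRingEnd ℂ s) (by rwa [Complex.conj_re]) S T k) (Or.inr ENNReal.ofReal_ne_top)) h1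
  have h3 := h2.trans (mul_le_mul_right hB _)
  have hδ : 0 ≤ ‖δ‖ ^ p.toReal := Real.rpow_nonneg δ.opNorm_nonneg _
  rw [← ofReal_norm, ENNReal.ofReal_rpow_of_nonneg (norm_nonneg _) hpr.le,
    norm_exp_mul_pow_rpow hpr, ← ENNReal.ofReal_mul hδ,
    ENNReal.ofReal_le_ofReal_iff (mul_nonneg hδ hB0)] at h3
  rwa [Complex.norm_exp, Complex.ofReal_re, Complex.norm_real, Real.norm_of_nonneg hY] at h3

theorem exists_le_norm_pointEvaluation_near (p : ℝ≥0∞) [Fact (1 ≤ p)] (hp : p ≠ ∞) (α : ℝ)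
    [hα : Fact (-1 < α)] : ∃ c b : ℝ, 0 < c ∧ 1 / 2 < b ∧
      ∀ (s : ℂ) (δ : bergmanSpaceInfty p α →L[ℂ] ℂ), 1 / 2 < s.re → s.re < b →
      IsPointEvaluation (bergmanSpaceInfty p α) s δ →
      c * (1 / (s.re - 1 / 2) ^ ((α + 2) / p.toReal)) ≤ ‖δ‖ := by
  have hα' := hα.out
  have hp1 := one_le_toReal hp
  have hpr : 0 < p.toReal := by linarith
  -- `k > 0` kills the first coefficient; `k > α` with `p ≥ 1` gives `kp > α`, as the weighted
  -- integral requires.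
  obtain ⟨k, hk⟩ := exists_nat_gt (max 0 α)
  have hk0 : k ≠ 0 := by
    rintro rfl
    exact absurd hk (by simp)
  have hkp : α < k * p.toReal := by
    have h1 : α < k := (le_max_right _ _).trans_lt hk
    have h2 : (k : ℝ) * 1 ≤ k * p.toReal := by gcongr
    linarith
  obtain ⟨C, hC, hint⟩ := exists_lintegral_test_le hpr α hkp
  obtain ⟨c₁, b₁, hc₁, hb₁, hS⟩ := exists_exp_sum_primes_ge
  obtain ⟨b₂, hb₂, hT⟩ := exists_sum_vonMangoldt_ge
  set r := (k : ℝ) * p.toReal with hr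
  have hr0 : 0 ≤ r := by positivity
  set E : ℝ := (c₁ / 2) ^ 2 * (1 / 8) ^ r / C with hE
  have hE0 : 0 < E := by positivity
  refine ⟨E ^ (1 / p.toReal), min (3 / 2) (min (b₁ / 2) (b₂ / 2)), by positivity,
    lt_min (by norm_num) (lt_min (by linarith) (by linarith)), fun s δ hs hsb hδ => ?_⟩
  rw [lt_min_iff, lt_min_iff] at hsb
  obtain ⟨S, hS⟩ := hS (2 * s.re) (by linarith) (by linarith [hsb.2.1])
  obtain ⟨T, hT⟩ := hT (2 * s.re) (by linarith) (by linarith [hsb.2.2])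
  set d := s.re - 1 / 2 with hd
  have hd0 : 0 < d := by linarith
  have h2d : 2 * s.re - 1 = 2 * d := by rw [hd]; ring
  rw [h2d] at hS hT
  have h1 := hδ.test_le hp (by linarith) S T hk0
    (hint (starRingEnd ℂ s) S T (by rwa [Complex.conj_re])
      (by rw [Complex.conj_re]; exact hsb.1.le))
    (by rw [Complex.conj_re]; positivity)
  rw [Complex.conj_re, ← hd] at h1
  have h2 : (c₁ / (2 * d)) ^ 2 * (1 / 4 / (2 * d)) ^ r ≤
      ‖δ‖ ^ p.toReal * (C * d ^ (α - r)) := le_trans (by gcongr) h1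
  have h3 : E * (1 / d) ^ (α + 2) ≤ ‖δ‖ ^ p.toReal := by
    have hq : 0 < C * d ^ (α - r) := by positivity
    rw [← div_le_iff₀ hq] at h2
    refine le_trans (le_of_eq ?_) h2
    rw [show 1 / 4 / (2 * d) = 1 / 8 * (1 / d) by field_simp; norm_num,
      Real.mul_rpow (by norm_num) (by positivity), Real.rpow_sub hd0, one_div d,
      Real.inv_rpow hd0.le, Real.inv_rpow hd0.le, Real.rpow_add hd0, Real.rpow_two, hE]
    have e1 : 0 < d ^ α := Real.rpow_pos_of_pos hd0 _
    have e2 : 0 < d ^ r := Real.rpow_pos_of_pos hd0 _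
    field_simp
  have h4 := Real.rpow_le_rpow (by positivity) h3 (show 0 ≤ 1 / p.toReal by positivity)
  rw [← Real.rpow_mul δ.opNorm_nonneg, mul_one_div_cancel hpr.ne', Real.rpow_one,
    Real.mul_rpow hE0.le (by positivity), ← Real.rpow_mul (by positivity), mul_one_div,
    Real.div_rpow zero_le_one hd0.le, Real.one_rpow] at h4
  exact h4

theorem norm_ofPolynomial_single_le (p : ℝ≥0∞) [Fact (1 ≤ p)] (hp : p ≠ ∞) (α : ℝ)
    [Fact (-1 < α)] (n : ℕ+) : ‖ofPolynomial p α (Finsupp.single n 1)‖ ≤ 1 := by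
  have hpr : 0 < p.toReal := by linarith [one_le_toReal hp]
  have h : ‖ofPolynomial p α (Finsupp.single n 1)‖ₑ ^ p.toReal ≤ 1 := by
    rw [enorm_ofPolynomial_rpow_eq_lintegral hp]
    have h2 : ∀ᵐ z ∂(bergmanProd α), ‖bergmanLift (Finsupp.single n 1) z‖ₑ ^ p.toReal ≤ 1 := by
      have h3 : ∀ᵐ z ∂(bergmanProd α), 0 < z.1 :=
        (Measure.quasiMeasurePreserving_fst (μ := bergmanMeasure α) (ν := polytorusMeasure)).ae
          (ae_bergmanMeasure α)
      filter_upwards [h3] with z hz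
      refine ENNReal.rpow_le_one ?_ hpr.le
      rw [bergmanLift_eq, Finsupp.sum_single_index (by simp), one_mul, ← ofReal_norm, norm_mul,
        norm_character, mul_one, Complex.norm_natCast_cpow_of_pos n.pos, Complex.neg_re,
        Complex.ofReal_re, ENNReal.ofReal_le_one]
      exact Real.rpow_le_one_of_one_le_of_nonpos (by exact_mod_cast n.pos) (by linarith)
    refine (lintegral_mono_ae h2).trans ?_
    rw [lintegral_const, measure_univ, mul_one]
  have h1 := not_lt.1 fun h1 => (ENNReal.one_lt_rpow h1 hpr).not_ge h
  rwa [← ofReal_norm, ENNReal.ofReal_le_one] at h1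

theorem polyEval_single (s : ℂ) (n : ℕ+) :
    polyEval s (Finsupp.single n 1) = (n : ℂ) ^ (-s) := by
  rw [polyEval, Finsupp.sum_single_index (by simp), one_mul]

/-- Evaluating `n^(-s)` gives a lower bound for the norm of the point evaluation. -/
theorem IsPointEvaluation.rpow_le_norm {p : ℝ≥0∞} [Fact (1 ≤ p)] (hp : p ≠ ∞) {α : ℝ}
    [Fact (-1 < α)] {X : Submodule ℂ (Lp ℂ p (bergmanProd α))} {s : ℂ} {δ : X →L[ℂ] ℂ}
    (h : IsPointEvaluation X s δ) {n : ℕ+}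
    (hn : ofPolynomial p α (Finsupp.single n 1) ∈ X) : ((n : ℕ) : ℝ) ^ (-s.re) ≤ ‖δ‖ := by
  have h1 := h.norm_polyEval_le hn
  rw [polyEval_single, Complex.norm_natCast_cpow_of_pos n.pos, Complex.neg_re] at h1
  exact h1.trans (mul_le_of_le_one_right δ.opNorm_nonneg (norm_ofPolynomial_single_le p hp α n))

theorem exists_le_norm_pointEvaluation (p : ℝ≥0∞) [Fact (1 ≤ p)] (hp : p ≠ ∞) (α : ℝ)
    [hα : Fact (-1 < α)] (a : ℝ) : ∃ c : ℝ, 0 < c ∧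
      ∀ (s : ℂ) (δ : bergmanSpaceInfty p α →L[ℂ] ℂ), 1 / 2 < s.re → s.re < a →
      IsPointEvaluation (bergmanSpaceInfty p α) s δ →
      c * (1 / (s.re - 1 / 2) ^ ((α + 2) / p.toReal)) ≤ ‖δ‖ := by
  have hα' := hα.out
  have hpr : 0 < p.toReal := by linarith [one_le_toReal hp]
  have he : 0 ≤ (α + 2) / p.toReal := div_nonneg (by linarith) hpr.le
  obtain ⟨c, b, hc, hb, h⟩ := exists_le_norm_pointEvaluation_near p hp α
  -- For `Re s` in `[b, a)` the test function `2^(-s)` already gives `‖δ‖ ≥ 2^(-a)`, and the target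
  -- is at most its value at `b`.
  set c' : ℝ := 2 ^ (-a) * (b - 1 / 2) ^ ((α + 2) / p.toReal) with hc'
  have hb0 : 0 < b - 1 / 2 := by linarith
  have hc'0 : 0 < c' := by positivity
  refine ⟨min c c', lt_min hc hc'0, fun s δ hs hsa hδ => ?_⟩
  have hd : 0 < s.re - 1 / 2 := by linarith
  rcases lt_or_ge s.re b with hsb | hsb
  · exact le_trans (by gcongr; exact min_le_left _ _) (h s δ hs hsb hδ)
  · have h2 : ((2 : ℕ+) : ℕ) = 2 := rfl
    have h1 := hδ.rpow_le_norm hp (n := 2) (ofPolynomial_mem_bergmanSpaceInfty p α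
      (Finsupp.single_eq_of_ne (by decide)))
    rw [h2, Nat.cast_ofNat] at h1
    refine le_trans ?_ h1
    calc min c c' * (1 / (s.re - 1 / 2) ^ ((α + 2) / p.toReal))
        ≤ c' * (1 / (b - 1 / 2) ^ ((α + 2) / p.toReal)) := by
          gcongr
          exact min_le_right _ _
      _ = 2 ^ (-a) := by
          rw [hc', mul_assoc, mul_one_div_cancel (Real.rpow_pos_of_pos hb0 _).ne', mul_one]
      _ ≤ 2 ^ (-s.re) := by
          gcongr
          norm_num

end

end DirichletBergman

/-! ### Assembly of the two-sided estimates -/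

theorem theorem4p3 (p : ℝ≥0∞) [Fact (1 ≤ p)] (hp : p ≠ ∞) (α : ℝ) [Fact (-1 < α)] :
    ∃ (δ : ℂ → (DirichletBergman.bergmanSpace p α →L[ℂ] ℂ))
      (δ₀ : ℂ → (DirichletBergman.bergmanSpaceInfty p α →L[ℂ] ℂ)),
      (∀ s : ℂ, 1 / 2 < s.re →
        DirichletBergman.IsPointEvaluation (DirichletBergman.bergmanSpace p α) s (δ s) ∧
        DirichletBergman.IsPointEvaluation (DirichletBergman.bergmanSpaceInfty p α) s (δ₀ s)) ∧
      (∀ a : ℝ, 1 / 2 < a → ∃ c C : ℝ, 0 < c ∧ 0 < C ∧ ∀ s : ℂ, 1 / 2 < s.re → s.re < a →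
        c * (1 / (s.re - 1 / 2) ^ ((α + 2) / p.toReal)) ≤ ‖δ₀ s‖ ∧
        ‖δ₀ s‖ ≤ C * (1 / (s.re - 1 / 2) ^ ((α + 2) / p.toReal))) ∧
      (∃ c C : ℝ, 0 < c ∧ 0 < C ∧ ∀ s : ℂ, 1 / 2 < s.re →
        c * (s.re / (s.re - 1 / 2)) ^ ((α + 2) / p.toReal) ≤ ‖δ s‖ ∧
        ‖δ s‖ ≤ C * (s.re / (s.re - 1 / 2)) ^ ((α + 2) / p.toReal)) ∧
      (∃ b c C : ℝ, 1 / 2 < b ∧ 0 < c ∧ 0 < C ∧ ∀ s : ℂ, 1 / 2 < s.re → s.re < b →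
        (c * ‖δ s‖ ≤ ‖δ₀ s‖ ∧ ‖δ₀ s‖ ≤ C * ‖δ s‖) ∧
        (c * (1 / (s.re - 1 / 2) ^ ((α + 2) / p.toReal)) ≤ ‖δ s‖ ∧
          ‖δ s‖ ≤ C * (1 / (s.re - 1 / 2) ^ ((α + 2) / p.toReal))) ∧
        (c * (1 / (s.re - 1 / 2) ^ ((α + 2) / p.toReal)) ≤ ‖δ₀ s‖ ∧
          ‖δ₀ s‖ ≤ C * (1 / (s.re - 1 / 2) ^ ((α + 2) / p.toReal)))) := by
  classical
  have hα' : -1 < α := Fact.out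
  have hpr : 0 < p.toReal := by linarith [DirichletBergman.one_le_toReal hp]
  have he : 0 ≤ (α + 2) / p.toReal := div_nonneg (by linarith) hpr.le
  have hle : DirichletBergman.bergmanSpaceInfty p α ≤ DirichletBergman.bergmanSpace p α :=
    inf_le_left
  have hex : ∀ s : ℂ, ∃ δ : DirichletBergman.bergmanSpace p α →L[ℂ] ℂ, 1 / 2 < s.re →
      DirichletBergman.IsPointEvaluation (DirichletBergman.bergmanSpace p α) s δ := fun s => by
    by_cases hs : 1 / 2 < s.re
    · obtain ⟨δ, hδ⟩ := DirichletBergman.exists_isPointEvaluation p hp α le_rfl hs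
      exact ⟨δ, fun _ => hδ⟩
    · exact ⟨0, fun h => absurd h hs⟩
  have hex₀ : ∀ s : ℂ, ∃ δ : DirichletBergman.bergmanSpaceInfty p α →L[ℂ] ℂ, 1 / 2 < s.re →
      DirichletBergman.IsPointEvaluation (DirichletBergman.bergmanSpaceInfty p α) s δ :=
    fun s => by
    by_cases hs : 1 / 2 < s.re
    · obtain ⟨δ, hδ⟩ := DirichletBergman.exists_isPointEvaluation p hp α hle hs
      exact ⟨δ, fun _ => hδ⟩
    · exact ⟨0, fun h => absurd h hs⟩
  choose δ hδ using hex
  choose δ₀ hδ₀ using hex₀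
  -- Upper bounds are needed only on the full space and lower bounds near the critical line only on
  -- the subspace; this inequality transfers both.
  have hδ₀δ : ∀ s : ℂ, 1 / 2 < s.re → ‖δ₀ s‖ ≤ ‖δ s‖ := fun s hs =>
    DirichletBergman.norm_pointEvaluation_le_of_le hle (hδ₀ s hs) (hδ s hs)
  obtain ⟨C, hC, hup⟩ := DirichletBergman.exists_norm_pointEvaluation_le p hp α
  have hup' : ∀ a : ℝ, 1 / 2 < a → ∀ s : ℂ, 1 / 2 < s.re → s.re < a →
      ‖δ s‖ ≤ C * a ^ ((α + 2) / p.toReal) * (1 / (s.re - 1 / 2) ^ ((α + 2) / p.toReal)) := by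
    intro a ha s hs hsa
    have hd : 0 < s.re - 1 / 2 := by linarith
    have hs0 : 0 < s.re := by linarith
    refine (hup s (δ s) hs (hδ s hs)).trans ?_
    rw [Real.div_rpow hs0.le hd.le, mul_assoc, mul_one_div]
    gcongr
  refine ⟨δ, δ₀, fun s hs => ⟨hδ s hs, hδ₀ s hs⟩, fun a ha => ?_, ?_, ?_⟩
  · obtain ⟨c, hc, hlow⟩ := DirichletBergman.exists_le_norm_pointEvaluation p hp α a
    have ha0 : 0 < a := by linarith
    exact ⟨c, C * a ^ ((α + 2) / p.toReal), hc, by positivity, fun s hs hsa =>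
      ⟨hlow s _ hs hsa (hδ₀ s hs), (hδ₀δ s hs).trans (hup' a ha s hs hsa)⟩⟩
  · obtain ⟨c, hc, hlow⟩ := DirichletBergman.exists_le_norm_pointEvaluation p hp α 1
    refine ⟨min c (1 / 2 ^ ((α + 2) / p.toReal)), C, lt_min hc (by positivity), hC,
      fun s hs => ⟨?_, hup s _ hs (hδ s hs)⟩⟩
    have hd : 0 < s.re - 1 / 2 := by linarith
    have hs0 : 0 < s.re := by linarith
    rcases lt_or_ge s.re 1 with h1 | h1
    · refine le_trans ?_ ((hlow s _ hs h1 (hδ₀ s hs)).trans (hδ₀δ s hs))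
      rw [Real.div_rpow hs0.le hd.le]
      have := Real.rpow_le_one hs0.le h1.le he
      gcongr
      exact min_le_left _ _
    -- For `Re s ≥ 1` the constant function gives `‖δ s‖ ≥ 1`, while `Re s / (Re s - 1/2) ≤ 2`.
    · have h2 := (hδ s hs).rpow_le_norm hp (n := 1)
        (DirichletBergman.ofPolynomial_mem_bergmanSpace p α _)
      rw [PNat.one_coe, Nat.cast_one, Real.one_rpow] at h2
      refine le_trans ?_ h2
      have h3 : s.re / (s.re - 1 / 2) ≤ 2 := by
        rw [div_le_iff₀ hd]
        linarith
      calc _ ≤ 1 / (2 : ℝ) ^ ((α + 2) / p.toReal) * (2 : ℝ) ^ ((α + 2) / p.toReal) := by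
            gcongr
            exact min_le_right _ _
        _ = 1 := one_div_mul_cancel (by positivity)
  · obtain ⟨c, hc, hlow⟩ := DirichletBergman.exists_le_norm_pointEvaluation p hp α 1
    have hlow' : ∀ s : ℂ, 1 / 2 < s.re → s.re < 1 →
        c * (1 / (s.re - 1 / 2) ^ ((α + 2) / p.toReal)) ≤ ‖δ₀ s‖ := fun s hs h1 =>
      hlow s _ hs h1 (hδ₀ s hs)
    have hup1 : ∀ s : ℂ, 1 / 2 < s.re → s.re < 1 →
        ‖δ s‖ ≤ C * (1 / (s.re - 1 / 2) ^ ((α + 2) / p.toReal)) := fun s hs h1 => by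
      simpa only [Real.one_rpow, mul_one] using hup' 1 (by norm_num) s hs h1
    refine ⟨1, min c (c / C), max C 1, by norm_num, lt_min hc (by positivity), by positivity,
      fun s hs h1 => ?_⟩
    have hR : 0 ≤ 1 / (s.re - 1 / 2) ^ ((α + 2) / p.toReal) :=
      div_nonneg zero_le_one (Real.rpow_nonneg (by linarith) _)
    have hδ0 : 0 ≤ ‖δ s‖ := (δ s).opNorm_nonneg
    have h2 : min c (c / C) * (1 / (s.re - 1 / 2) ^ ((α + 2) / p.toReal)) ≤ ‖δ₀ s‖ :=
      (mul_le_mul_of_nonneg_right (min_le_left _ _) hR).trans (hlow' s hs h1)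
    have h3 : ‖δ s‖ ≤ max C 1 * (1 / (s.re - 1 / 2) ^ ((α + 2) / p.toReal)) :=
      (hup1 s hs h1).trans (mul_le_mul_of_nonneg_right (le_max_left _ _) hR)
    refine ⟨⟨?_, (hδ₀δ s hs).trans (le_mul_of_one_le_left hδ0 (le_max_right _ _))⟩,
      ⟨h2.trans (hδ₀δ s hs), h3⟩, ⟨h2, (hδ₀δ s hs).trans h3⟩⟩
    calc min c (c / C) * ‖δ s‖ ≤ c / C * (C * (1 / (s.re - 1 / 2) ^ ((α + 2) / p.toReal))) := by
          gcongr
          · exact min_le_right _ _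
          · exact hup1 s hs h1
      _ = c * (1 / (s.re - 1 / 2) ^ ((α + 2) / p.toReal)) := by field_simp
      _ ≤ ‖δ₀ s‖ := hlow' s hs h1
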